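/- For a set $S\subseteq\mathbb{R}^2$ let $A(S)$ be the number of distinct magnitudes in the open interval $(0,\pi)$ of angles $\angle abc$ with $a,b,c\in S$ distinct, and let $$P(k)=\max\{\#S : S\subseteq\mathbb{R}^2 \text{ not contained in a line},\ A(S)\le k\}.$$ Then $P(3)=5$. Moreover, up to similarity (rigid motions and dilations) there are exactly five optimal configurations, that is, non-collinear sets of $5$ points with $A(S)\le 3$. Writing $v_0,\dots,v_4$ for the vertices of a regular pentagon in cyclic order, they are: 1. the four vertices of a square together with its centre; 2. the regular pentagon $\{v_0,v_1,v_2,v_3,v_4\}$; 3. $\{v_0,v_1,v_2,v_3\}$ together with the intersection point of the diagonals $v_0v_2$ and $v_1v_3$; 4. $\{v_0,v_1,v_2,v_3\}$ together with the intersection point of the lines $v_0v_1$ and $v_2v_3$; 5. $\{v_4,v_0,v_1\}$ together with the two points in which the segment $v_1v_4$ is met by the segments $v_0v_2$ and $v_0v_3$ (equivalently, a triangle with angles $\frac{3\pi}{5},\frac{\pi}{5},\frac{\pi}{5}$ together with the two points of its longest side on the trisectors of the angle $\frac{3\pi}{5}$). No two of these five configurations are similar to each other. -/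

import Mathlib

/-- The Euclidean plane. -/
abbrev Plane : Type := EuclideanSpace ℝ (Fin 2)

/-- The magnitudes, strictly between `0` and `π`, of the angles `∠ a b c` determined by three
distinct points `a`, `b`, `c` of `S`. -/
def angleSet (S : Set Plane) : Set ℝ :=
  {θ | θ ∈ Set.Ioo 0 Real.pi ∧ ∃ a ∈ S, ∃ b ∈ S, ∃ c ∈ S,
    a ≠ b ∧ b ≠ c ∧ a ≠ c ∧ EuclideanGeometry.angle a b c = θ}

/-- `A(S)`, the number of distinct angles in `(0, π)` determined by `S` (possibly infinite). -/
noncomputable def numAngles (S : Set Plane) : ℕ∞ := (angleSet S).encard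

/-- `S` is a point set (finite or infinite) that is not contained in a line and determines at most
`k` distinct angles in `(0, π)`. -/
def IsAdmissible (k : ℕ) (S : Set Plane) : Prop :=
  ¬ Collinear ℝ S ∧ numAngles S ≤ k

/-- The sizes of the non-collinear point sets with at most `k` distinct angles. The number `P(k)`
is the maximum (greatest element) of this set. -/
def admissibleSizes (k : ℕ) : Set ℕ∞ :=
  {n | ∃ S : Set Plane, IsAdmissible k S ∧ S.encard = n}

/-- `S` is an optimal configuration for `k`: it is admissible and attains the maximum `P(k)`. -/
def IsOptimal (k : ℕ) (S : Set Plane) : Prop :=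
  IsAdmissible k S ∧ IsGreatest (admissibleSizes k) S.encard

/-- Two subsets of the plane are similar: a similarity of the plane (a bijection that multiplies
all distances by one positive constant, that is, a rigid motion composed with a dilation) carries
the one onto the other. -/
def SimilarSets (S T : Set Plane) : Prop :=
  ∃ f : Plane ≃ᵈ Plane, f '' S = T

/-- The vertices `pentagonVertex 0, …, pentagonVertex 4`, in cyclic order, of a regular pentagon
inscribed in the unit circle. -/
noncomputable def pentagonVertex (j : ℕ) : Plane :=
  !₂[Real.cos (2 * Real.pi * j / 5), Real.sin (2 * Real.pi * j / 5)]

/-- The four vertices of a square together with its centre. -/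
def squareWithCentre : Set Plane :=
  {!₂[1, 1], !₂[-1, 1], !₂[-1, -1], !₂[1, -1], !₂[0, 0]}

/-- The vertices of a regular pentagon. -/
noncomputable def regularPentagon : Set Plane :=
  {pentagonVertex 0, pentagonVertex 1, pentagonVertex 2, pentagonVertex 3, pentagonVertex 4}

/-- Four vertices `v₀, v₁, v₂, v₃` of a regular pentagon, together with the intersection point of
the diagonals `v₀v₂` and `v₁v₃` of the trapezoid that they form. (The diagonals of a regular
pentagon cut each other in the golden ratio; the longer part of `v₀v₂` is the one at `v₀`.) -/
noncomputable def trapezoidWithDiagonalPoint : Set Plane :=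
  {pentagonVertex 0, pentagonVertex 1, pentagonVertex 2, pentagonVertex 3,
    AffineMap.lineMap (pentagonVertex 0) (pentagonVertex 2) (Real.goldenRatio⁻¹)}

/-- Four vertices `v₀, v₁, v₂, v₃` of a regular pentagon, together with the intersection point of
the lines `v₀v₁` and `v₃v₂`, which carry the legs of the trapezoid that they form. (With `φ` the
golden ratio, this point lies beyond `v₁`, at `1 + φ` side lengths from `v₀`.) -/
noncomputable def trapezoidWithLegPoint : Set Plane :=
  {pentagonVertex 0, pentagonVertex 1, pentagonVertex 2, pentagonVertex 3,
    AffineMap.lineMap (pentagonVertex 0) (pentagonVertex 1) (1 + Real.goldenRatio)}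

/-- Three consecutive vertices `v₄, v₀, v₁` of a regular pentagon, together with the two points in
which the diagonal `v₁v₄` is met by the diagonals `v₀v₂` and `v₀v₃`: an isosceles triangle with
angle `3π/5` at the apex `v₀`, and the two points of its base on the trisectors of that angle. -/
noncomputable def trisectedTriangle : Set Plane :=
  {pentagonVertex 0, pentagonVertex 1, pentagonVertex 4,
    AffineMap.lineMap (pentagonVertex 1) (pentagonVertex 4) (Real.goldenRatio⁻¹),
    AffineMap.lineMap (pentagonVertex 4) (pentagonVertex 1) (Real.goldenRatio⁻¹)}

/-- The five configurations. -/
noncomputable def optimalConfig : Fin 5 → Set Plane :=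
  ![squareWithCentre, regularPentagon, trapezoidWithDiagonalPoint, trapezoidWithLegPoint,
    trisectedTriangle]

/-!
Why no set does better, and why only five sets do as well.

Three distinct angles leave little room: among any four angles of the set two coincide, and the
angle sums of triangles and of adjacent angles turn such coincidences into linear equations.
The argument distinguishes whether some point `p` of the set sees four others in different
directions inside an angle less than `π` (a *fan*, `IsFan`).

If there is a fan, its three consecutive gaps must be one angle `t`, and the angles of the set are
`t`, `2 * t`, `3 * t` only (`fan_equal_gaps`). Triangles at `p` give `n * t = π` with `n` among
`5`, `6`, `7`, and the law of sines in these triangles leaves `t = π / 5` together with distances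
from `p` that agree up to the golden ratio (`fan_distances`). So the fan is a regular pentagon or
a trisected triangle (`fan_coordinates`). Each direction at `p` carries only one point and no
direction can be added, so the whole set consists of these five points (`eq_fan`).

Without a fan, the remaining possibilities are found by looking at the points from the
lexicographically smallest point `p` and sorting them by direction. No line contains four points
and no more than three directions occur. With a segment across a triangle whose inner point is cut
again excluded (`not_cevian`), five points are either two crossing segments with their
intersection point (`IsCrossing`) or an apex with two points on each of two rays (`IsLegs`), and
six points are impossible (`classification`). Chasing angles determines the shapes: two crossing
segments are the diagonals of a square or meet at the angle `2π / 5` (`crossing_right`,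
`crossing_acute`), and the two legs meet at the angle `π / 5` (`legs_angles`).

For the five configurations themselves, every vector between two of their points has a direction
that is a multiple of `π / 4` or `π / 5`. With the table of these multiples (`HasDirections`), their
angles and the similarity invariants that tell them apart (right angles, points between two others,
and so on) are read off by finite computation.
-/

open EuclideanGeometry

/-! ### Cross products and affine frames -/

/-- The cross product (determinant) of two vectors of the plane. -/
def cross (u v : Plane) : ℝ := u 0 * v 1 - u 1 * v 0

theorem cross_swap (u v : Plane) : cross u v = -cross v u := by
  unfold cross; ring

/-- The point with affine coordinates `(x, y)` in the frame with origin `p` and axes `u`, `v`. -/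
noncomputable def framePoint (p u v : Plane) (x y : ℝ) : Plane := p + (x • u + y • v)

theorem cross_framePoint (p u v : Plane) (x₁ y₁ x₂ y₂ x₃ y₃ : ℝ) :
    cross (framePoint p u v x₂ y₂ - framePoint p u v x₁ y₁)
      (framePoint p u v x₃ y₃ - framePoint p u v x₁ y₁) =
      ((x₂ - x₁) * (y₃ - y₁) - (x₃ - x₁) * (y₂ - y₁)) * cross u v := by
  simp [cross, framePoint]; ring

theorem collinear_iff_cross {a b c : Plane} :
    Collinear ℝ {a, b, c} ↔ cross (b - a) (c - a) = 0 := by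
  constructor
  · intro h
    obtain ⟨v, hv⟩ := (collinear_iff_of_mem (p₀ := a) (by simp)).1 h
    obtain ⟨r, hr⟩ := hv b (by simp)
    obtain ⟨s, hs⟩ := hv c (by simp)
    rw [hr, hs]
    simp [cross]; ring
  · intro h
    by_cases hab : b - a = 0
    · rw [sub_eq_zero] at hab
      rw [hab]; simp [collinear_pair]
    · refine (collinear_iff_of_mem (p₀ := a) (by simp)).2 ⟨b - a, ?_⟩
      have hn : (b - a) 0 ^ 2 + (b - a) 1 ^ 2 ≠ 0 := by
        intro h0
        apply hab
        ext i
        fin_cases i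
        · simpa using (by nlinarith [sq_nonneg ((b - a) 0), sq_nonneg ((b - a) 1)] :
            (b - a) 0 ^ 2 = 0)
        · simpa using (by nlinarith [sq_nonneg ((b - a) 0), sq_nonneg ((b - a) 1)] :
            (b - a) 1 ^ 2 = 0)
      rintro q hq
      simp only [Set.mem_insert_iff, Set.mem_singleton_iff] at hq
      rcases hq with rfl | rfl | rfl
      · exact ⟨0, by simp⟩
      · exact ⟨1, by simp⟩
      · refine ⟨((q - a) 0 * (b - a) 0 + (q - a) 1 * (b - a) 1) /
          ((b - a) 0 ^ 2 + (b - a) 1 ^ 2), ?_⟩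
        unfold cross at h
        ext i
        fin_cases i
        · simp only [Fin.zero_eta, vadd_eq_add, PiLp.add_apply, PiLp.smul_apply, smul_eq_mul]
          field_simp
          simp only [PiLp.sub_apply] at h ⊢
          linear_combination (-(b 1 - a 1)) * h
        · simp only [Fin.mk_one, vadd_eq_add, PiLp.add_apply, PiLp.smul_apply, smul_eq_mul]
          field_simp
          simp only [PiLp.sub_apply] at h ⊢
          linear_combination (b 0 - a 0) * h

theorem not_collinear_framePoint {p u v : Plane} (h : cross u v ≠ 0) {x₁ y₁ x₂ y₂ x₃ y₃ : ℝ}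
    (hd : (x₂ - x₁) * (y₃ - y₁) - (x₃ - x₁) * (y₂ - y₁) ≠ 0) :
    ¬ Collinear ℝ {framePoint p u v x₁ y₁, framePoint p u v x₂ y₂, framePoint p u v x₃ y₃} := by
  rw [collinear_iff_cross, cross_framePoint]
  exact mul_ne_zero hd h

@[simp] theorem framePoint_zero_zero (p u v : Plane) : framePoint p u v 0 0 = p := by
  simp [framePoint]

@[simp] theorem framePoint_one_zero (p a v : Plane) : framePoint p (a - p) v 1 0 = a := by
  simp [framePoint]

@[simp] theorem framePoint_zero_one (p u b : Plane) : framePoint p u (b - p) 0 1 = b := by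
  simp [framePoint]

theorem lineMap_framePoint (p u v : Plane) (x₁ y₁ x₂ y₂ t : ℝ) :
    AffineMap.lineMap (framePoint p u v x₁ y₁) (framePoint p u v x₂ y₂) t =
      framePoint p u v ((1 - t) * x₁ + t * x₂) ((1 - t) * y₁ + t * y₂) := by
  ext i
  simp [AffineMap.lineMap_apply, framePoint]; ring

/-- Every point lies in a nondegenerate frame, by Cramer's rule. -/
theorem eq_framePoint {u v : Plane} (h : cross u v ≠ 0) (p q : Plane) :
    q = framePoint p u v (cross (q - p) v / cross u v) (cross u (q - p) / cross u v) := by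
  ext i
  fin_cases i
  · simp only [framePoint, Fin.zero_eta, PiLp.add_apply, PiLp.smul_apply, smul_eq_mul]
    field_simp
    simp only [cross, PiLp.sub_apply]; ring
  · simp only [framePoint, Fin.mk_one, PiLp.add_apply, PiLp.smul_apply, smul_eq_mul]
    field_simp
    simp only [cross, PiLp.sub_apply]; ring

theorem sbtw_framePoint {p u v : Plane} (h : cross u v ≠ 0) {x₁ y₁ x₂ y₂ x₃ y₃ : ℝ} (t : ℝ)
    (h0 : 0 < t) (h1 : t < 1) (hx : x₂ = (1 - t) * x₁ + t * x₃) (hy : y₂ = (1 - t) * y₁ + t * y₃)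
    (hne : x₁ ≠ x₃ ∨ y₁ ≠ y₃) :
    Sbtw ℝ (framePoint p u v x₁ y₁) (framePoint p u v x₂ y₂) (framePoint p u v x₃ y₃) := by
  rw [hx, hy, ← lineMap_framePoint, sbtw_lineMap_iff]
  refine ⟨fun he => ?_, h0, h1⟩
  have e1 : cross u (framePoint p u v x₁ y₁ - framePoint p u v x₃ y₃) = 0 := by
    simp [he, cross]
  have e2 : cross (framePoint p u v x₁ y₁ - framePoint p u v x₃ y₃) v = 0 := by
    simp [he, cross]
  have e1' : (y₁ - y₃) * cross u v = 0 := by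
    rw [← e1]; simp [cross, framePoint]; ring
  have e2' : (x₁ - x₃) * cross u v = 0 := by
    rw [← e2]; simp [cross, framePoint]; ring
  rcases hne with hne | hne
  · exact mul_ne_zero (sub_ne_zero.2 hne) h e2'
  · exact mul_ne_zero (sub_ne_zero.2 hne) h e1'

theorem Sbtw.exists_lineMap {a b c : Plane} (h : Sbtw ℝ a b c) :
    ∃ t : ℝ, 0 < t ∧ t < 1 ∧ b = AffineMap.lineMap a c t := by
  obtain ⟨-, t, ⟨h0, h1⟩, rfl⟩ := sbtw_iff_mem_image_Ioo_and_ne.1 h |>.symm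
  exact ⟨t, h0, h1, rfl⟩

/-! ### Angle sets -/

/-- The angle in a triangle, at its first vertex, is one of the angles of a set containing it. -/
theorem angle_mem_angleSet {S : Set Plane} {a b c : Plane} (ha : a ∈ S) (hb : b ∈ S) (hc : c ∈ S)
    (h : ¬ Collinear ℝ {a, b, c}) : ∠ a b c ∈ angleSet S :=
  ⟨⟨angle_pos_of_not_collinear h, angle_lt_pi_of_not_collinear h⟩, a, ha, b, hb, c, hc,
    ne₁₂_of_not_collinear h, ne₂₃_of_not_collinear h, ne₁₃_of_not_collinear h, rfl⟩

theorem eq_or_of_numAngles_le {S : Set Plane} (h : numAngles S ≤ 3) {x y z w : ℝ}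
    (hx : x ∈ angleSet S) (hy : y ∈ angleSet S) (hz : z ∈ angleSet S) (hw : w ∈ angleSet S)
    (hxy : x ≠ y) (hxz : x ≠ z) (hyz : y ≠ z) : w = x ∨ w = y ∨ w = z := by
  by_contra! hne
  have h4 : ({w, x, y, z} : Set ℝ).encard = 4 := by
    rw [Set.encard_insert_of_notMem (by simp [hne]), Set.encard_insert_of_notMem (by simp [hxy, hxz]),
      Set.encard_pair hyz]
    norm_num
  have hsub : ({w, x, y, z} : Set ℝ) ⊆ angleSet S := by
    intro r hr
    simp only [Set.mem_insert_iff, Set.mem_singleton_iff] at hr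
    rcases hr with rfl | rfl | rfl | rfl <;> assumption
  have := (Set.encard_le_encard hsub).trans h
  rw [h4] at this
  exact absurd this (by decide)

theorem triangle_sum {a b : Plane} (c : Plane) (h : a ≠ b) : ∠ b a c + ∠ a b c + ∠ a c b = Real.pi := by
  have := angle_add_angle_add_angle_eq_pi c h.symm
  rw [angle_comm b c a, angle_comm c a b] at this
  linarith

/-! ### Cevians, and segments across an angle -/

/-- The angles of a nondegenerate triangle with vertices in `S` are positive, sum to `π` and belong
to the angle set of `S`. -/
theorem triangle_angles {S : Set Plane} {a b c : Plane} (ha : a ∈ S) (hb : b ∈ S) (hc : c ∈ S)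
    (h : ¬ Collinear ℝ {a, b, c}) :
    (∠ b a c ∈ angleSet S ∧ ∠ a b c ∈ angleSet S ∧ ∠ a c b ∈ angleSet S) ∧
      (0 < ∠ b a c ∧ 0 < ∠ a b c ∧ 0 < ∠ a c b) ∧ ∠ b a c + ∠ a b c + ∠ a c b = Real.pi := by
  have h1 : ¬ Collinear ℝ {b, a, c} := by rwa [Set.insert_comm]
  have h2 : ¬ Collinear ℝ {a, c, b} := by rwa [Set.pair_comm c b]
  exact ⟨⟨angle_mem_angleSet hb ha hc h1, angle_mem_angleSet ha hb hc h,
    angle_mem_angleSet ha hc hb h2⟩, ⟨angle_pos_of_not_collinear h1, angle_pos_of_not_collinear h,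
    angle_pos_of_not_collinear h2⟩, triangle_sum c (ne₁₂_of_not_collinear h)⟩

theorem exists_framePoint {a b c : Plane} (h : ¬ Collinear ℝ {a, b, c}) :
    ∃ o u v, cross u v ≠ 0 ∧ a = framePoint o u v 0 0 ∧ b = framePoint o u v 1 0 ∧
      c = framePoint o u v 0 1 :=
  ⟨a, b - a, c - a, by rwa [Ne, ← collinear_iff_cross], by simp, by simp, by simp⟩

/-- A set with three angles does not contain a triangle `a b c`, a point `d` of the side `b c` and a
point `e` of the cevian `a d`: the angles at `d` and `e` are too many. -/
theorem not_cevian {S : Set Plane} (hS : numAngles S ≤ 3) {a b c d e : Plane} (ha : a ∈ S)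
    (hb : b ∈ S) (hc : c ∈ S) (hd : d ∈ S) (he : e ∈ S) (h : ¬ Collinear ℝ {a, b, c})
    (hbc : Sbtw ℝ b d c) : ¬ Sbtw ℝ a e d := by
  intro had
  have r1 : ∠ a d b = ∠ b d e := by rw [angle_comm, had.symm.angle_eq_right]
  have r1' : ∠ a d c = ∠ c d e := by rw [angle_comm, had.symm.angle_eq_right]
  have r2 := angle_add_angle_eq_pi_of_angle_eq_pi b had.angle₁₂₃_eq_pi
  have r3 := angle_add_angle_eq_pi_of_angle_eq_pi c had.angle₁₂₃_eq_pi
  have r4 := angle_add_angle_eq_pi_of_angle_eq_pi a hbc.angle₁₂₃_eq_pi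
  have r5 := hbc.angle_eq_left e
  have r6 := hbc.symm.angle_eq_left e
  rw [angle_comm b e a] at r2
  rw [angle_comm c e a] at r3
  obtain ⟨t, ht0, ht1, et⟩ := hbc.exists_lineMap
  obtain ⟨s, hs0, hs1, es⟩ := had.exists_lineMap
  obtain ⟨⟨-, mabd, madb⟩, ⟨pbad, pabd, padb⟩, sabd⟩ := triangle_angles (c := d) ha hb hd (by
    obtain ⟨o, u, v, huv, rfl, rfl, rfl⟩ := exists_framePoint h
    rw [et, lineMap_framePoint]
    exact not_collinear_framePoint huv (by norm_num; positivity))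
  obtain ⟨⟨-, -, madc⟩, ⟨-, -, -⟩, -⟩ := triangle_angles (c := d) ha hc hd (by
    obtain ⟨o, u, v, huv, rfl, rfl, rfl⟩ := exists_framePoint h
    rw [et, lineMap_framePoint]
    exact not_collinear_framePoint huv (by norm_num; linarith))
  have hts := mul_pos hs0 ht0
  have hts' := mul_pos hs0 (sub_pos.2 ht1)
  have hst := mul_pos ht0 (sub_pos.2 hs1)
  have hst' := mul_pos (sub_pos.2 hs1) (sub_pos.2 ht1)
  obtain ⟨⟨-, -, maeb⟩, -, -⟩ := triangle_angles (c := e) ha hb he (by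
    obtain ⟨o, u, v, huv, rfl, rfl, rfl⟩ := exists_framePoint h
    rw [es, et, lineMap_framePoint, lineMap_framePoint]
    exact not_collinear_framePoint huv (ne_of_gt (by nlinarith)))
  obtain ⟨⟨-, -, maec⟩, -, -⟩ := triangle_angles (c := e) ha hc he (by
    obtain ⟨o, u, v, huv, rfl, rfl, rfl⟩ := exists_framePoint h
    rw [es, et, lineMap_framePoint, lineMap_framePoint]
    exact not_collinear_framePoint huv (ne_of_lt (by nlinarith)))
  obtain ⟨⟨mdbe, mbde, mbed⟩, ⟨pdbe, pbde, pbed⟩, sbde⟩ := triangle_angles (c := e) hb hd he (by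
    obtain ⟨o, u, v, huv, rfl, rfl, rfl⟩ := exists_framePoint h
    rw [es, et, lineMap_framePoint, lineMap_framePoint]
    exact not_collinear_framePoint huv (ne_of_gt (by nlinarith)))
  obtain ⟨⟨mdce, mcde, mced⟩, ⟨pdce, pcde, pced⟩, scde⟩ := triangle_angles (c := e) hc hd he (by
    obtain ⟨o, u, v, huv, rfl, rfl, rfl⟩ := exists_framePoint h
    rw [es, et, lineMap_framePoint, lineMap_framePoint]
    exact not_collinear_framePoint huv (ne_of_lt (by nlinarith)))
  obtain ⟨⟨-, -, mbec⟩, ⟨-, -, pbec⟩, sbec⟩ := triangle_angles (c := e) hb hc he (by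
    obtain ⟨o, u, v, huv, rfl, rfl, rfl⟩ := exists_framePoint h
    rw [es, et, lineMap_framePoint, lineMap_framePoint]
    exact not_collinear_framePoint huv (ne_of_gt (by nlinarith)))
  have key := fun {x y z w : ℝ} => @eq_or_of_numAngles_le S hS x y z w
  -- The two angles at `e` above the base agree.
  by_cases heq : ∠ a e b = ∠ a e c
  · -- The exterior angles at `e` exceed the angles at `d`, so the latter are right.
    have hright : ∠ a d b = Real.pi / 2 := by
      by_contra hne
      rcases key maeb mbed madb madc (fun _ => by linarith) (fun _ => by linarith)
        (fun _ => by linarith) with h | h | h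
      · linarith
      · linarith
      · exact hne (by linarith)
    have cov := fun {w : ℝ} (hw : w ∈ angleSet S) => key maeb mbed madb hw (fun _ => by linarith)
        (fun _ => by linarith) (fun _ => by linarith)
    rcases cov mbec with h | h | h
    · rcases cov mdbe with h' | h' | h' <;> linarith
    · linarith
    · have : ∠ a b d = ∠ a b e + ∠ d b e := by
        rw [angle_comm d b e, angle_add_angle_eq_of_sbtw had]
      have : 0 ≤ ∠ a b e := angle_nonneg _ _ _
      have : 0 < ∠ a b e := angle_pos_of_not_collinear (by
        obtain ⟨o, u, v, huv, rfl, rfl, rfl⟩ := exists_framePoint ‹¬ Collinear ℝ {a, b, c}›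
        rw [es, et, lineMap_framePoint, lineMap_framePoint]
        exact not_collinear_framePoint huv (ne_of_gt (by nlinarith)))
      rcases cov mabd with h' | h' | h' <;> linarith
  -- `∠ a e b`, `∠ a e c` and their supplements are different unless one of them is right.
  · by_cases h1 : ∠ a e b = Real.pi / 2
    · have cov := fun {w : ℝ} (hw : w ∈ angleSet S) => key maeb maec mced hw heq
        (fun _ => by linarith) (fun _ => by linarith)
      rcases cov mbec with h | h | h
      · linarith
      · rcases cov madb with h' | h' | h' <;> rcases cov madc with h'' | h'' | h'' <;> linarith
      · linarith
    · by_cases h2 : ∠ a e c = Real.pi / 2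
      · have cov := fun {w : ℝ} (hw : w ∈ angleSet S) => key maeb maec mbed hw heq
          (fun _ => by linarith) (fun _ => by linarith)
        rcases cov mbec with h | h | h
        · rcases cov madb with h' | h' | h' <;> rcases cov madc with h'' | h'' | h'' <;> linarith
        · linarith
        · linarith
      · rcases key maeb maec mbed mced heq (fun _ => h1 (by linarith)) (fun _ => by linarith)
          with h | h | h
        · linarith
        · exact h2 (by linarith)
        · exact heq (by linarith)

/-- Three angles that fill a straight angle: the outer two agree, unless the angles are `π / 4`,
`π / 4` and `π / 2`. -/
theorem eq_or_of_add_add_eq_pi {S : Set Plane} (hS : numAngles S ≤ 3) {u v w : ℝ}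
    (hu : u ∈ angleSet S) (hv : v ∈ angleSet S) (hw : w ∈ angleSet S) (huv : u + v ∈ angleSet S)
    (hvw : v + w ∈ angleSet S) (hsum : u + v + w = Real.pi) :
    u = w ∨ (Real.pi / 4 ≤ u ∧ v = Real.pi / 4 ∧ Real.pi / 4 ≤ w ∧
      ∀ x ∈ angleSet S, Real.pi / 4 ≤ x) := by
  have pu := hu.1.1
  have pv := hv.1.1
  have pw := hw.1.1
  rcases lt_trichotomy u w with h | h | h
  · right
    have cov := fun {x : ℝ} (hx : x ∈ angleSet S) => eq_or_of_numAngles_le hS hu huv hvw hx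
      (by intro; linarith) (by intro; linarith) (by intro; linarith)
    rcases cov hw with h1 | h1 | h1 <;> rcases cov hv with h2 | h2 | h2 <;> try linarith
    refine ⟨by linarith, by linarith, by linarith, fun x hx => ?_⟩
    rcases cov hx with h3 | h3 | h3 <;> linarith
  · exact Or.inl h
  · right
    have cov := fun {x : ℝ} (hx : x ∈ angleSet S) => eq_or_of_numAngles_le hS hw hvw huv hx
      (by intro; linarith) (by intro; linarith) (by intro; linarith)
    rcases cov hu with h1 | h1 | h1 <;> rcases cov hv with h2 | h2 | h2 <;> try linarith
    refine ⟨by linarith, by linarith, by linarith, fun x hx => ?_⟩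
    rcases cov hx with h3 | h3 | h3 <;> linarith

/-- If two points of each side of an angle belong to a set with three angles, then the apex and the
nearer two points form a golden triangle, and the nearer points divide the sides alike. -/
theorem legs_angles {S : Set Plane} (hS : numAngles S ≤ 3) {a b c d e : Plane} (ha : a ∈ S)
    (hb : b ∈ S) (hc : c ∈ S) (hd : d ∈ S) (he : e ∈ S) (h : ¬ Collinear ℝ {a, d, e})
    (hbd : Sbtw ℝ a b d) (hce : Sbtw ℝ a c e) :
    ∠ b a c = Real.pi / 5 ∧ ∠ a b c = 2 * Real.pi / 5 ∧ ∠ b d c = Real.pi / 5 ∧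
      ∠ b c d = Real.pi / 5 ∧ ∠ c e b = Real.pi / 5 ∧ ∠ c b e = Real.pi / 5 := by
  have hpi := Real.pi_pos
  obtain ⟨t, ht0, ht1, et⟩ := hbd.exists_lineMap
  obtain ⟨s, hs0, hs1, es⟩ := hce.exists_lineMap
  have hts := mul_pos hs0 ht0
  have hts' := mul_pos hs0 (sub_pos.2 ht1)
  have hst := mul_pos ht0 (sub_pos.2 hs1)
  have hst' := mul_pos (sub_pos.2 hs1) (sub_pos.2 ht1)
  obtain ⟨⟨mbac, mabc, macb⟩, ⟨pbac, pabc, pacb⟩, sabc⟩ := triangle_angles (c := c) ha hb hc (by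
    obtain ⟨o, u, v, huv, rfl, rfl, rfl⟩ := exists_framePoint h
    rw [es, et, lineMap_framePoint, lineMap_framePoint]
    exact not_collinear_framePoint huv (ne_of_gt (by nlinarith)))
  obtain ⟨⟨mcbd, mbcd, mbdc⟩, ⟨pcbd, pbcd, pbdc⟩, sbcd⟩ := triangle_angles (c := d) hb hc hd (by
    obtain ⟨o, u, v, huv, rfl, rfl, rfl⟩ := exists_framePoint h
    rw [es, et, lineMap_framePoint, lineMap_framePoint]
    exact not_collinear_framePoint huv (ne_of_lt (by nlinarith)))
  obtain ⟨⟨mcbe, mbce, mbec⟩, ⟨pcbe, pbce, pbec⟩, sbce⟩ := triangle_angles (c := e) hb hc he (by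
    obtain ⟨o, u, v, huv, rfl, rfl, rfl⟩ := exists_framePoint h
    rw [es, et, lineMap_framePoint, lineMap_framePoint]
    exact not_collinear_framePoint huv (ne_of_lt (by nlinarith)))
  obtain ⟨⟨mdbe, mbde, mbed⟩, ⟨pdbe, pbde, pbed⟩, sbde⟩ := triangle_angles (c := e) hb hd he (by
    obtain ⟨o, u, v, huv, rfl, rfl, rfl⟩ := exists_framePoint h
    rw [et, lineMap_framePoint]
    exact not_collinear_framePoint huv (ne_of_gt (by nlinarith)))
  obtain ⟨⟨mdce, mcde, mced⟩, ⟨pdce, pcde, pced⟩, scde⟩ := triangle_angles (c := e) hc hd he (by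
    obtain ⟨o, u, v, huv, rfl, rfl, rfl⟩ := exists_framePoint h
    rw [es, lineMap_framePoint]
    exact not_collinear_framePoint huv (ne_of_gt (by nlinarith)))
  obtain ⟨⟨-, mabe, -⟩, -, -⟩ := triangle_angles (c := e) ha hb he (by
    obtain ⟨o, u, v, huv, rfl, rfl, rfl⟩ := exists_framePoint h
    rw [et, lineMap_framePoint]
    exact not_collinear_framePoint huv (ne_of_gt (by nlinarith)))
  obtain ⟨⟨-, macd, -⟩, -, -⟩ := triangle_angles (c := d) ha hc hd (by
    obtain ⟨o, u, v, huv, rfl, rfl, rfl⟩ := exists_framePoint h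
    rw [es, lineMap_framePoint]
    exact not_collinear_framePoint huv (ne_of_lt (by nlinarith)))
  -- At `b` the rays to `a`, `c`, `e`, `d` follow each other, and likewise at `c`.
  have b1 := angle_add_angle_eq_of_sbtw (p := b) hce
  have b2 := angle_add_angle_eq_pi_of_angle_eq_pi c hbd.angle₁₂₃_eq_pi
  have b3 := angle_add_angle_eq_pi_of_angle_eq_pi e hbd.angle₁₂₃_eq_pi
  have c1 := angle_add_angle_eq_of_sbtw (p := c) hbd
  have c2 := angle_add_angle_eq_pi_of_angle_eq_pi b hce.angle₁₂₃_eq_pi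
  have c3 := angle_add_angle_eq_pi_of_angle_eq_pi d hce.angle₁₂₃_eq_pi
  rw [angle_comm c b a] at b2
  rw [angle_comm e b a, angle_comm e b d] at b3
  rw [angle_comm b c a] at c2
  rw [angle_comm d c a] at c3
  -- The angles at the far points agree with those in the large triangles.
  have d1 := hbd.symm.angle_eq_left c
  have d2 := hbd.symm.angle_eq_left e
  have e1 := hce.symm.angle_eq_left b
  have e2 := hce.symm.angle_eq_left d
  have d3 := angle_add_angle_eq_of_sbtw (p := d) hce
  have e3 := angle_add_angle_eq_of_sbtw (p := e) hbd
  rw [angle_comm c e b] at e1 ⊢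
  rw [← d1, ← d2] at d3
  rw [← e1, ← e2] at e3
  have hcbd : ∠ c b d = ∠ c b e + ∠ d b e := by linarith
  have hbce : ∠ b c e = ∠ b c d + ∠ d c e := by linarith
  rw [hcbd] at mcbd
  rw [hbce] at mbce
  rw [← b1] at mabe
  rw [← c1] at macd
  -- A right angle among them would make all angles at least `π / 4`, too much for the big triangle.
  have hu : ∠ a b c = ∠ d b e := by
    rcases eq_or_of_add_add_eq_pi hS mabc mcbe mdbe mabe mcbd (by linarith) with h | ⟨h1, h2, h3, hx⟩
    · exact h
    · linarith [hx _ mbac, hx _ mbdc, hx _ mcde, hx _ mbec, hx _ mbed, hx _ macb]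
  have hu' : ∠ a c b = ∠ d c e := by
    rcases eq_or_of_add_add_eq_pi hS macb mbcd mdce macd mbce (by linarith) with h | ⟨h1, h2, h3, hx⟩
    · exact h
    · linarith [hx _ mbac, hx _ mbdc, hx _ mcde, hx _ mbec, hx _ mbed, hx _ mabc]
  have heq : ∠ a b c = ∠ a c b := by
    by_contra hne
    rcases eq_or_of_numAngles_le hS mabc macb mcbd mbce hne (by intro; linarith)
      (by intro; linarith) with h | h | h
    · linarith
    · linarith
    · exact hne (by linarith)
  have cov := fun {x : ℝ} (hx : x ∈ angleSet S) => eq_or_of_numAngles_le hS mabc mcbe mbce hx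
      (by intro; linarith) (by intro; linarith) (by intro; linarith)
  have h5 : ∠ a b c = 2 * Real.pi / 5 := by
    rcases cov mbdc with h | h | h <;> linarith
  refine ⟨by linarith, h5, by linarith, by linarith, by linarith, by linarith⟩

/-! ### Two segments that cross -/

theorem crossing_not_collinear {a b c d e : Plane} (h : ¬ Collinear ℝ {a, b, e})
    (hac : Sbtw ℝ a e c) (hbd : Sbtw ℝ b e d) :
    ¬ Collinear ℝ {b, c, e} ∧ ¬ Collinear ℝ {c, d, e} ∧ ¬ Collinear ℝ {a, d, e} ∧
      ¬ Collinear ℝ {a, b, d} ∧ ¬ Collinear ℝ {a, b, c} ∧ ¬ Collinear ℝ {b, c, d} ∧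
      ¬ Collinear ℝ {a, c, d} := by
  rw [collinear_iff_cross] at h
  obtain ⟨t, ht0, ht1, rfl⟩ := hac.exists_lineMap
  obtain ⟨s, hs0, hs1, es⟩ := hbd.exists_lineMap
  -- With the crossing point as origin, the four points have coordinates
  -- `(1, 0)`, `(0, 1)`, `(-k, 0)` and `(0, -l)` with `k` and `l` positive.
  set e := AffineMap.lineMap a c t with he
  have huv : cross (a - e) (b - e) ≠ 0 := by
    intro h0; apply h; rw [← h0]; simp [cross]; ring
  have ea : a = framePoint e (a - e) (b - e) 1 0 := by simp
  have eb : b = framePoint e (a - e) (b - e) 0 1 := by simp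
  have ee : e = framePoint e (a - e) (b - e) 0 0 := by simp
  have hk : 0 < (1 - t) / t := div_pos (by linarith) ht0
  have hl : 0 < (1 - s) / s := div_pos (by linarith) hs0
  have ec : c = framePoint e (a - e) (b - e) (-((1 - t) / t)) 0 := by
    have : ∀ i, e i = (1 - t) * a i + t * c i := by
      intro i; simp [he, AffineMap.lineMap_apply]; ring
    ext i
    simp only [framePoint, PiLp.add_apply, PiLp.smul_apply, PiLp.sub_apply, smul_eq_mul]
    field_simp
    linear_combination -this i
  have ed : d = framePoint e (a - e) (b - e) 0 (-((1 - s) / s)) := by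
    have : ∀ i, e i = (1 - s) * b i + s * d i := by
      intro i; rw [es]; simp [AffineMap.lineMap_apply]; ring
    ext i
    simp only [framePoint, PiLp.add_apply, PiLp.smul_apply, PiLp.sub_apply, smul_eq_mul]
    field_simp
    linear_combination -this i
  generalize (1 - t) / t = k at *
  generalize (1 - s) / s = l at *
  have hkl := mul_pos hk hl
  generalize a - e = u at *
  generalize b - e = v at *
  clear_value e
  refine ⟨?_, ?_, ?_, ?_, ?_, ?_, ?_⟩
  · rw [ec, eb, ee]
    simpa using not_collinear_framePoint (p := e) huv (x₁ := 0) (y₁ := 1) (x₂ := -k) (y₂ := 0)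
      (x₃ := 0) (y₃ := 0) (ne_of_gt (by nlinarith))
  · rw [ec, ed, ee]
    simpa using not_collinear_framePoint (p := e) huv (x₁ := -k) (y₁ := 0) (x₂ := 0) (y₂ := -l)
      (x₃ := 0) (y₃ := 0) (ne_of_gt (by nlinarith))
  · rw [ea, ed, ee]
    simpa using not_collinear_framePoint (p := e) huv (x₁ := 1) (y₁ := 0) (x₂ := 0) (y₂ := -l)
      (x₃ := 0) (y₃ := 0) (ne_of_lt (by nlinarith))
  · rw [ea, eb, ed]
    exact not_collinear_framePoint huv (ne_of_gt (by nlinarith))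
  · rw [ea, eb, ec]
    exact not_collinear_framePoint huv (ne_of_gt (by nlinarith))
  · rw [eb, ec, ed]
    exact not_collinear_framePoint huv (ne_of_gt (by nlinarith))
  · rw [ea, ec, ed]
    exact not_collinear_framePoint huv (ne_of_gt (by nlinarith))

/-- The angles of a quadrilateral with perpendicular diagonals, each divided by a diagonal: `a₁`, `b₂`,
`c₂`, `d₂` are next to the following side of the quadrilateral, and `a₂`, `b₁`, `c₁`, `d₁` to the
preceding one. Unless `a₁ = π / 4`, the former agree. -/
theorem eq_pi_div_four_or_of_right {S : Set Plane} (hS : numAngles S ≤ 3)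
    {a₁ a₂ b₁ b₂ c₁ c₂ d₁ d₂ : ℝ} (ha₁ : a₁ ∈ angleSet S) (ha₂ : a₂ ∈ angleSet S)
    (hb₁ : b₁ ∈ angleSet S) (hb₂ : b₂ ∈ angleSet S)
    (hc₂ : c₂ ∈ angleSet S) (hd₂ : d₂ ∈ angleSet S)
    (ha : a₁ + a₂ ∈ angleSet S) (hb : b₁ + b₂ ∈ angleSet S) (hc : c₁ + c₂ ∈ angleSet S)
    (hd : d₁ + d₂ ∈ angleSet S) (hr : Real.pi / 2 ∈ angleSet S) (hab : a₁ + b₁ = Real.pi / 2)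
    (hbc : b₂ + c₁ = Real.pi / 2) (hcd : c₂ + d₁ = Real.pi / 2) (hda : d₂ + a₂ = Real.pi / 2)
    (hc₁ : 0 < c₁) (hd₁ : 0 < d₁) :
    a₁ = Real.pi / 4 ∨ (b₂ = a₁ ∧ c₂ = a₁ ∧ d₂ = a₁) := by
  by_cases hne : a₁ = Real.pi / 4
  · exact Or.inl hne
  right
  have p1 := ha₁.1.1
  have p2 := hb₁.1.1
  have p3 := ha₂.1.1
  have p4 := hb₂.1.1
  have p5 := hc₂.1.1
  have p6 := hd₂.1.1
  have cov := fun {x : ℝ} (hx : x ∈ angleSet S) => eq_or_of_numAngles_le hS ha₁ hb₁ hr hx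
    (fun _ => hne (by linarith)) (by intro; linarith) (by intro; linarith)
  rcases cov hb₂ with h1 | h1 | h1
  · rcases cov hc₂ with h2 | h2 | h2
    · rcases cov hd₂ with h3 | h3 | h3
      · exact ⟨h1, h2, h3⟩
      · exfalso
        rcases cov ha with h | h | h <;> rcases cov hd with h' | h' | h' <;> first
          | linarith
          | exact hne (by linarith)
      · linarith
    · exfalso
      rcases cov hc with h | h | h <;> rcases cov hd₂ with h3 | h3 | h3 <;>
        rcases cov ha with h' | h' | h' <;> rcases cov hd with h'' | h'' | h'' <;> first
          | linarith
          | exact hne (by linarith)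
    · linarith
  · exfalso
    rcases cov hc₂ with h2 | h2 | h2 <;> rcases cov hb with h | h | h <;> try linarith
    all_goals try exact hne (by linarith)
    all_goals rcases cov hc with h' | h' | h' <;> try linarith
    all_goals rcases cov hd₂ with h3 | h3 | h3 <;> try linarith
    all_goals rcases cov hd with h'' | h'' | h'' <;> try linarith
    all_goals rcases cov ha with h4 | h4 | h4 <;> linarith
  · linarith

theorem dist_eq_of_angle_eq {a b e : Plane} (h : ¬ Collinear ℝ {a, b, e}) (hab : ∠ b a e = ∠ a b e) :
    dist e a = dist e b := by
  refine dist_eq_of_angle_eq_angle_of_angle_ne_pi (by rw [angle_comm e a b, angle_comm e b a, hab])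
    (angle_ne_pi_of_not_collinear ?_)
  rwa [Set.pair_comm e b]

/-- If two segments with endpoints in `S` cross at a right angle at a point of `S`, then
neighbouring endpoints are equally far from it, so that the endpoints form a square. -/
theorem crossing_right {S : Set Plane} (hS : numAngles S ≤ 3) {a b c d e : Plane} (ha : a ∈ S)
    (hb : b ∈ S) (hc : c ∈ S) (hd : d ∈ S) (he : e ∈ S) (h : ¬ Collinear ℝ {a, b, e})
    (hac : Sbtw ℝ a e c) (hbd : Sbtw ℝ b e d) (hr : ∠ a e b = Real.pi / 2) :
    dist e a = dist e b := by
  obtain ⟨nbce, ncde, nade, nabd, nabc, nbcd, nacd⟩ := crossing_not_collinear h hac hbd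
  obtain ⟨⟨mbae, mabe, maeb⟩, ⟨pbae, pabe, paeb⟩, sabe⟩ := triangle_angles ha hb he h
  obtain ⟨⟨mcbe, mbce, mbec⟩, ⟨pcbe, pbce, pbec⟩, sbce⟩ := triangle_angles hb hc he nbce
  obtain ⟨⟨mdce, mcde, mced⟩, ⟨pdce, pcde, pced⟩, scde⟩ := triangle_angles hc hd he ncde
  obtain ⟨⟨mdae, made, maed⟩, ⟨pdae, pade, paed⟩, sade⟩ := triangle_angles ha hd he nade
  obtain ⟨⟨mbad, -, -⟩, -, -⟩ := triangle_angles ha hb hd nabd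
  obtain ⟨⟨-, mabc, -⟩, -, -⟩ := triangle_angles ha hb hc nabc
  obtain ⟨⟨-, mbcd, -⟩, -, -⟩ := triangle_angles hb hc hd nbcd
  obtain ⟨⟨-, -, madc⟩, -, -⟩ := triangle_angles ha hc hd nacd
  have a1 := angle_add_angle_eq_of_sbtw (p := a) hbd
  have a2 := angle_add_angle_eq_of_sbtw (p := b) hac
  have a3 := angle_add_angle_eq_of_sbtw (p := c) hbd
  have a4 := angle_add_angle_eq_of_sbtw (p := d) hac
  have e1 := angle_add_angle_eq_pi_of_angle_eq_pi b hac.angle₁₂₃_eq_pi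
  have e2 := angle_add_angle_eq_pi_of_angle_eq_pi a hbd.angle₁₂₃_eq_pi
  have e3 := angle_add_angle_eq_pi_of_angle_eq_pi c hbd.angle₁₂₃_eq_pi
  rw [angle_comm e a d] at a1
  rw [angle_comm e b c] at a2
  rw [angle_comm e c d] at a3
  rw [angle_comm e d c, add_comm] at a4
  rw [angle_comm b e a] at e1
  rw [angle_comm c e b] at e3
  by_cases hq : ∠ b a e = Real.pi / 4
  · exact dist_eq_of_angle_eq h (by linarith)
  exfalso
  rcases eq_pi_div_four_or_of_right hS mbae mdae mabe mcbe mdce made (by rwa [a1]) (by rwa [a2])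
    (by rwa [a3]) (by rwa [a4]) (by rwa [← hr]) (by linarith) (by linarith) (by linarith)
    (by linarith) pbce pcde with h0 | ⟨h1, h2, h3⟩
  · exact hq h0
  -- Otherwise the distances from the crossing point increase, or decrease, all the way round.
  have lt : ∀ {x y : Plane}, ¬ Collinear ℝ {x, y, e} → ∠ y x e < ∠ x y e → dist e y < dist e x := by
    intro x y hn hlt
    refine dist_lt_of_angle_lt ?_ (by rwa [angle_comm e x y, angle_comm e y x])
    rwa [show ({e, y, x} : Set Plane) = {x, y, e} by
      ext; simp only [Set.mem_insert_iff, Set.mem_singleton_iff]; tauto]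
  have swap : ∀ {x y : Plane}, ¬ Collinear ℝ {x, y, e} → ¬ Collinear ℝ {y, x, e} := by
    intro x y hn; rwa [Set.insert_comm]
  rcases lt_or_gt_of_ne hq with hlt | hlt
  · linarith [lt h (by linarith), lt nbce (by linarith), lt ncde (by linarith),
      lt (swap nade) (by linarith)]
  · linarith [lt (swap h) (by linarith), lt (swap nbce) (by linarith), lt (swap ncde) (by linarith),
      lt nade (by linarith)]

/-- If two segments with endpoints in `S` cross at an acute angle at a point of `S`, then this angle
is `2 * π / 5`. -/
theorem crossing_acute {S : Set Plane} (hS : numAngles S ≤ 3) {a b c d e : Plane} (ha : a ∈ S)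
    (hb : b ∈ S) (hc : c ∈ S) (hd : d ∈ S) (he : e ∈ S) (h : ¬ Collinear ℝ {a, b, e})
    (hac : Sbtw ℝ a e c) (hbd : Sbtw ℝ b e d) (hr : ∠ a e b < Real.pi / 2) :
    ∠ a e b = 2 * Real.pi / 5 ∧ dist e b = dist e c ∧ dist e a = dist e d ∧
      ((∠ b a e = 2 * Real.pi / 5 ∧ ∠ a b e = Real.pi / 5) ∨
        (∠ b a e = Real.pi / 5 ∧ ∠ a b e = 2 * Real.pi / 5)) := by
  obtain ⟨nbce, ncde, nade, nabd, nabc, nbcd, nacd⟩ := crossing_not_collinear h hac hbd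
  obtain ⟨⟨mbae, mabe, maeb⟩, ⟨pbae, pabe, paeb⟩, sabe⟩ := triangle_angles ha hb he h
  obtain ⟨⟨mcbe, mbce, mbec⟩, ⟨pcbe, pbce, pbec⟩, sbce⟩ := triangle_angles hb hc he nbce
  obtain ⟨⟨mdae, made, maed⟩, ⟨pdae, pade, paed⟩, sade⟩ := triangle_angles ha hd he nade
  obtain ⟨⟨mbad, -, -⟩, -, -⟩ := triangle_angles ha hb hd nabd
  have a1 := angle_add_angle_eq_of_sbtw (p := a) hbd
  have e1 := angle_add_angle_eq_pi_of_angle_eq_pi b hac.angle₁₂₃_eq_pi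
  have e2 := angle_add_angle_eq_pi_of_angle_eq_pi a hbd.angle₁₂₃_eq_pi
  rw [angle_comm e a d] at a1
  rw [angle_comm b e a] at e1
  -- The triangles with the obtuse angle are isosceles.
  have hiso : ∀ {x y : ℝ}, x ∈ angleSet S → y ∈ angleSet S → x + y = ∠ a e b → x = y := by
    intro x y hx hy hxy
    by_contra hne
    have := hx.1.1
    have := hy.1.1
    rcases eq_or_of_numAngles_le hS hx hy maeb mbec hne (by intro; linarith) (by intro; linarith)
      with h | h | h <;> linarith
  have hb1 := hiso mcbe mbce (by linarith)
  have hd1 := hiso mdae made (by linarith)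
  have cov := fun {x : ℝ} (hx : x ∈ angleSet S) => eq_or_of_numAngles_le hS mdae maeb mbec hx
      (by intro; linarith) (by intro; linarith) (by intro; linarith)
  refine and_comm.1 ⟨⟨dist_eq_of_angle_eq nbce hb1, dist_eq_of_angle_eq nade hd1, ?_⟩, ?_⟩
  all_goals
    rcases cov mbae with h1 | h1 | h1 <;> rcases cov mabe with h2 | h2 | h2 <;> try linarith
  · exact Or.inr ⟨by linarith, by linarith⟩
  · exact Or.inl ⟨by linarith, by linarith⟩
  · exfalso
    rw [← a1] at mbad
    rcases cov mbad with h | h | h <;> linarith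
  · exfalso
    rw [← a1] at mbad
    rcases cov mbad with h | h | h <;> linarith

/-! ### Fans -/

/-- The points `a`, `b`, `c`, `d` are seen from `p` in this order, in four different directions
inside an angle less than `π`. The sign of `s` is the orientation of the fan. -/
def IsFan (p a b c d : Plane) : Prop :=
  ∃ s : ℝ, 0 < s * cross (a - p) (b - p) ∧ 0 < s * cross (a - p) (c - p) ∧
    0 < s * cross (a - p) (d - p) ∧ 0 < s * cross (b - p) (c - p) ∧
    0 < s * cross (b - p) (d - p) ∧ 0 < s * cross (c - p) (d - p)

theorem not_collinear_of_cross_pos {s : ℝ} {p a b : Plane} (h : 0 < s * cross (a - p) (b - p)) :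
    ¬ Collinear ℝ {p, a, b} := by
  rw [collinear_iff_cross]
  intro h0; simp [h0] at h

theorem angle_add_of_eq_add {x y z : Plane} {k l : ℝ} (hk : 0 ≤ k) (hl : 0 ≤ l) (hy : y ≠ 0)
    (h : y = k • x + l • z) :
    InnerProductGeometry.angle x y + InnerProductGeometry.angle y z =
      InnerProductGeometry.angle x z := by
  refine (InnerProductGeometry.angle_eq_angle_add_add_angle_add_of_mem_span hy ?_).symm
  rw [Submodule.mem_span_pair]
  exact ⟨⟨k, hk⟩, ⟨l, hl⟩, h.symm⟩

theorem angle_add_of_cross_pos {s : ℝ} {p a b c : Plane} (hab : 0 < s * cross (a - p) (b - p))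
    (hbc : 0 < s * cross (b - p) (c - p)) (hac : 0 < s * cross (a - p) (c - p)) :
    ∠ a p b + ∠ b p c = ∠ a p c := by
  have hs : s ≠ 0 := by rintro rfl; simp at hab
  have hac0 : cross (a - p) (c - p) ≠ 0 := fun h0 => by simp [h0] at hac
  have hb : b - p ≠ 0 := fun h0 => by simp [h0, cross] at hab
  have h1 : 0 ≤ cross (b - p) (c - p) / cross (a - p) (c - p) := by
    rw [← mul_div_mul_left _ _ hs]; positivity
  have h2 : 0 ≤ cross (a - p) (b - p) / cross (a - p) (c - p) := by
    rw [← mul_div_mul_left _ _ hs]; positivity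
  have := eq_framePoint hac0 p b
  rw [framePoint, ← sub_eq_iff_eq_add'] at this
  exact angle_add_of_eq_add h1 h2 hb this

/-- A point of a set with three angles sees no five of its points in a half-plane, in different
directions. -/
theorem not_five_fan {S : Set Plane} (hS : numAngles S ≤ 3) {p a b c d e : Plane} (hp : p ∈ S)
    (ha : a ∈ S) (hb : b ∈ S) (hc : c ∈ S) (hd : d ∈ S) (he : e ∈ S) {s : ℝ}
    (hab : 0 < s * cross (a - p) (b - p)) (hac : 0 < s * cross (a - p) (c - p))
    (had : 0 < s * cross (a - p) (d - p)) (hae : 0 < s * cross (a - p) (e - p))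
    (hbc : 0 < s * cross (b - p) (c - p)) (hcd : 0 < s * cross (c - p) (d - p))
    (hde : 0 < s * cross (d - p) (e - p)) : False := by
  have mem : ∀ {x y : Plane}, x ∈ S → y ∈ S → 0 < s * cross (x - p) (y - p) →
      ∠ x p y ∈ angleSet S := by
    intro x y hx hy h
    have := not_collinear_of_cross_pos h
    exact angle_mem_angleSet hx hp hy (by rwa [Set.insert_comm])
  have h1 := angle_add_of_cross_pos hab hbc hac
  have h2 := angle_add_of_cross_pos hac hcd had
  have h3 := angle_add_of_cross_pos had hde hae
  have p1 := (mem hb hc hbc).1.1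
  have p2 := (mem hc hd hcd).1.1
  have p3 := (mem hd he hde).1.1
  rcases eq_or_of_numAngles_le hS (mem ha hb hab) (mem ha hc hac) (mem ha hd had) (mem ha he hae)
    (by intro; linarith) (by intro; linarith) (by intro; linarith) with h | h | h <;> linarith

/-- The angles from the first point of a fan to the other three already exhaust the angle set, so the
remaining angles of the fan must be among them. -/
theorem fan_equal_gaps {S : Set Plane} (hS : numAngles S ≤ 3) {p a b c d : Plane} (hp : p ∈ S)
    (ha : a ∈ S) (hb : b ∈ S) (hc : c ∈ S) (hd : d ∈ S) (h : IsFan p a b c d) :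
    0 < ∠ a p b ∧ ∠ b p c = ∠ a p b ∧ ∠ c p d = ∠ a p b ∧ ∠ a p c = 2 * ∠ a p b ∧
      ∠ b p d = 2 * ∠ a p b ∧ ∠ a p d = 3 * ∠ a p b ∧
      ∀ x ∈ angleSet S, x = ∠ a p b ∨ x = 2 * ∠ a p b ∨ x = 3 * ∠ a p b := by
  obtain ⟨s, hab, hac, had, hbc, hbd, hcd⟩ := h
  have mem : ∀ {x y : Plane}, x ∈ S → y ∈ S → 0 < s * cross (x - p) (y - p) →
      ∠ x p y ∈ angleSet S := by
    intro x y hx hy h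
    have := not_collinear_of_cross_pos h
    exact angle_mem_angleSet hx hp hy (by rwa [Set.insert_comm])
  have h1 := angle_add_of_cross_pos hab hbc hac
  have h2 := angle_add_of_cross_pos hac hcd had
  have h3 := angle_add_of_cross_pos hbc hcd hbd
  have p0 := (mem ha hb hab).1.1
  have p1 := (mem hb hc hbc).1.1
  have p2 := (mem hc hd hcd).1.1
  have cov := fun {x : ℝ} (hx : x ∈ angleSet S) => eq_or_of_numAngles_le hS (mem ha hb hab)
    (mem ha hc hac) (mem ha hd had) hx (by intro; linarith) (by intro; linarith)
    (by intro; linarith)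
  have hbc' : ∠ b p c = ∠ a p b := by
    rcases cov (mem hb hc hbc) with h | h | h <;> rcases cov (mem hb hd hbd) with h' | h' | h' <;>
      linarith
  have hbd' : ∠ b p d = ∠ a p c := by
    rcases cov (mem hb hd hbd) with h' | h' | h' <;> linarith
  refine ⟨p0, hbc', by linarith, by linarith, by linarith, by linarith, fun x hx => ?_⟩
  rcases cov hx with h | h | h
  · left; exact h
  · right; left; linarith
  · right; right; linarith

/-- The law of sines in the triangle `p`, `x`, `y`, with the angles at `x` and `y` that a fan at `p`
with gap `t` allows. -/
theorem fan_triangle {S : Set Plane} {t : ℝ}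
    (hcov : ∀ x ∈ angleSet S, x = t ∨ x = 2 * t ∨ x = 3 * t) {p x y : Plane} (hp : p ∈ S)
    (hx : x ∈ S) (hy : y ∈ S) (h : ¬ Collinear ℝ {p, x, y}) :
    ∃ i j : ℕ, (i = 1 ∨ i = 2 ∨ i = 3) ∧ (j = 1 ∨ j = 2 ∨ j = 3) ∧
      ∠ x p y + (i + j) * t = Real.pi ∧ Real.sin (i * t) * dist p x = Real.sin (j * t) * dist p y ∧
      (i = j → dist p x = dist p y) ∧ (dist p x = dist p y → i = j) := by
  obtain ⟨⟨-, mx, my⟩, -, hsum⟩ := triangle_angles hp hx hy h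
  have cov : ∀ θ ∈ angleSet S, ∃ i : ℕ, (i = 1 ∨ i = 2 ∨ i = 3) ∧ θ = i * t := by
    intro θ hθ
    rcases hcov θ hθ with rfl | rfl | rfl
    · exact ⟨1, by simp, by simp⟩
    · exact ⟨2, by simp, by simp⟩
    · exact ⟨3, by simp, by simp⟩
  obtain ⟨i, hi, ei⟩ := cov _ mx
  obtain ⟨j, hj, ej⟩ := cov _ my
  refine ⟨i, j, hi, hj, ?_, ?_, ?_, ?_⟩
  · rw [ei, ej] at hsum; linarith
  · have := law_sin y x p
    rw [angle_comm y x p, ei, ej, dist_comm x p] at this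
    exact this
  · rintro rfl
    exact dist_eq_of_angle_eq_angle_of_angle_ne_pi (ei.trans ej.symm)
      (angle_ne_pi_of_not_collinear (by rwa [Set.insert_comm]))
  · intro hd
    have h1 := angle_eq_angle_of_dist_eq hd
    rw [ei, ej] at h1
    have h2 : t ≠ 0 := by
      rintro rfl
      have := mx.1.1
      rw [ei] at this; simp at this
    exact_mod_cast mul_right_cancel₀ h2 h1

theorem sin_pi_div_five_pos : 0 < Real.sin (Real.pi / 5) :=
  Real.sin_pos_of_pos_of_lt_pi (by positivity) (by linarith [Real.pi_pos])

theorem cos_pi_div_five_eq : Real.cos (Real.pi / 5) = Real.goldenRatio / 2 := by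
  rw [Real.cos_pi_div_five, Real.goldenRatio]; ring

theorem sin_two_pi_div_five :
    Real.sin (2 * (Real.pi / 5)) = Real.goldenRatio * Real.sin (Real.pi / 5) := by
  rw [Real.sin_two_mul, cos_pi_div_five_eq]; ring

theorem sin_three_pi_div_five :
    Real.sin (3 * (Real.pi / 5)) = Real.goldenRatio * Real.sin (Real.pi / 5) := by
  rw [← sin_two_pi_div_five, ← Real.sin_pi_sub]; congr 1; ring

theorem pentagonal_ratio_of_add_eq_three {i j : ℕ} {x y : ℝ} (hi : i = 1 ∨ i = 2 ∨ i = 3)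
    (hj : j = 1 ∨ j = 2 ∨ j = 3) (hij : i + j = 3)
    (hl : Real.sin (i * (Real.pi / 5)) * x = Real.sin (j * (Real.pi / 5)) * y) :
    x = Real.goldenRatio * y ∨ y = Real.goldenRatio * x := by
  have hs := sin_pi_div_five_pos
  have : (i = 1 ∧ j = 2) ∨ (i = 2 ∧ j = 1) := by omega
  rcases this with ⟨rfl, rfl⟩ | ⟨rfl, rfl⟩
  · left
    push_cast at hl
    rw [sin_two_pi_div_five, one_mul] at hl
    apply mul_left_cancel₀ hs.ne'; linarith
  · right
    push_cast at hl
    rw [sin_two_pi_div_five, one_mul] at hl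
    apply mul_left_cancel₀ hs.ne'; linarith

theorem pentagonal_ratio_of_add_eq_four {i j : ℕ} {x y : ℝ} (hi : i = 1 ∨ i = 2 ∨ i = 3)
    (hj : j = 1 ∨ j = 2 ∨ j = 3) (hij : i + j = 4)
    (hl : Real.sin (i * (Real.pi / 5)) * x = Real.sin (j * (Real.pi / 5)) * y) :
    x = y ∨ x = Real.goldenRatio * y ∨ y = Real.goldenRatio * x := by
  have hs := sin_pi_div_five_pos
  have hφ := Real.goldenRatio_pos
  have : (i = 1 ∧ j = 3) ∨ (i = 2 ∧ j = 2) ∨ (i = 3 ∧ j = 1) := by omega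
  rcases this with ⟨rfl, rfl⟩ | ⟨rfl, rfl⟩ | ⟨rfl, rfl⟩
  · right; left
    push_cast at hl
    rw [sin_three_pi_div_five, one_mul] at hl
    apply mul_left_cancel₀ hs.ne'; linarith
  · left
    push_cast at hl
    rw [sin_two_pi_div_five] at hl
    exact mul_left_cancel₀ (by positivity) hl
  · right; right
    push_cast at hl
    rw [sin_three_pi_div_five, one_mul] at hl
    apply mul_left_cancel₀ hs.ne'; linarith

theorem sin_two_pi_div_six : Real.sin (2 * (Real.pi / 6)) = √3 / 2 := by
  rw [← Real.sin_pi_div_three]; congr 1; ring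

theorem hexagonal_ratio_of_add_eq_five {i j : ℕ} {x y : ℝ} (hi : i = 1 ∨ i = 2 ∨ i = 3)
    (hj : j = 1 ∨ j = 2 ∨ j = 3) (hij : i + j = 5)
    (hl : Real.sin (i * (Real.pi / 6)) * x = Real.sin (j * (Real.pi / 6)) * y) :
    3 * x ^ 2 = 4 * y ^ 2 ∨ 4 * x ^ 2 = 3 * y ^ 2 := by
  have q2 : Real.sin (3 * (Real.pi / 6)) = 1 := by
    rw [← Real.sin_pi_div_two]; congr 1; ring
  have q3 : √(3 : ℝ) ^ 2 = 3 := Real.sq_sqrt (by norm_num)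
  have : (i = 2 ∧ j = 3) ∨ (i = 3 ∧ j = 2) := by omega
  rcases this with ⟨rfl, rfl⟩ | ⟨rfl, rfl⟩
  · left
    push_cast at hl
    rw [sin_two_pi_div_six, q2, one_mul] at hl
    rw [← hl]; linear_combination (-x ^ 2) * q3
  · right
    push_cast at hl
    rw [sin_two_pi_div_six, q2, one_mul] at hl
    rw [hl]; linear_combination (y ^ 2) * q3

theorem hexagonal_ratio_of_add_eq_three {i j : ℕ} {x y : ℝ} (hi : i = 1 ∨ i = 2 ∨ i = 3)
    (hj : j = 1 ∨ j = 2 ∨ j = 3) (hij : i + j = 3)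
    (hl : Real.sin (i * (Real.pi / 6)) * x = Real.sin (j * (Real.pi / 6)) * y) :
    3 * x ^ 2 = y ^ 2 ∨ x ^ 2 = 3 * y ^ 2 := by
  have q3 : √(3 : ℝ) ^ 2 = 3 := Real.sq_sqrt (by norm_num)
  have : (i = 1 ∧ j = 2) ∨ (i = 2 ∧ j = 1) := by omega
  rcases this with ⟨rfl, rfl⟩ | ⟨rfl, rfl⟩
  · right
    push_cast at hl
    rw [sin_two_pi_div_six, one_mul, Real.sin_pi_div_six] at hl
    have : x = √3 * y := by linarith
    rw [this, mul_pow, q3]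
  · left
    push_cast at hl
    rw [sin_two_pi_div_six, one_mul, Real.sin_pi_div_six] at hl
    have : y = √3 * x := by linarith
    rw [this, mul_pow, q3]

theorem golden_distances {a b c : ℝ} (hb : 0 < b) (hc : 0 < c)
    (hac : a = Real.goldenRatio * c ∨ c = Real.goldenRatio * a)
    (hba : b = Real.goldenRatio * a ∨ a = Real.goldenRatio * b)
    (hbc : b = c ∨ b = Real.goldenRatio * c ∨ c = Real.goldenRatio * b) :
    c = b ∧ (b = Real.goldenRatio * a ∨ a = Real.goldenRatio * b) := by
  have hφ := Real.one_lt_goldenRatio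
  have hφ2 := Real.goldenRatio_sq
  -- `b` and `c` differ by a factor `φ` at most, hence not by `φ ^ 2`.
  have hno : ∀ {x y : ℝ}, 0 < x → 0 < y → x = Real.goldenRatio ^ 2 * y → x = y ∨
      x = Real.goldenRatio * y ∨ y = Real.goldenRatio * x → False := by
    intro x y hx hy h h'
    rw [hφ2] at h
    rcases h' with h' | h' | h' <;> nlinarith
  rcases hac with r1 | r1 <;> rcases hba with r2 | r2
  · exact (hno hb hc (by rw [r2, r1]; ring) hbc).elim
  · exact ⟨mul_left_cancel₀ Real.goldenRatio_ne_zero (by rw [← r1, ← r2]), Or.inr r2⟩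
  · exact ⟨r1.trans r2.symm, Or.inl r2⟩
  · exact (hno hc hb (by rw [r1, r2]; ring) (by tauto)).elim

/-- Three factors `(4 / 3) ^ (±1)` do not multiply to `3 ^ (±1)`. -/
theorem hexagonal_distances {a b c d : ℝ} (ha : 0 < a) (hd : 0 < d)
    (hab : 3 * a = 4 * b ∨ 4 * a = 3 * b) (hbc : 3 * b = 4 * c ∨ 4 * b = 3 * c)
    (hcd : 3 * c = 4 * d ∨ 4 * c = 3 * d) (had : 3 * a = d ∨ a = 3 * d) : False := by
  rcases hab with r1 | r1 <;> rcases hbc with r2 | r2 <;> rcases hcd with r3 | r3 <;>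
    rcases had with r | r <;> linarith

/-- A fan in a set with three angles: the gaps are `π / 5`, the outer points are equally far away,
and so are the inner points, with golden ratio to the outer ones. -/
theorem fan_distances {S : Set Plane} (hS : numAngles S ≤ 3) {p a b c d : Plane} (hp : p ∈ S)
    (ha : a ∈ S) (hb : b ∈ S) (hc : c ∈ S) (hd : d ∈ S) (h : IsFan p a b c d) :
    ∠ a p b = Real.pi / 5 ∧ dist p d = dist p a ∧ dist p c = dist p b ∧
      (dist p b = Real.goldenRatio * dist p a ∨ dist p a = Real.goldenRatio * dist p b) := by
  -- In a triangle at `p` over one gap `t`, the other two angles are `i * t` and `j * t`, so that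
  -- `(i + j + 1) * t = π`; over all three gaps, they are `g * t` and `g' * t`.
  have range : ∀ {i j g g' : ℕ}, (i = 1 ∨ i = 2 ∨ i = 3) → (j = 1 ∨ j = 2 ∨ j = 3) →
      (g = 1 ∨ g = 2 ∨ g = 3) → (g' = 1 ∨ g' = 2 ∨ g' = 3) → g + g' + 2 = i + j →
      i + j = 4 ∨ i + j = 5 ∨ i + j = 6 := by omega
  have two : ∀ {i j : ℕ}, (i = 1 ∨ i = 2 ∨ i = 3) → (j = 1 ∨ j = 2 ∨ j = 3) → i + j = 2 →
      i = j := by omega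
  have six : ∀ {i j : ℕ}, (i = 1 ∨ i = 2 ∨ i = 3) → (j = 1 ∨ j = 2 ∨ j = 3) → i + j = 6 →
      i = j := by omega
  have odd : ∀ {i j : ℕ}, i = j → i + j ≠ 5 := by omega
  obtain ⟨t0, h1, h2, h3, h4, h5, cov⟩ := fan_equal_gaps hS hp ha hb hc hd h
  obtain ⟨s, hab, hac, had, hbc, hbd, hcd⟩ := h
  obtain ⟨i, j, hi, hj, s1, l1, d1, -⟩ :=
    fan_triangle cov hp ha hb (not_collinear_of_cross_pos hab)
  obtain ⟨i', j', hi', hj', s2, l2, d2, -⟩ :=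
    fan_triangle cov hp hb hc (not_collinear_of_cross_pos hbc)
  obtain ⟨k, l, hk, hl, s3, l3, -, -⟩ :=
    fan_triangle cov hp hc hd (not_collinear_of_cross_pos hcd)
  obtain ⟨m, n, hm, hn, s4, l4, -, d4'⟩ :=
    fan_triangle cov hp ha hc (not_collinear_of_cross_pos hac)
  obtain ⟨m', n', hm', hn', s5, l5, -, -⟩ :=
    fan_triangle cov hp hb hd (not_collinear_of_cross_pos hbd)
  obtain ⟨g, g', hg, hg', s6, l6, d6, -⟩ :=
    fan_triangle cov hp ha hd (not_collinear_of_cross_pos had)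
  have pa : 0 < dist p a := dist_pos.2 (ne₁₂_of_not_collinear (not_collinear_of_cross_pos hab))
  have pb : 0 < dist p b := dist_pos.2 (ne₁₂_of_not_collinear (not_collinear_of_cross_pos hbc))
  have pc : 0 < dist p c := dist_pos.2 (ne₁₂_of_not_collinear (not_collinear_of_cross_pos hcd))
  have pd : 0 < dist p d := dist_pos.2 (ne₁₃_of_not_collinear (not_collinear_of_cross_pos hcd))
  rw [h1] at s2
  rw [h2] at s3
  rw [h3] at s4
  rw [h4] at s5
  rw [h5] at s6
  generalize ∠ a p b = t at *
  have e2 : i' + j' = i + j := by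
    have : ((i' + j' : ℝ)) = i + j := by
      apply mul_right_cancel₀ t0.ne'; linarith
    exact_mod_cast this
  have e3 : k + l = i + j := by
    have : ((k + l : ℝ)) = i + j := by
      apply mul_right_cancel₀ t0.ne'; linarith
    exact_mod_cast this
  have e4 : m + n + 1 = i + j := by
    have : ((m + n + 1 : ℝ)) = i + j := by
      apply mul_right_cancel₀ t0.ne'; linarith
    exact_mod_cast this
  have e5 : m' + n' + 1 = i + j := by
    have : ((m' + n' + 1 : ℝ)) = i + j := by
      apply mul_right_cancel₀ t0.ne'; linarith
    exact_mod_cast this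
  have e6 : g + g' + 2 = i + j := by
    have : ((g + g' + 2 : ℝ)) = i + j := by
      apply mul_right_cancel₀ t0.ne'; linarith
    exact_mod_cast this
  have hij := range hi hj hg hg' e6
  rcases hij with hij | hij | hij
  · -- The gap is `π / 5`.
    have ht : t = Real.pi / 5 := by
      have : ((i + j : ℝ)) = 4 := by exact_mod_cast hij
      rw [this] at s1; linarith
    have hda := d6 (two hg hg' (by linarith only [e6, hij]))
    refine ⟨ht, hda.symm, ?_⟩
    subst ht
    have r1 := pentagonal_ratio_of_add_eq_three hm hn (by linarith only [e4, hij]) l4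
    have r2 := pentagonal_ratio_of_add_eq_three hm' hn' (by linarith only [e5, hij]) l5
    have r3 := pentagonal_ratio_of_add_eq_four hi' hj' (e2.trans hij) l2
    rw [← hda] at r2
    exact golden_distances pb pc r1 r2 r3
  · -- The gap is `π / 6`. Neighbouring distances have ratio `√3 / 2`, the outer ones `√3`.
    exfalso
    have ht : t = Real.pi / 6 := by
      have : ((i + j : ℝ)) = 5 := by exact_mod_cast hij
      rw [this] at s1; linarith
    subst ht
    exact hexagonal_distances (pow_pos pa 2) (pow_pos pd 2)
      (hexagonal_ratio_of_add_eq_five hi hj hij l1)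
      (hexagonal_ratio_of_add_eq_five hi' hj' (e2.trans hij) l2)
      (hexagonal_ratio_of_add_eq_five hk hl (e3.trans hij) l3)
      (hexagonal_ratio_of_add_eq_three hg hg' (by linarith only [e6, hij]) l6)
  · -- The gap is `π / 7`. Neighbouring distances are equal, so `p`, `a`, `c` are isosceles.
    exfalso
    exact odd (d4' ((d1 (six hi hj hij)).trans (d2 (six hi' hj' (e2.trans hij)))))
      (by linarith only [e4, hij])

/-! ### The shape of a fan -/

theorem eq_smul_of_cross_eq_zero {u v w : Plane} (huw : cross u w ≠ 0) (h : cross u v = 0) :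
    v = (cross v w / cross u w) • u := by
  have := eq_framePoint huw 0 v
  simpa [framePoint, h] using this

theorem abs_cross (u v : Plane) :
    |cross u v| = ‖u‖ * ‖v‖ * Real.sin (InnerProductGeometry.angle u v) := by
  rw [mul_comm, InnerProductGeometry.sin_angle_mul_norm_mul_norm, ← Real.sqrt_sq_eq_abs]
  congr 1
  simp only [real_inner_self_eq_norm_sq, Fin.sum_univ_two,
    PiLp.inner_apply, cross]
  simp; ring

theorem div_cross_eq {s : ℝ} {u v w z : Plane} (h : 0 < s * cross u v) (h' : 0 < s * cross w z) :
    cross u v / cross w z = (‖u‖ * ‖v‖ * Real.sin (InnerProductGeometry.angle u v)) /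
      (‖w‖ * ‖z‖ * Real.sin (InnerProductGeometry.angle w z)) := by
  have hs : s ≠ 0 := by rintro rfl; simp at h
  rw [← abs_cross, ← abs_cross, ← abs_div, abs_of_pos]
  rw [← mul_div_mul_left _ _ hs]
  exact div_pos h h'

/-- Up to similarity there are two fans, the regular pentagon and the trisected triangle. -/
theorem fan_coordinates {S : Set Plane} (hS : numAngles S ≤ 3) {p a b c d : Plane} (hp : p ∈ S)
    (ha : a ∈ S) (hb : b ∈ S) (hc : c ∈ S) (hd : d ∈ S) (h : IsFan p a b c d) :
    (b = framePoint p (a - p) (d - p) Real.goldenRatio 1 ∧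
        c = framePoint p (a - p) (d - p) 1 Real.goldenRatio) ∨
      (b = framePoint p (a - p) (d - p) Real.goldenRatio⁻¹ (Real.goldenRatio⁻¹ ^ 2) ∧
        c = framePoint p (a - p) (d - p) (Real.goldenRatio⁻¹ ^ 2) Real.goldenRatio⁻¹) := by
  obtain ⟨-, h1, h2, h3, h4, h5, -⟩ := fan_equal_gaps hS hp ha hb hc hd h
  obtain ⟨h0, e1, e2, e3⟩ := fan_distances hS hp ha hb hc hd h
  obtain ⟨s, hab, hac, had, hbc, hbd, hcd⟩ := h
  rw [h0] at h1 h2 h3 h4 h5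
  have hφ := Real.goldenRatio_pos
  have hs := sin_pi_div_five_pos
  have hsad : cross (a - p) (d - p) ≠ 0 := fun h0 => by simp [h0] at had
  have pa : 0 < dist p a := dist_pos.2 (ne₁₂_of_not_collinear (not_collinear_of_cross_pos hab))
  have xb := eq_framePoint hsad p b
  have xc := eq_framePoint hsad p c
  rw [div_cross_eq hbd had, div_cross_eq hab had] at xb
  rw [div_cross_eq hcd had, div_cross_eq hac had] at xc
  simp only [angle, vsub_eq_sub] at h0 h1 h2 h3 h4 h5
  simp only [h0, h2, h3, h4, h5, ← dist_eq_norm, dist_comm _ p, e1, e2, sin_two_pi_div_five,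
    sin_three_pi_div_five] at xb xc
  rcases e3 with e3 | e3
  · left
    rw [e3] at xb xc
    constructor
    · convert xb using 1
      congr 1 <;> field_simp
    · convert xc using 1
      congr 1 <;> field_simp
  · right
    rw [e3] at xb xc
    have pb : dist p b ≠ 0 := by
      intro h; rw [h] at e3; simp [e3] at pa
    constructor
    · convert xb using 1
      congr 1 <;> field_simp
    · convert xc using 1
      congr 1 <;> field_simp

theorem eq_of_smul_of_dist_eq {p x q : Plane} {k : ℝ} (hk : 0 < k) (hx : x - p = k • (q - p))
    (hq : dist p q ≠ 0) (h : dist p x = dist p q) : x = q := by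
  rw [dist_comm p x, dist_eq_norm, hx, norm_smul, Real.norm_of_nonneg hk.le, ← dist_eq_norm,
    dist_comm q p] at h
  have : k = 1 := by
    apply mul_right_cancel₀ hq; linarith
  rw [this, one_smul] at hx
  exact sub_left_injective hx

theorem cross_smul_left (k : ℝ) (u v : Plane) : cross (k • u) v = k * cross u v := by
  simp [cross]; ring

theorem cross_smul_right (k : ℝ) (u v : Plane) : cross u (k • v) = k * cross u v := by
  simp [cross]; ring

/-- A point on a ray of a fan is the point of the fan on this ray. -/
theorem eq_of_mem_fan_ray {S : Set Plane} (hS : numAngles S ≤ 3) {p a b c d x : Plane} (hp : p ∈ S)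
    (ha : a ∈ S) (hb : b ∈ S) (hc : c ∈ S) (hd : d ∈ S) (hx : x ∈ S) (h : IsFan p a b c d) {k : ℝ}
    (hk : 0 < k) (hray : x - p = k • (a - p) ∨ x - p = k • (b - p) ∨ x - p = k • (c - p) ∨
      x - p = k • (d - p)) : x = a ∨ x = b ∨ x = c ∨ x = d := by
  obtain ⟨-, e1, e2, -⟩ := fan_distances hS hp ha hb hc hd h
  obtain ⟨s, hab, hac, had, hbc, hbd, hcd⟩ := id h
  have pa : dist p a ≠ 0 := dist_ne_zero.2 (ne₁₂_of_not_collinear (not_collinear_of_cross_pos hab))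
  have pb : dist p b ≠ 0 := dist_ne_zero.2 (ne₁₂_of_not_collinear (not_collinear_of_cross_pos hbc))
  have pos : ∀ {r : ℝ}, 0 < s * r → 0 < s * (k * r) := by
    intro r hr
    have := mul_pos hk hr
    linarith
  rcases hray with hr | hr | hr | hr
  · left
    obtain ⟨-, e1', -, -⟩ := fan_distances hS hp hx hb hc hd
      ⟨s, by rw [hr, cross_smul_left]; exact pos hab, by rw [hr, cross_smul_left]; exact pos hac,
        by rw [hr, cross_smul_left]; exact pos had, hbc, hbd, hcd⟩
    exact eq_of_smul_of_dist_eq hk hr pa (e1'.symm.trans e1)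
  · right; left
    obtain ⟨-, -, e2', -⟩ := fan_distances hS hp ha hx hc hd
      ⟨s, by rw [hr, cross_smul_right]; exact pos hab, hac, had,
        by rw [hr, cross_smul_left]; exact pos hbc, by rw [hr, cross_smul_left]; exact pos hbd, hcd⟩
    exact eq_of_smul_of_dist_eq hk hr pb (e2'.symm.trans e2)
  · right; right; left
    obtain ⟨-, -, e2', -⟩ := fan_distances hS hp ha hb hx hd
      ⟨s, hab, by rw [hr, cross_smul_right]; exact pos hac, had,
        by rw [hr, cross_smul_right]; exact pos hbc, hbd, by rw [hr, cross_smul_left]; exact pos hcd⟩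
    exact eq_of_smul_of_dist_eq hk hr (by rwa [e2]) (e2'.trans e2.symm)
  · right; right; right
    obtain ⟨-, e1', -, -⟩ := fan_distances hS hp ha hb hc hx
      ⟨s, hab, hac, by rw [hr, cross_smul_right]; exact pos had, hbc,
        by rw [hr, cross_smul_right]; exact pos hbd, by rw [hr, cross_smul_right]; exact pos hcd⟩
    exact eq_of_smul_of_dist_eq hk hr (by rwa [e1]) (e1'.trans e1.symm)

/-- A set with three angles that contains a fan has no further points. -/
theorem eq_fan {S : Set Plane} (hS : numAngles S ≤ 3) {p a b c d : Plane} (hp : p ∈ S)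
    (ha : a ∈ S) (hb : b ∈ S) (hc : c ∈ S) (hd : d ∈ S) (h : IsFan p a b c d) :
    S = {p, a, b, c, d} := by
  refine Set.Subset.antisymm (fun x hx => ?_) (by
    rintro x (rfl | rfl | rfl | rfl | rfl) <;> assumption)
  by_cases hxp : x = p
  · exact Or.inl hxp
  refine Or.inr ?_
  simp only [Set.mem_insert_iff, Set.mem_singleton_iff]
  obtain ⟨-, h1, h2, h3, h4, h5, cov⟩ := fan_equal_gaps hS hp ha hb hc hd h
  obtain ⟨h0, e1, e2, e3⟩ := fan_distances hS hp ha hb hc hd h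
  have ray := fun {k : ℝ} => @eq_of_mem_fan_ray S hS p a b c d x hp ha hb hc hd hx h k
  obtain ⟨s, hab, hac, had, hbc, hbd, hcd⟩ := h
  rw [h0] at h1 h2 h3 h4 h5 cov
  have hs : s ≠ 0 := by rintro rfl; simp at hab
  have quot : ∀ {r r' : ℝ}, 0 < s * r → 0 < s * r' → 0 < r / r' := by
    intro r r' hr hr'
    rw [← mul_div_mul_left _ _ hs]; exact div_pos hr hr'
  have quot' : ∀ {r r' : ℝ}, 0 ≤ s * r → 0 < s * r' → 0 ≤ r / r' := by
    intro r r' hr hr'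
    rw [← mul_div_mul_left _ _ hs]; exact div_nonneg hr hr'.le
  have ne : ∀ {u v : Plane}, 0 < s * cross u v → cross u v ≠ 0 := fun h h0 => by simp [h0] at h
  have ne' : ∀ {u v : Plane}, 0 < s * cross u v → cross v u ≠ 0 := fun h h0 => by
    rw [cross_swap, h0] at h; simp at h
  have sw : ∀ {u v : Plane}, s * cross u v < 0 → 0 < s * cross v u := by
    intro u v h; rw [cross_swap]; linarith
  have zero : ∀ {r : ℝ}, s * r = 0 → r = 0 := fun h => (mul_eq_zero.1 h).resolve_left hs
  have mem : ∀ {y : Plane}, y ∈ S → cross (y - p) (x - p) ≠ 0 → ∠ y p x ∈ angleSet S := by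
    intro y hy h
    rw [Ne, ← collinear_iff_cross] at h
    exact angle_mem_angleSet hy hp hx (by rwa [Set.insert_comm])
  have hpi := Real.pi_pos
  rcases lt_trichotomy (s * cross (a - p) (x - p)) 0 with hA | hA | hA <;>
    rcases lt_trichotomy (s * cross (d - p) (x - p)) 0 with hD | hD | hD
  · -- `x` comes before the fan
    exfalso
    have comb : ∀ {y : Plane}, 0 < s * cross (a - p) (y - p) → 0 < s * cross (y - p) (d - p) →
        0 < s * cross (x - p) (y - p) := by
      intro y h1 h2
      have e : cross (x - p) (y - p) = (cross (y - p) (d - p) / cross (a - p) (d - p)) *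
          cross (x - p) (a - p) + (cross (a - p) (y - p) / cross (a - p) (d - p)) *
          cross (x - p) (d - p) := by
        have := ne had
        field_simp
        unfold cross; ring
      rw [e, mul_add, mul_left_comm, mul_left_comm s (cross (a - p) (y - p) / _)]
      exact add_pos (mul_pos (quot h2 had) (sw hA)) (mul_pos (quot h1 had) (sw hD))
    exact not_five_fan hS hp hx ha hb hc hd (sw hA) (comb hab hbd) (comb hac hcd) (sw hD) hab hbc hcd
  · -- `x` is opposite to `d`
    exfalso
    have hk := eq_smul_of_cross_eq_zero (ne' had) (zero hD)
    have hk0 : 0 < cross (a - p) (x - p) / cross (a - p) (d - p) * -1 := by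
      have := quot (r := cross (x - p) (a - p)) (sw hA) had
      rw [cross_swap, neg_div] at this; linarith
    have hneg : cross (x - p) (a - p) / cross (d - p) (a - p) < 0 := by
      rw [cross_swap (x - p), cross_swap (d - p), neg_div_neg_eq]; linarith
    have m := mem hc (by rw [hk, cross_smul_right]; exact mul_ne_zero hneg.ne (ne hcd))
    have : ∠ c p x = Real.pi - Real.pi / 5 := by
      rw [← h2]
      simp only [angle, vsub_eq_sub]
      rw [hk, InnerProductGeometry.angle_smul_right_of_neg _ _ hneg,
        InnerProductGeometry.angle_neg_right]
    rcases cov _ m with h | h | h <;> linarith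
  · -- `x` is opposite to an inner point of the fan
    exfalso
    have m1 := mem ha (fun h => by simp [h] at hA)
    have m2 := mem hd (fun h => by simp [h] at hD)
    have : ∠ a p x + ∠ d p x = 2 * Real.pi - 3 * (Real.pi / 5) := by
      rw [← h5]
      simp only [angle, vsub_eq_sub]
      have hy : -(x - p) ≠ 0 := by rwa [neg_ne_zero, sub_ne_zero]
      have hk : 0 ≤ cross (-(x - p)) (d - p) / cross (a - p) (d - p) :=
        quot' (by rw [show cross (-(x - p)) (d - p) = cross (d - p) (x - p) by
          simp [cross]; ring]; exact hD.le) had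
      have hl : 0 ≤ cross (a - p) (-(x - p)) / cross (a - p) (d - p) :=
        quot' (by rw [show cross (a - p) (-(x - p)) = -cross (a - p) (x - p) by
          simp [cross]; ring]; linarith) had
      have hy' := eq_framePoint (ne had) 0 (-(x - p))
      rw [framePoint, sub_zero, zero_add] at hy'
      have := angle_add_of_eq_add hk hl hy hy'
      rw [InnerProductGeometry.angle_neg_right, InnerProductGeometry.angle_neg_left,
        InnerProductGeometry.angle_comm (x - p)] at this
      linarith
    rcases cov _ m1 with h | h | h <;> rcases cov _ m2 with h' | h' | h' <;> linarith
  · have hk := eq_smul_of_cross_eq_zero (ne had) (zero hA)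
    exact ray (quot (sw hD) had) (Or.inl hk)
  · -- `x` cannot lie on two lines through `p`
    exfalso
    have hk := eq_smul_of_cross_eq_zero (ne had) (zero hA)
    have h0 : cross (x - p) (d - p) = 0 := by rw [cross_swap, zero hD, neg_zero]
    rw [h0, zero_div, zero_smul, sub_eq_zero] at hk
    exact hxp hk
  · -- `x` is opposite to `a`
    exfalso
    have hk := eq_smul_of_cross_eq_zero (ne had) (zero hA)
    have hneg : cross (x - p) (d - p) / cross (a - p) (d - p) < 0 := by
      have := quot (r := cross (d - p) (x - p)) hD had
      rw [cross_swap, neg_div] at this; linarith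
    have m := mem hb (by rw [hk, cross_smul_right]; exact mul_ne_zero hneg.ne (ne' hab))
    have : ∠ b p x = Real.pi - Real.pi / 5 := by
      rw [← h0]
      simp only [angle, vsub_eq_sub]
      rw [hk, InnerProductGeometry.angle_smul_right_of_neg _ _ hneg,
        InnerProductGeometry.angle_neg_right, InnerProductGeometry.angle_comm]
    rcases cov _ m with h | h | h <;> linarith
  · -- `x` lies between the outer rays of the fan
    rcases lt_trichotomy (s * cross (b - p) (x - p)) 0 with hB | hB | hB
    · exact (not_five_fan hS hp ha hx hb hc hd hA hab hac had (sw hB) hbc hcd).elim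
    · have hk := eq_smul_of_cross_eq_zero (ne' hab) (zero hB)
      refine ray (k := cross (x - p) (a - p) / cross (b - p) (a - p)) ?_ (Or.inr (Or.inl hk))
      rw [cross_swap (x - p), cross_swap (b - p), neg_div_neg_eq]
      exact quot hA hab
    rcases lt_trichotomy (s * cross (c - p) (x - p)) 0 with hC | hC | hC
    · exact (not_five_fan hS hp ha hb hx hc hd hab hA hac had hB (sw hC) hcd).elim
    · have hk := eq_smul_of_cross_eq_zero (ne' hac) (zero hC)
      refine ray (k := cross (x - p) (a - p) / cross (c - p) (a - p)) ?_ (Or.inr (Or.inr (Or.inl hk)))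
      rw [cross_swap (x - p), cross_swap (c - p), neg_div_neg_eq]
      exact quot hA hac
    · exact (not_five_fan hS hp ha hb hc hx hd hab hac hA had hbc hC (sw hD)).elim
  · have hk := eq_smul_of_cross_eq_zero (ne' had) (zero hD)
    refine ray (k := cross (x - p) (a - p) / cross (d - p) (a - p)) ?_ (Or.inr (Or.inr (Or.inr hk)))
    rw [cross_swap (x - p), cross_swap (d - p), neg_div_neg_eq]
    exact quot hA had
  · -- `x` comes after the fan
    exact (not_five_fan hS hp ha hb hc hd hx hab hac had hA hbc hcd hD).elim

/-! ### Point sets without fans -/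

theorem isFan_framePoint {o u v : Plane} (h : cross u v ≠ 0) (σ : ℝ) {x y x₁ y₁ x₂ y₂ x₃ y₃ x₄ y₄ : ℝ}
    (h₁₂ : 0 < σ * ((x₁ - x) * (y₂ - y) - (x₂ - x) * (y₁ - y)))
    (h₁₃ : 0 < σ * ((x₁ - x) * (y₃ - y) - (x₃ - x) * (y₁ - y)))
    (h₁₄ : 0 < σ * ((x₁ - x) * (y₄ - y) - (x₄ - x) * (y₁ - y)))
    (h₂₃ : 0 < σ * ((x₂ - x) * (y₃ - y) - (x₃ - x) * (y₂ - y)))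
    (h₂₄ : 0 < σ * ((x₂ - x) * (y₄ - y) - (x₄ - x) * (y₂ - y)))
    (h₃₄ : 0 < σ * ((x₃ - x) * (y₄ - y) - (x₄ - x) * (y₃ - y))) :
    IsFan (framePoint o u v x y) (framePoint o u v x₁ y₁) (framePoint o u v x₂ y₂)
      (framePoint o u v x₃ y₃) (framePoint o u v x₄ y₄) := by
  have h2 : 0 < cross u v ^ 2 := by positivity
  refine ⟨σ * cross u v, ?_, ?_, ?_, ?_, ?_, ?_⟩ <;> rw [cross_framePoint]
  · linarith [mul_pos h₁₂ h2]
  · linarith [mul_pos h₁₃ h2]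
  · linarith [mul_pos h₁₄ h2]
  · linarith [mul_pos h₂₃ h2]
  · linarith [mul_pos h₂₄ h2]
  · linarith [mul_pos h₃₄ h2]

/-- No point of `S` sees four others in different directions inside an angle less than `π`. -/
def HasNoFan (S : Set Plane) : Prop :=
  ∀ p ∈ S, ∀ a ∈ S, ∀ b ∈ S, ∀ c ∈ S, ∀ d ∈ S, ¬ IsFan p a b c d

theorem framePoint_of_sbtw {p a a' : Plane} (h : Sbtw ℝ p a a') (v : Plane) :
    ∃ t : ℝ, 0 < t ∧ t < 1 ∧ a = framePoint p (a' - p) v t 0 := by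
  obtain ⟨t, h0, h1, rfl⟩ := h.exists_lineMap
  refine ⟨t, h0, h1, ?_⟩
  ext i
  simp [framePoint, AffineMap.lineMap_apply]; ring

/-- If `S` has four points on a line, then any point of `S` off this line sees a fan. -/
theorem not_four_on_line {S : Set Plane} (hS : HasNoFan S) {p a b c d : Plane} (hp : p ∈ S)
    (ha : a ∈ S) (hb : b ∈ S) (hc : c ∈ S) (hd : d ∈ S) (hab : Sbtw ℝ p a b) (hbc : Sbtw ℝ p b c) :
    cross (c - p) (d - p) = 0 := by
  by_contra h
  obtain ⟨t, ht0, ht1, eb⟩ := framePoint_of_sbtw hbc (d - p)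
  obtain ⟨s, hs0, hs1, es⟩ := hab.exists_lineMap
  have hst := mul_pos hs0 ht0
  have hst' : s * t < t := by nlinarith
  refine hS d hd p hp a ha b hb c hc ?_
  have key := isFan_framePoint (o := p) h 1 (x := 0) (y := 1) (x₁ := 0) (y₁ := 0)
    (x₂ := (1 - s) * 0 + s * t) (y₂ := (1 - s) * 0 + s * 0) (x₃ := t) (y₃ := 0) (x₄ := 1) (y₄ := 0)
    (by linarith) (by linarith) (by linarith) (by linarith) (by linarith) (by linarith)
  rwa [← lineMap_framePoint, ← eb, framePoint_zero_zero, ← es, framePoint_zero_one,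
    framePoint_one_zero] at key

/-- Rays from `p` with two, one and one points, the first ray being an outer one: in any position of `b`
other than on the segment `a' c`, there is a fan or a cevian with a further point. -/
theorem sbtw_of_outer_ray {S : Set Plane} (hS : numAngles S ≤ 3) (hf : HasNoFan S)
    {p a a' b c : Plane} (hp : p ∈ S) (ha : a ∈ S) (ha' : a' ∈ S) (hb : b ∈ S) (hc : c ∈ S)
    (haa : Sbtw ℝ p a a') {s : ℝ} (hab : 0 < s * cross (a' - p) (b - p))
    (hac : 0 < s * cross (a' - p) (c - p)) (hbc : 0 < s * cross (b - p) (c - p)) :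
    Sbtw ℝ a' b c := by
  have hs : s ≠ 0 := by rintro rfl; simp at hab
  have h : cross (a' - p) (c - p) ≠ 0 := fun h => by simp [h] at hac
  obtain ⟨t, ht0, ht1, ea⟩ := framePoint_of_sbtw haa (c - p)
  have eb := eq_framePoint h p b
  have hx : 0 < cross (b - p) (c - p) / cross (a' - p) (c - p) := by
    rw [← mul_div_mul_left _ _ hs]; exact div_pos hbc hac
  have hy : 0 < cross (a' - p) (b - p) / cross (a' - p) (c - p) := by
    rw [← mul_div_mul_left _ _ hs]; exact div_pos hab hac
  generalize cross (b - p) (c - p) / cross (a' - p) (c - p) = x at *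
  generalize cross (a' - p) (b - p) / cross (a' - p) (c - p) = y at *
  have ea' : a' = framePoint p (a' - p) (c - p) 1 0 := by simp
  have ec : c = framePoint p (a' - p) (c - p) 0 1 := by simp
  have ep : p = framePoint p (a' - p) (c - p) 0 0 := by simp
  generalize a' - p = u at *
  generalize c - p = v at *
  have htx := mul_pos ht0 hx
  have hty := mul_pos ht0 hy
  have hty' := mul_pos (sub_pos.2 ht1) hy
  rcases lt_trichotomy (x + y) 1 with hxy | hxy | hxy
  · rcases lt_trichotomy x (t * (1 - y)) with h1 | h1 | h1
    · refine (hf c hc p hp b hb a ha a' ha' ?_).elim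
      rw [ec, eb, ea, ea']
      nth_rw 2 [ep]
      refine isFan_framePoint h 1 ?_ ?_ ?_ ?_ ?_ ?_ <;> nlinarith
    · refine (not_cevian hS hc hp ha' ha hb ?_ haa ?_).elim
      · rw [ec, ea']
        nth_rw 2 [ep]
        exact not_collinear_framePoint h (by norm_num)
      · rw [ec, eb, ea]
        exact sbtw_framePoint h (1 - y) (by nlinarith) (by linarith) (by linarith) (by ring)
          (Or.inr (by norm_num))
    · refine (hf c hc p hp a ha b hb a' ha' ?_).elim
      rw [ec, eb, ea, ea']
      nth_rw 2 [ep]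
      refine isFan_framePoint h 1 ?_ ?_ ?_ ?_ ?_ ?_ <;> nlinarith
  · rw [ec, eb, ea']
    exact sbtw_framePoint h y hy (by linarith) (by linarith) (by ring) (Or.inr (by norm_num))
  · refine (hf c hc p hp a ha a' ha' b hb ?_).elim
    rw [ec, eb, ea, ea']
    nth_rw 2 [ep]
    refine isFan_framePoint h 1 ?_ ?_ ?_ ?_ ?_ ?_ <;> nlinarith

/-- Rays from `p` with one, two and one points: unless `e` is on the segment `b c`, there is a fan or a
cevian with a further point. -/
theorem sbtw_of_middle_ray {S : Set Plane} (hS : numAngles S ≤ 3) (hf : HasNoFan S)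
    {p b e d c : Plane} (hp : p ∈ S) (hb : b ∈ S) (he : e ∈ S) (hd : d ∈ S) (hc : c ∈ S)
    (hed : Sbtw ℝ p e d) (hbd : 0 < cross (b - p) (d - p))
    (hbc : 0 < cross (b - p) (c - p)) (hdc : 0 < cross (d - p) (c - p)) :
    Sbtw ℝ b e c := by
  have h : cross (b - p) (c - p) ≠ 0 := hbc.ne'
  obtain ⟨t, ht0, ht1, et⟩ := hed.exists_lineMap
  have edd := eq_framePoint h p d
  have hx : 0 < cross (d - p) (c - p) / cross (b - p) (c - p) := div_pos hdc hbc
  have hy : 0 < cross (b - p) (d - p) / cross (b - p) (c - p) := div_pos hbd hbc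
  generalize cross (d - p) (c - p) / cross (b - p) (c - p) = x at *
  generalize cross (b - p) (d - p) / cross (b - p) (c - p) = y at *
  have eb : b = framePoint p (b - p) (c - p) 1 0 := by simp
  have ec : c = framePoint p (b - p) (c - p) 0 1 := by simp
  have ep : p = framePoint p (b - p) (c - p) 0 0 := by simp
  have ee : e = framePoint p (b - p) (c - p) (t * x) (t * y) := by
    rw [et, edd]
    nth_rw 1 [ep]
    rw [lineMap_framePoint]; simp
  generalize b - p = u at *
  generalize c - p = v at *
  have htx := mul_pos ht0 hx
  have hty := mul_pos ht0 hy
  have hty' := mul_pos (sub_pos.2 ht1) hy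
  have htx' := mul_pos (sub_pos.2 ht1) hx
  clear et
  rcases lt_trichotomy (x + y) 1 with hxy | hxy | hxy
  · refine (hf b hb p hp e he d hd c hc ?_).elim
    rw [eb, ee, edd, ec]
    nth_rw 2 [ep]
    refine isFan_framePoint h (-1) ?_ ?_ ?_ ?_ ?_ ?_ <;> nlinarith
  · refine (not_cevian hS hp hb hc hd he ?_ ?_ hed).elim
    · rw [eb, ec]
      nth_rw 1 [ep]
      exact not_collinear_framePoint h (by norm_num)
    · rw [eb, ec, edd]
      exact sbtw_framePoint h y hy (by linarith) (by linarith) (by ring) (Or.inr (by norm_num))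
  · rcases lt_trichotomy (t * (x + y)) 1 with h1 | h1 | h1
    · refine (hf b hb p hp e he c hc d hd ?_).elim
      rw [eb, ee, edd, ec]
      nth_rw 2 [ep]
      refine isFan_framePoint h (-1) ?_ ?_ ?_ ?_ ?_ ?_ <;> nlinarith
    · rw [eb, ee, ec]
      exact sbtw_framePoint h (t * y) hty (by linarith) (by linarith) (by ring)
        (Or.inr (by norm_num))
    · refine (hf b hb p hp c hc e he d hd ?_).elim
      rw [eb, ee, edd, ec]
      nth_rw 2 [ep]
      refine isFan_framePoint h (-1) ?_ ?_ ?_ ?_ ?_ ?_ <;> nlinarith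

theorem cross_eq_zero_of_sbtw {m x n : Plane} (h : Sbtw ℝ m x n) :
    cross (x - m) (n - m) = 0 ∧ cross (n - m) (x - m) = 0 := by
  obtain ⟨t, -, -, rfl⟩ := h.exists_lineMap
  constructor <;> · simp [cross, AffineMap.lineMap_apply]; ring

/-- A line that meets a ray twice contains its origin. -/
theorem cross_eq_zero_of_two_on_line {p x y m n : Plane} (h : Sbtw ℝ p x y)
    (hx : cross (x - m) (n - m) = 0) (hy : cross (y - m) (n - m) = 0) :
    cross (m - p) (n - p) = 0 := by
  obtain ⟨t, ht0, ht1, rfl⟩ := h.exists_lineMap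
  have : (1 - t) * cross (m - p) (n - p) = 0 := by
    simp only [cross, AffineMap.lineMap_apply, vsub_eq_sub, vadd_eq_add, PiLp.add_apply,
      PiLp.sub_apply, PiLp.smul_apply, smul_eq_mul] at *
    linear_combination t * hy - hx
  exact (mul_eq_zero.1 this).resolve_left (by linarith)

/-! ### Sorting points by direction -/

/-- The direction of a vector, as an angle with the positive first axis. -/
noncomputable def direction (u : Plane) : ℝ := Complex.arg ⟨u 0, u 1⟩

theorem norm_complex_mk (u : Plane) : ‖(⟨u 0, u 1⟩ : ℂ)‖ = ‖u‖ := by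
  rw [Complex.norm_eq_sqrt_sq_add_sq, EuclideanSpace.norm_eq]
  simp [Fin.sum_univ_two]

theorem polar_coordinates (u : Plane) :
    u 0 = ‖u‖ * Real.cos (direction u) ∧ u 1 = ‖u‖ * Real.sin (direction u) := by
  rw [← norm_complex_mk, direction, Complex.norm_mul_cos_arg, Complex.norm_mul_sin_arg]
  exact ⟨rfl, rfl⟩

theorem cross_eq_norm_mul_sin (u v : Plane) :
    cross u v = ‖u‖ * ‖v‖ * Real.sin (direction v - direction u) := by
  obtain ⟨h1, h2⟩ := polar_coordinates u
  obtain ⟨h3, h4⟩ := polar_coordinates v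
  rw [cross, h1, h2, h3, h4, Real.sin_sub]; ring

/-- The open right half-plane together with the positive second axis. -/
def rightHalf : Set Plane := {u | 0 < u 0 ∨ u 0 = 0 ∧ 0 < u 1}

theorem direction_mem {u : Plane} (h : u ∈ rightHalf) :
    0 < ‖u‖ ∧ -(Real.pi / 2) < direction u ∧ direction u ≤ Real.pi / 2 := by
  have hu : u ≠ 0 := by
    rintro rfl; simp [rightHalf] at h
  refine ⟨norm_pos_iff.2 hu, ?_, ?_⟩
  · rcases h with h | ⟨h, h'⟩
    · exact (Complex.neg_pi_div_two_lt_arg_iff.2 (Or.inl h))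
    · exact (Complex.neg_pi_div_two_lt_arg_iff.2 (Or.inr h'.le))
  · refine Complex.arg_le_pi_div_two_iff.2 (Or.inl ?_)
    rcases h with h | ⟨h, h'⟩
    · exact h.le
    · exact h.ge

theorem cross_pos_iff {u v : Plane} (hu : u ∈ rightHalf) (hv : v ∈ rightHalf) :
    0 < cross u v ↔ direction u < direction v := by
  obtain ⟨nu, u1, u2⟩ := direction_mem hu
  obtain ⟨nv, v1, v2⟩ := direction_mem hv
  have hn := mul_pos nu nv
  rw [cross_eq_norm_mul_sin]
  constructor
  · intro h
    by_contra hle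
    have : Real.sin (direction v - direction u) ≤ 0 :=
      Real.sin_nonpos_of_nonpos_of_neg_pi_le (by linarith) (by linarith)
    nlinarith
  · intro h
    exact mul_pos hn (Real.sin_pos_of_pos_of_lt_pi (by linarith) (by linarith))

theorem sbtw_of_direction_eq {p x y : Plane} (hx : x - p ∈ rightHalf) (hy : y - p ∈ rightHalf)
    (hd : direction (x - p) = direction (y - p)) (hn : ‖x - p‖ < ‖y - p‖) : Sbtw ℝ p x y := by
  obtain ⟨nx, -, -⟩ := direction_mem hx
  obtain ⟨ny, -, -⟩ := direction_mem hy
  have e : x = AffineMap.lineMap p y (‖x - p‖ / ‖y - p‖) := by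
    obtain ⟨h1, h2⟩ := polar_coordinates (x - p)
    obtain ⟨h3, h4⟩ := polar_coordinates (y - p)
    rw [hd] at h1 h2
    simp only [PiLp.sub_apply] at h1 h2 h3 h4
    ext i
    rw [AffineMap.lineMap_apply]
    fin_cases i
    · simp [h3]; field_simp; linarith
    · simp [h4]; field_simp; linarith
  rw [e, sbtw_lineMap_iff]
  refine ⟨?_, by positivity, (div_lt_one ny).2 hn⟩
  rintro rfl
  simp at ny

/-- Finitely many points on one side of `p`, sorted by direction and then by distance. -/
theorem exists_sorted {p : Plane} {n : ℕ} {T : Finset Plane} (hT : T.card = n)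
    (hp : ∀ q ∈ T, q - p ∈ rightHalf) :
    ∃ (q : Fin n → Plane) (θ : Fin n → ℝ), Function.Injective q ∧ (∀ x, x ∈ T ↔ ∃ i, q i = x) ∧
      Monotone θ ∧ (∀ i j, 0 < cross (q i - p) (q j - p) ↔ θ i < θ j) ∧
      ∀ i j, i < j → θ i = θ j → Sbtw ℝ p (q i) (q j) := by
  let f : Fin n → Plane := fun i => ((T.equivFinOfCardEq hT).symm i : Plane)
  have hf : Function.Injective f := Subtype.val_injective.comp (Equiv.injective _)
  have hfr : ∀ x, x ∈ T ↔ ∃ i, f i = x := by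
    intro x
    constructor
    · intro hx
      exact ⟨T.equivFinOfCardEq hT ⟨x, hx⟩, by simp [f]⟩
    · rintro ⟨i, rfl⟩
      exact ((T.equivFinOfCardEq hT).symm i).2
  let k : Fin n → ℝ ×ₗ ℝ := fun i => toLex (direction (f i - p), ‖f i - p‖)
  have hk := Tuple.monotone_sort k
  set σ := Tuple.sort k
  have hmem : ∀ i, f (σ i) - p ∈ rightHalf := fun i => hp _ ((hfr _).2 ⟨_, rfl⟩)
  have hmono : Monotone fun i => direction (f (σ i) - p) := by
    intro i j hij
    have := hk hij
    simp only [Function.comp, k, Prod.Lex.toLex_le_toLex] at this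
    rcases this with h | h
    · exact h.le
    · exact h.1.le
  refine ⟨f ∘ σ, fun i => direction (f (σ i) - p), hf.comp σ.injective, fun x => ?_, hmono,
    fun i j => cross_pos_iff (hmem i) (hmem j), fun i j hij hd => ?_⟩
  · rw [hfr]
    constructor
    · rintro ⟨i, rfl⟩; exact ⟨σ.symm i, by simp⟩
    · rintro ⟨i, rfl⟩; exact ⟨σ i, rfl⟩
  · beta_reduce at hd
    have := hk hij.le
    simp only [Function.comp, k, Prod.Lex.toLex_le_toLex] at this
    have hle : ‖f (σ i) - p‖ ≤ ‖f (σ j) - p‖ := by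
      rcases this with h | h
      · exact absurd hd h.ne
      · exact h.2
    rcases hle.lt_or_eq with h | h
    · exact sbtw_of_direction_eq (hmem i) (hmem j) hd h
    · exfalso
      obtain ⟨h1, h2⟩ := polar_coordinates (f (σ i) - p)
      obtain ⟨h3, h4⟩ := polar_coordinates (f (σ j) - p)
      rw [hd, h] at h1 h2
      have : f (σ i) - p = f (σ j) - p := by
        ext l
        fin_cases l
        · exact h1.trans h3.symm
        · exact h2.trans h4.symm
      exact hij.ne (σ.injective (hf (sub_left_injective this)))

theorem exists_rightHalf {F : Finset Plane} (hF : F.Nonempty) :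
    ∃ p ∈ F, ∀ q ∈ F, q ≠ p → q - p ∈ rightHalf := by
  obtain ⟨p, hp, hmin⟩ := F.exists_min_image (fun q : Plane => toLex (q 0, q 1)) hF
  refine ⟨p, hp, fun q hq hne => ?_⟩
  have := hmin q hq
  rw [Prod.Lex.toLex_le_toLex] at this
  simp only [rightHalf, Set.mem_ofPred_eq, PiLp.sub_apply]
  rcases this with h | ⟨h, h'⟩
  · left; simpa using h
  · right
    simp only at h h'
    refine ⟨by linarith, ?_⟩
    rcases h'.lt_or_eq with h2 | h2
    · linarith
    · exfalso; apply hne; ext l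
      fin_cases l
      · exact h.symm
      · exact h2.symm

/-! ### Five and six points -/

/-- The points `a`, `b`, `c`, `d` and the point `e` where the segments `a c` and `b d` cross. -/
def IsCrossing (a b c d e : Plane) : Prop :=
  ¬ Collinear ℝ {a, b, e} ∧ Sbtw ℝ a e c ∧ Sbtw ℝ b e d

/-- The apex `a` of an angle, points `b`, `d` on one side and `c`, `e` on the other one, the points
`b` and `c` being nearer to the apex. -/
def IsLegs (a b c d e : Plane) : Prop :=
  ¬ Collinear ℝ {a, d, e} ∧ Sbtw ℝ a b d ∧ Sbtw ℝ a c e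

section Sorted

variable {S : Set Plane} {p : Plane} {n : ℕ} {q : Fin n → Plane} {θ : Fin n → ℝ}

theorem sorted_no_fan (hf : HasNoFan S) (hp : p ∈ S) (hq : ∀ i, q i ∈ S)
    (hθ : ∀ i j, 0 < cross (q i - p) (q j - p) ↔ θ i < θ j) {i j k l : Fin n}
    (hij : θ i < θ j) (hjk : θ j < θ k) (hkl : θ k < θ l) : False :=
  hf p hp _ (hq i) _ (hq j) _ (hq k) _ (hq l)
    ⟨1, by rw [one_mul, hθ]; linarith, by rw [one_mul, hθ]; linarith, by rw [one_mul, hθ]; linarith,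
      by rw [one_mul, hθ]; linarith, by rw [one_mul, hθ]; linarith, by rw [one_mul, hθ]; linarith⟩

theorem sorted_no_line (hf : HasNoFan S) (hp : p ∈ S) (hq : ∀ i, q i ∈ S)
    (hθ : ∀ i j, 0 < cross (q i - p) (q j - p) ↔ θ i < θ j)
    (hs : ∀ i j, i < j → θ i = θ j → Sbtw ℝ p (q i) (q j)) {i j k l m : Fin n}
    (hij : i < j) (hjk : j < k) (e : θ i = θ j) (e' : θ j = θ k) (hlm : θ l < θ m) : False := by
  have key : ∀ x, θ x = θ k := by
    intro x
    have := not_four_on_line hf hp (hq i) (hq j) (hq k) (hq x) (hs i j hij e) (hs j k hjk e')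
    have h1 := hθ k x
    have h2 := hθ x k
    rw [this] at h1
    rw [cross_swap, this] at h2
    simp only [lt_irrefl, neg_zero, false_iff, not_lt] at h1 h2
    exact le_antisymm h1 h2
  linarith [key l, key m]

end Sorted

/-- The cases are told apart by the numbers of points on the rays from `p`. There are at most three
rays, with at most two points each. -/
theorem five_of_sorted {S : Set Plane} (hS : numAngles S ≤ 3) (hf : HasNoFan S) {p : Plane}
    {q : Fin 4 → Plane} {θ : Fin 4 → ℝ} (hp : p ∈ S) (hq : ∀ i, q i ∈ S) (hmono : Monotone θ)
    (hθ : ∀ i j, 0 < cross (q i - p) (q j - p) ↔ θ i < θ j)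
    (hs : ∀ i j, i < j → θ i = θ j → Sbtw ℝ p (q i) (q j)) {l m : Fin 4} (hlm : θ l < θ m) :
    ∃ a b c d e, ({p, q 0, q 1, q 2, q 3} : Set Plane) = {a, b, c, d, e} ∧
      (IsCrossing a b c d e ∨ IsLegs a b c d e) := by
  have nf := fun {i j k l : Fin 4} => sorted_no_fan hf hp hq hθ (i := i) (j := j) (k := k) (l := l)
  have nl := fun {i j k : Fin 4} => sorted_no_line hf hp hq hθ hs (i := i) (j := j) (k := k) (hlm := hlm)
  have pos : ∀ {i j}, θ i < θ j → 0 < 1 * cross (q i - p) (q j - p) := by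
    intro i j h; rwa [one_mul, hθ]
  have neg : ∀ {i j}, θ i < θ j → 0 < -1 * cross (q j - p) (q i - p) := by
    intro i j h; rw [cross_swap]; linarith [pos h]
  have nc : ∀ {i j}, θ i < θ j → cross (q i - p) (q j - p) ≠ 0 := by
    intro i j h; rw [← hθ] at h; exact h.ne'
  rcases (hmono (show (0 : Fin 4) ≤ 1 by decide)).lt_or_eq with h1 | h1 <;>
    rcases (hmono (show (1 : Fin 4) ≤ 2 by decide)).lt_or_eq with h2 | h2 <;>
    rcases (hmono (show (2 : Fin 4) ≤ 3 by decide)).lt_or_eq with h3 | h3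
  · exact (nf h1 h2 h3).elim
  · have e1 := hs 2 3 (by decide) h3
    have := sbtw_of_outer_ray hS hf hp (hq 2) (hq 3) (hq 1) (hq 0) e1 (s := -1)
      (neg (by linarith)) (neg (by linarith)) (neg h1)
    refine ⟨q 3, q 2, q 1, p, q 0, ?_, Or.inr ⟨?_, e1.symm, this⟩⟩
    · ext; simp only [Set.mem_insert_iff, Set.mem_singleton_iff]; tauto
    · rw [Set.insert_comm, collinear_iff_cross]
      intro h
      exact nc (h1.trans_le (h2.le.trans h3.le)) (by rw [cross_swap, h, neg_zero])
  · have e1 := hs 1 2 (by decide) h2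
    have := sbtw_of_middle_ray hS hf hp (hq 0) (hq 1) (hq 2) (hq 3) e1
      ((hθ _ _).2 (by linarith)) ((hθ _ _).2 (by linarith)) ((hθ _ _).2 h3)
    refine ⟨p, q 0, q 2, q 3, q 1, ?_, Or.inl ⟨?_, e1, this⟩⟩
    · ext; simp only [Set.mem_insert_iff, Set.mem_singleton_iff]; tauto
    · rw [collinear_iff_cross]
      exact nc h1
  · exact (nl (by decide) (by decide) h2 h3).elim
  · have e1 := hs 0 1 (by decide) h1
    have := sbtw_of_outer_ray hS hf hp (hq 0) (hq 1) (hq 2) (hq 3) e1 (s := 1)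
      (pos h2) (pos (by linarith)) (pos h3)
    refine ⟨q 1, q 0, q 2, p, q 3, ?_, Or.inr ⟨?_, e1.symm, this⟩⟩
    · ext; simp only [Set.mem_insert_iff, Set.mem_singleton_iff]; tauto
    · rw [Set.insert_comm, collinear_iff_cross]
      exact nc (h2.trans h3)
  · refine ⟨p, q 0, q 2, q 1, q 3, ?_, Or.inr ⟨?_, hs 0 1 (by decide) h1, hs 2 3 (by decide) h3⟩⟩
    · ext; simp only [Set.mem_insert_iff, Set.mem_singleton_iff]; tauto
    · rw [collinear_iff_cross]
      exact nc (by linarith)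
  · exact (nl (by decide) (by decide) h1 h2).elim
  · exact (nl (by decide) (by decide) h1 h2).elim

/-- Without a fan, there would be three rays from `p`, two of them with two points. By `sbtw_of_outer_ray`, both points of
one ray lie on a line through points of the other two rays, which then contains `p`. -/
theorem not_six_of_sorted {S : Set Plane} (hS : numAngles S ≤ 3) (hf : HasNoFan S) {p : Plane}
    {q : Fin 5 → Plane} {θ : Fin 5 → ℝ} (hp : p ∈ S) (hq : ∀ i, q i ∈ S) (hmono : Monotone θ)
    (hθ : ∀ i j, 0 < cross (q i - p) (q j - p) ↔ θ i < θ j)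
    (hs : ∀ i j, i < j → θ i = θ j → Sbtw ℝ p (q i) (q j)) {l m : Fin 5} (hlm : θ l < θ m) :
    False := by
  have nf := fun {i j k l : Fin 5} => sorted_no_fan hf hp hq hθ (i := i) (j := j) (k := k) (l := l)
  have nl := fun {i j k : Fin 5} => sorted_no_line hf hp hq hθ hs (i := i) (j := j) (k := k) (hlm := hlm)
  have pos : ∀ {i j}, θ i < θ j → 0 < 1 * cross (q i - p) (q j - p) := by
    intro i j h; rwa [one_mul, hθ]
  have neg : ∀ {i j}, θ i < θ j → 0 < -1 * cross (q j - p) (q i - p) := by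
    intro i j h; rw [cross_swap]; linarith [pos h]
  have nc : ∀ {i j}, θ i < θ j → cross (q i - p) (q j - p) ≠ 0 := by
    intro i j h; rw [← hθ] at h; exact h.ne'
  rcases (hmono (show (0 : Fin 5) ≤ 1 by decide)).lt_or_eq with h1 | h1 <;>
    rcases (hmono (show (1 : Fin 5) ≤ 2 by decide)).lt_or_eq with h2 | h2 <;>
    rcases (hmono (show (2 : Fin 5) ≤ 3 by decide)).lt_or_eq with h3 | h3 <;>
    rcases (hmono (show (3 : Fin 5) ≤ 4 by decide)).lt_or_eq with h4 | h4
  · exact nf h1 h2 h3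
  · exact nf h1 h2 h3
  · exact nf h1 h2 (h3.trans_lt h4)
  · exact nl (by decide) (by decide) h3 h4
  · exact nf h1 (h2.trans_lt h3) h4
  · -- one, two and two points
    have e1 := hs 1 2 (by decide) h2
    have e2 := hs 3 4 (by decide) h4
    have s1 := sbtw_of_outer_ray hS hf hp (hq 3) (hq 4) (hq 1) (hq 0) e2 (s := -1)
      (neg (by linarith)) (neg (by linarith)) (neg (by linarith))
    have s2 := sbtw_of_outer_ray hS hf hp (hq 3) (hq 4) (hq 2) (hq 0) e2 (s := -1)
      (neg (by linarith)) (neg (by linarith)) (neg (by linarith))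
    have := cross_eq_zero_of_two_on_line e1 (cross_eq_zero_of_sbtw s1).1
      (cross_eq_zero_of_sbtw s2).1
    exact nc (i := 0) (j := 4) (by linarith) (by rw [cross_swap, this, neg_zero])
  · exact nl (by decide) (by decide) h2 h3
  · exact nl (by decide) (by decide) h2 h3
  · exact nf (h1.trans_lt h2) h3 h4
  · -- two, one and two points
    have e1 := hs 0 1 (by decide) h1
    have e2 := hs 3 4 (by decide) h4
    have s1 := sbtw_of_outer_ray hS hf hp (hq 0) (hq 1) (hq 2) (hq 3) e1 (s := 1)
      (pos (by linarith)) (pos (by linarith)) (pos (by linarith))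
    have s2 := sbtw_of_outer_ray hS hf hp (hq 0) (hq 1) (hq 2) (hq 4) e1 (s := 1)
      (pos (by linarith)) (pos (by linarith)) (pos (by linarith))
    have := cross_eq_zero_of_two_on_line e2 (cross_eq_zero_of_sbtw s1).2
      (cross_eq_zero_of_sbtw s2).2
    exact nc h2 this
  · -- two, two and one points
    have e1 := hs 0 1 (by decide) h1
    have e2 := hs 2 3 (by decide) h3
    have s1 := sbtw_of_outer_ray hS hf hp (hq 0) (hq 1) (hq 2) (hq 4) e1 (s := 1)
      (pos (by linarith)) (pos (by linarith)) (pos (by linarith))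
    have s2 := sbtw_of_outer_ray hS hf hp (hq 0) (hq 1) (hq 3) (hq 4) e1 (s := 1)
      (pos (by linarith)) (pos (by linarith)) (pos (by linarith))
    have := cross_eq_zero_of_two_on_line e2 (cross_eq_zero_of_sbtw s1).1
      (cross_eq_zero_of_sbtw s2).1
    exact nc (i := 1) (j := 4) (by linarith) this
  · exact nl (by decide) (by decide) h3 h4
  all_goals exact nl (by decide) (by decide) h1 h2

/-- From any point, two points of a set that does not lie on a line are seen in independent
directions. -/
theorem exists_cross_pos {F : Set Plane} (h : ¬ Collinear ℝ F) (p : Plane) :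
    ∃ a ∈ F, ∃ b ∈ F, 0 < cross (a - p) (b - p) := by
  by_contra! hle
  apply h
  have h0 : ∀ a ∈ F, ∀ b ∈ F, cross (a - p) (b - p) = 0 := by
    intro a ha b hb
    refine le_antisymm (hle a ha b hb) ?_
    have := hle b hb a ha
    rw [cross_swap] at this; linarith
  have hc : ∀ a ∈ F, ∀ b ∈ F, ∀ c ∈ F, Collinear ℝ {a, b, c} := by
    intro a ha b hb c hc
    rw [collinear_iff_cross]
    have e : cross (b - a) (c - a) = cross (a - p) (b - p) + cross (b - p) (c - p) +
        cross (c - p) (a - p) := by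
      simp [cross]; ring
    rw [e, h0 a ha b hb, h0 b hb c hc, h0 c hc a ha]; ring
  by_cases hs : F.Subsingleton
  · exact hs.induction_on (collinear_empty ℝ _) (collinear_singleton ℝ)
  · rw [Set.not_subsingleton_iff] at hs
    obtain ⟨a, ha, b, hb, hab⟩ := hs
    rw [collinear_iff_of_mem ha]
    refine ⟨b - a, fun c hc' => ?_⟩
    have := hc a ha b hb c hc'
    rw [collinear_iff_of_mem (p₀ := a) (by simp)] at this
    obtain ⟨v, hv⟩ := this
    obtain ⟨r, hr⟩ := hv b (by simp)
    obtain ⟨s, hs⟩ := hv c (by simp)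
    have hr0 : r ≠ 0 := by
      rintro rfl; apply hab; simp [hr]
    refine ⟨s / r, ?_⟩
    rw [hs, hr]
    simp [smul_smul, div_mul_cancel₀ _ hr0]

/-- The five-point and six-point subsets of a set with three angles and no fan. The points are sorted
by direction from the lexicographically smallest one. -/
theorem classification {S : Set Plane} (hS : numAngles S ≤ 3) {F : Finset Plane}
    (hF : (F : Set Plane) ⊆ S) (hcol : ¬ Collinear ℝ (F : Set Plane)) (hf : HasNoFan S) :
    F.card ≠ 6 ∧ (F.card = 5 → ∃ a b c d e, (F : Set Plane) = {a, b, c, d, e} ∧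
      (IsCrossing a b c d e ∨ IsLegs a b c d e)) := by
  classical
  have hne : F.Nonempty := by
    rw [Finset.nonempty_iff_ne_empty]
    rintro rfl
    exact hcol (by simpa using collinear_empty ℝ Plane)
  obtain ⟨p, hp, hpos⟩ := exists_rightHalf hne
  obtain ⟨a, ha, b, hb, hab⟩ := exists_cross_pos hcol p
  have hap : a ≠ p := by
    rintro rfl; simp [cross] at hab
  have hbp : b ≠ p := by
    rintro rfl; simp [cross] at hab
  have hcard := Finset.card_erase_add_one hp
  have hT : ∀ q ∈ F.erase p, q - p ∈ rightHalf := by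
    intro q hq
    rw [Finset.mem_erase] at hq
    exact hpos q hq.2 hq.1
  constructor
  · intro h6
    obtain ⟨q, θ, -, hmem, hmono, hθ, hs⟩ :=
      exists_sorted (n := 5) (T := F.erase p) (by omega) hT
    obtain ⟨i, rfl⟩ := (hmem a).1 (Finset.mem_erase.2 ⟨hap, ha⟩)
    obtain ⟨j, rfl⟩ := (hmem b).1 (Finset.mem_erase.2 ⟨hbp, hb⟩)
    exact not_six_of_sorted hS hf (hF hp)
      (fun i => hF (Finset.mem_of_mem_erase ((hmem (q i)).2 ⟨i, rfl⟩))) hmono hθ hs ((hθ _ _).1 hab)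
  · intro h5
    obtain ⟨q, θ, -, hmem, hmono, hθ, hs⟩ :=
      exists_sorted (n := 4) (T := F.erase p) (by omega) hT
    obtain ⟨i, rfl⟩ := (hmem a).1 (Finset.mem_erase.2 ⟨hap, ha⟩)
    obtain ⟨j, rfl⟩ := (hmem b).1 (Finset.mem_erase.2 ⟨hbp, hb⟩)
    obtain ⟨a, b, c, d, e, he, h⟩ := five_of_sorted hS hf (hF hp)
      (fun i => hF (Finset.mem_of_mem_erase ((hmem (q i)).2 ⟨i, rfl⟩))) hmono hθ hs ((hθ _ _).1 hab)
    refine ⟨a, b, c, d, e, he ▸ ?_, h⟩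
    rw [← Finset.insert_erase hp]
    ext x
    rw [Finset.mem_coe, Finset.mem_insert, hmem, Fin.exists_fin_succ, Fin.exists_fin_succ,
      Fin.exists_fin_succ, Fin.exists_fin_succ]
    simp [eq_comm]

/-! ### Similarities -/

theorem angle_dilation (f : Plane ≃ᵈ Plane) (a b c : Plane) : ∠ (f a) (f b) (f c) = ∠ a b c := by
  refine Similar.angle_eq ?_
  refine ⟨Dilation.ratio f, Dilation.ratio_ne_zero f, fun i j => ?_⟩
  fin_cases i <;> fin_cases j <;> exact Dilation.edist_eq f _ _

theorem SimilarSets.symm {S T : Set Plane} (h : SimilarSets S T) : SimilarSets T S := by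
  obtain ⟨f, rfl⟩ := h
  exact ⟨f.symm, by rw [Set.image_image]; simp⟩

/-- A complex number is determined up to conjugation by its distances from `0` and `1`. -/
theorem eq_or_eq_conj {w z : ℂ} (h0 : ‖w‖ = ‖z‖) (h1 : ‖w - 1‖ = ‖z - 1‖) :
    z = w ∨ z = (starRingEnd ℂ) w := by
  have h0' := congrArg (· ^ 2) h0
  have h1' := congrArg (· ^ 2) h1
  simp only [← Complex.normSq_eq_norm_sq, Complex.normSq_apply, Complex.sub_re, Complex.sub_im,
    Complex.one_re, Complex.one_im] at h0' h1'
  have hre : z.re = w.re := by linarith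
  have him : (z.im - w.im) * (z.im + w.im) = 0 := by
    rw [hre] at h0'; linarith
  rcases mul_eq_zero.1 him with h | h
  · left; exact Complex.ext hre (by linarith)
  · right; exact Complex.ext (by simpa using hre) (by rw [Complex.conj_im]; linarith)

/-- Triangles with the same angles are related by a similarity, which respects the frames that they
span. -/
theorem exists_dilation {p a b p' a' b' : Plane} (h : ¬ Collinear ℝ {p, a, b})
    (h1 : ∠ a p b = ∠ a' p' b') (h2 : ∠ p a b = ∠ p' a' b') :
    ∃ f : Plane ≃ᵈ Plane, ∀ x y, f (framePoint p (a - p) (b - p) x y) =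
      framePoint p' (a' - p') (b' - p') x y := by
  have hsim : Similar ![p, a, b] ![p', a', b'] := by
    refine similar_of_angle_angle h h2 ?_
    have h3 := triangle_sum b (ne₁₂_of_not_collinear h)
    have hne : p' ≠ a' := by
      rintro rfl
      rw [angle_self_left] at h1 h2
      have : 0 < ∠ p b a := angle_pos_of_not_collinear (by rwa [Set.pair_comm b a])
      linarith
    have h4 := triangle_sum b' hne
    rw [angle_comm a b p, angle_comm a' b' p']
    linarith
  obtain ⟨r, hr, hd⟩ := similar_iff_exists_dist_eq.1 hsim
  have d1 := hd 1 0
  have d2 := hd 2 0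
  have d3 := hd 2 1
  simp only [Matrix.cons_val_zero, Matrix.cons_val_one, Matrix.cons_val, dist_eq_norm] at d1 d2 d3
  have hr' : (0 : ℝ) < r := by positivity
  let e : Plane ≃ₗᵢ[ℝ] ℂ := Complex.orthonormalBasisOneI.repr.symm
  have hu : e (a - p) ≠ 0 := by
    rw [Ne, LinearIsometryEquiv.map_eq_zero_iff, sub_eq_zero]
    exact (ne₁₂_of_not_collinear h).symm
  have hu' : e (a' - p') ≠ 0 := by
    rw [Ne, LinearIsometryEquiv.map_eq_zero_iff]
    rintro h0
    rw [h0, norm_zero, mul_zero, norm_eq_zero, sub_eq_zero] at d1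
    exact ne₁₂_of_not_collinear h d1.symm
  have q0 : ‖e (b - p) / e (a - p)‖ = ‖e (b' - p') / e (a' - p')‖ := by
    simp only [norm_div, LinearIsometryEquiv.norm_map]
    rw [d1, d2, mul_div_mul_left _ _ hr'.ne']
  have q1 : ‖e (b - p) / e (a - p) - 1‖ = ‖e (b' - p') / e (a' - p') - 1‖ := by
    rw [div_sub_one hu, div_sub_one hu', ← map_sub, ← map_sub]
    simp only [norm_div, LinearIsometryEquiv.norm_map, sub_sub_sub_cancel_right]
    rw [d1, d3, mul_div_mul_left _ _ hr'.ne']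
  have hframe : ∀ (g : ℂ ≃ᵈ ℂ), (∀ x y : ℝ, g (x • e (a - p) + y • e (b - p)) =
      x • e (a' - p') + y • e (b' - p')) → ∃ f : Plane ≃ᵈ Plane, ∀ x y,
      f (framePoint p (a - p) (b - p) x y) = framePoint p' (a' - p') (b' - p') x y := by
    intro g hg
    refine ⟨(IsometryEquiv.subRight p).toDilationEquiv.trans
      (e.toIsometryEquiv.toDilationEquiv.trans (g.trans
      (e.symm.toIsometryEquiv.toDilationEquiv.trans
      (IsometryEquiv.addLeft p').toDilationEquiv))), fun x y => ?_⟩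
    change p' + e.symm (g (e (framePoint p (a - p) (b - p) x y - p))) = _
    rw [framePoint, add_sub_cancel_left, map_add, map_smul, map_smul, hg, map_add, map_smul,
      map_smul, e.symm_apply_apply, e.symm_apply_apply, framePoint]
  rcases eq_or_eq_conj q0 q1 with h | h
  · refine hframe (DilationEquiv.smulTorsor (0 : ℂ) (div_ne_zero hu' hu)) fun x y => ?_
    simp only [DilationEquiv.smulTorsor_apply, vadd_eq_add, add_zero, smul_eq_mul,
      Complex.real_smul]
    field_simp at h ⊢
    linear_combination (-y : ℂ) * h
  · have hc : (starRingEnd ℂ) (e (a - p)) ≠ 0 := (map_ne_zero _).2 hu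
    refine hframe (Complex.conjLIE.toIsometryEquiv.toDilationEquiv.trans
      (DilationEquiv.smulTorsor (0 : ℂ) (div_ne_zero hu' hc))) fun x y => ?_
    rw [map_div₀] at h
    change (e (a' - p') / (starRingEnd ℂ) (e (a - p))) •
      (starRingEnd ℂ) (x • e (a - p) + y • e (b - p)) + 0 = _
    simp only [add_zero, smul_eq_mul, Complex.real_smul, map_add (starRingEnd ℂ), map_mul,
      Complex.conj_ofReal]
    field_simp at h ⊢
    linear_combination (-y : ℂ) * h

theorem similarSets_of_frames {p a b p' a' b' : Plane} (h : ¬ Collinear ℝ {p, a, b})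
    (h1 : ∠ a p b = ∠ a' p' b') (h2 : ∠ p a b = ∠ p' a' b') (x₁ y₁ x₂ y₂ : ℝ) :
    SimilarSets {p, a, b, framePoint p (a - p) (b - p) x₁ y₁, framePoint p (a - p) (b - p) x₂ y₂}
      {p', a', b', framePoint p' (a' - p') (b' - p') x₁ y₁,
        framePoint p' (a' - p') (b' - p') x₂ y₂} := by
  obtain ⟨f, hf⟩ := exists_dilation h h1 h2
  have e1 := hf 0 0
  have e2 := hf 1 0
  have e3 := hf 0 1
  simp only [framePoint_zero_zero, framePoint_one_zero, framePoint_zero_one] at e1 e2 e3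
  exact ⟨f, by simp only [Set.image_insert_eq, Set.image_singleton, hf, e1, e2, e3]⟩

/-! ### Configurations with directions in a regular polygon -/

/-- The unit vector at the angle `k * π / n` to the second axis. (This choice makes the directions of
the sides and diagonals of a regular pentagon multiples of `π / 5`.) -/
noncomputable def unitRay (n k : ℕ) : Plane :=
  !₂[-Real.sin (k * Real.pi / n), Real.cos (k * Real.pi / n)]

theorem norm_unitRay (n k : ℕ) : ‖unitRay n k‖ = 1 := by
  rw [EuclideanSpace.norm_eq, Real.sqrt_eq_one]
  simp [unitRay, Fin.sum_univ_two]

theorem inner_unitRay (n k l : ℕ) :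
    inner ℝ (unitRay n k) (unitRay n l) = Real.cos (k * Real.pi / n - l * Real.pi / n) := by
  rw [Real.cos_sub]
  simp [unitRay, PiLp.inner_apply, Fin.sum_univ_two]; ring

theorem unitRay_add_half {n : ℕ} (hn : n ≠ 0) (k : ℕ) : unitRay n (k + n) = -unitRay n k := by
  have : ((k + n : ℕ) : ℝ) * Real.pi / n = k * Real.pi / n + Real.pi := by
    push_cast; field_simp
  ext i
  fin_cases i <;> simp only [unitRay, this, Real.sin_add_pi, Real.cos_add_pi] <;> simp

theorem unitRay_add_period {n : ℕ} (hn : n ≠ 0) (k : ℕ) : unitRay n (k + 2 * n) = unitRay n k := by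
  rw [two_mul, ← add_assoc, unitRay_add_half hn, unitRay_add_half hn, neg_neg]

theorem unitRay_mod {n : ℕ} (hn : n ≠ 0) (k : ℕ) : unitRay n (k % (2 * n)) = unitRay n k := by
  conv_rhs => rw [← Nat.mod_add_div k (2 * n)]
  generalize k / (2 * n) = m
  induction m with
  | zero => simp
  | succ m ih => rw [ih, Nat.mul_succ, ← add_assoc, unitRay_add_period hn]

/-- The angle, in units of `π / n`, between the directions with numbers `k` and `l`. -/
def turn (n k l : ℕ) : ℕ := min (k - l + (l - k)) (2 * n - (k - l + (l - k)))

theorem angle_unitRay {n k l : ℕ} (hn : n ≠ 0) (hk : k < 2 * n) (hl : l < 2 * n) :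
    InnerProductGeometry.angle (unitRay n k) (unitRay n l) = turn n k l * Real.pi / n := by
  have hn' : (0 : ℝ) < n := by positivity
  have hpi := Real.pi_pos
  have key : ∀ k l : ℕ, l ≤ k → k < 2 * n →
      Real.arccos (Real.cos (k * Real.pi / n - l * Real.pi / n)) = turn n k l * Real.pi / n := by
    intro k l hlk hk
    obtain ⟨d, rfl⟩ := Nat.exists_eq_add_of_le hlk
    have e : ((l + d : ℕ) : ℝ) * Real.pi / n - l * Real.pi / n = d * Real.pi / n := by
      push_cast; ring
    have e2 : turn n (l + d) l = min d (2 * n - d) := by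
      unfold turn; congr 1 <;> omega
    rw [e, e2]
    rcases le_total d n with h | h
    · rw [min_eq_left (by omega), Real.arccos_cos (by positivity)]
      rw [div_le_iff₀ hn', mul_comm]
      gcongr
    · rw [min_eq_right (by omega), Nat.cast_sub (by omega)]
      have : (d : ℝ) * Real.pi / n = 2 * Real.pi - ((2 * n : ℕ) - d : ℝ) * Real.pi / n := by
        push_cast; field_simp; ring
      have h1 : (n : ℝ) ≤ d := by exact_mod_cast h
      have h2 : (d : ℝ) ≤ 2 * n := by exact_mod_cast (show d ≤ 2 * n by omega)
      rw [this, Real.cos_two_pi_sub, Real.arccos_cos]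
      · push_cast
        have : (0 : ℝ) ≤ 2 * n - d := by linarith
        positivity
      · push_cast
        rw [div_le_iff₀ hn', mul_comm]
        gcongr; linarith
  rw [InnerProductGeometry.angle, norm_unitRay, norm_unitRay, inner_unitRay, mul_one, div_one]
  rcases le_total l k with h | h
  · exact key k l h hk
  · rw [← Real.cos_neg, neg_sub, key l k h hl, turn, turn, add_comm]

/-- The vector from `z i` to `z j` has the direction with number `K i j`, in units of `π / n`. -/
structure HasDirections (n : ℕ) (K : Fin 5 → Fin 5 → ℕ) (z : Fin 5 → Plane) : Prop where
  ne_zero : n ≠ 0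
  lt : ∀ i j, K i j < 2 * n
  eq : ∀ i j, i ≠ j → ∃ r : ℝ, 0 < r ∧ z j - z i = r • unitRay n (K i j)

/-- The table of all directions, from those of the vectors from `z i` to `z j` with `i < j`. -/
def fullDirections (n : ℕ) (U : Fin 5 → Fin 5 → ℕ) (i j : Fin 5) : ℕ :=
  if i < j then U i j else (U j i + n) % (2 * n)

theorem hasDirections_of_lt {n : ℕ} {U : Fin 5 → Fin 5 → ℕ} {z : Fin 5 → Plane} (hn : n ≠ 0)
    (hU : ∀ i j, U i j < 2 * n)
    (h : ∀ i j, i < j → ∃ r : ℝ, 0 < r ∧ z j - z i = r • unitRay n (U i j)) :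
    HasDirections n (fullDirections n U) z := by
  refine ⟨hn, fun i j => ?_, fun i j hij => ?_⟩
  · unfold fullDirections
    split_ifs
    · exact hU i j
    · exact Nat.mod_lt _ (by omega)
  · rcases lt_or_gt_of_ne hij with hlt | hlt
    · rw [fullDirections, if_pos hlt]
      exact h i j hlt
    · obtain ⟨r, hr, e⟩ := h j i hlt
      refine ⟨r, hr, ?_⟩
      rw [fullDirections, if_neg hlt.not_gt, unitRay_mod hn, unitRay_add_half hn, smul_neg, ← e,
        neg_sub]

namespace HasDirections

variable {n : ℕ} {K : Fin 5 → Fin 5 → ℕ} {z : Fin 5 → Plane}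

theorem angle_eq (h : HasDirections n K z) {i j l : Fin 5} (hij : i ≠ j) (hlj : l ≠ j) :
    ∠ (z i) (z j) (z l) = turn n (K j i) (K j l) * Real.pi / n := by
  obtain ⟨r, hr, e⟩ := h.eq j i hij.symm
  obtain ⟨s, hs, e'⟩ := h.eq j l hlj.symm
  rw [angle, vsub_eq_sub, vsub_eq_sub, e, e', InnerProductGeometry.angle_smul_left_of_pos _ _ hr,
    InnerProductGeometry.angle_smul_right_of_pos _ _ hs,
    angle_unitRay h.ne_zero (h.lt _ _) (h.lt _ _)]

theorem injective (h : HasDirections n K z) : Function.Injective z := by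
  intro i j hij
  by_contra hne
  obtain ⟨r, hr, e⟩ := h.eq i j hne
  have := congrArg norm e
  rw [hij, sub_self, norm_zero, norm_smul, norm_unitRay, mul_one, Real.norm_of_nonneg hr.le] at this
  linarith

theorem angle_eq_iff (h : HasDirections n K z) {i j l : Fin 5} (hij : i ≠ j) (hlj : l ≠ j) {a b : ℕ}
    (hb : b ≠ 0) :
    ∠ (z i) (z j) (z l) = a * Real.pi / b ↔ turn n (K j i) (K j l) * b = a * n := by
  have := h.ne_zero
  have hpi := Real.pi_ne_zero
  rw [h.angle_eq hij hlj, div_eq_div_iff (by positivity) (by positivity)]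
  rw [mul_right_comm, mul_right_comm (a : ℝ), mul_left_inj' hpi]
  exact_mod_cast Iff.rfl

theorem angle_eq_pi_iff (h : HasDirections n K z) {i j l : Fin 5} (hij : i ≠ j) (hlj : l ≠ j) :
    ∠ (z i) (z j) (z l) = Real.pi ↔ turn n (K j i) (K j l) = n := by
  have := h.angle_eq_iff hij hlj (a := 1) (b := 1) one_ne_zero
  simpa using this

theorem numAngles_le (h : HasDirections n K z)
    (hK : ∀ i j l, i ≠ j → l ≠ j → turn n (K j i) (K j l) = 0 ∨ turn n (K j i) (K j l) = 1 ∨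
      turn n (K j i) (K j l) = 2 ∨ turn n (K j i) (K j l) = 3 ∨ turn n (K j i) (K j l) = n) :
    numAngles (Set.range z) ≤ 3 := by
  have hn : (n : ℝ) ≠ 0 := by exact_mod_cast h.ne_zero
  have hsub : angleSet (Set.range z) ⊆ {1 * Real.pi / n, 2 * Real.pi / n, 3 * Real.pi / n} := by
    rintro θ ⟨⟨h0, hpi⟩, -, ⟨i, rfl⟩, -, ⟨j, rfl⟩, -, ⟨l, rfl⟩, hij, hjl, -, rfl⟩
    have hij' : i ≠ j := fun h => hij (congrArg z h)
    have hlj' : l ≠ j := fun h => hjl (congrArg z h.symm)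
    rw [h.angle_eq hij' hlj'] at h0 hpi ⊢
    have := hK i j l hij' hlj'
    generalize turn n (K j i) (K j l) = m at *
    rcases this with rfl | rfl | rfl | rfl | rfl
    · simp at h0
    · simp
    · simp
    · simp
    · rw [mul_comm, mul_div_assoc, div_self hn, mul_one] at hpi
      exact absurd hpi (lt_irrefl _)
  refine (Set.encard_le_encard hsub).trans ((Set.encard_insert_le _ _).trans ?_)
  refine (add_le_add_left (Set.encard_insert_le _ _) 1).trans ?_
  rw [Set.encard_singleton]
  norm_num

theorem not_collinear (h : HasDirections n K z) {i j l : Fin 5} (hij : i ≠ j) (hlj : l ≠ j)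
    (h0 : turn n (K j i) (K j l) ≠ 0) (hn : turn n (K j i) (K j l) ≠ n) :
    ¬ Collinear ℝ {z i, z j, z l} := by
  rw [collinear_iff_eq_or_eq_or_angle_eq_zero_or_angle_eq_pi]
  rintro (e | e | e | e)
  · exact hij (h.injective e)
  · exact hlj (h.injective e)
  · have := (h.angle_eq_iff hij hlj (a := 0) (b := 1) one_ne_zero).1 (by simpa using e)
    omega
  · exact hn ((h.angle_eq_pi_iff hij hlj).1 e)

theorem encard_range (h : HasDirections n K z) : (Set.range z).encard = 5 := by
  rw [← Set.image_univ, h.injective.encard_image, Set.encard_univ]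
  simp

end HasDirections

theorem ne_of_angle_eq_pi {a b c : Plane} (h : ∠ a b c = Real.pi) : a ≠ b ∧ c ≠ b := by
  have := Real.pi_pos
  constructor
  · rintro rfl; rw [angle_self_left] at h; linarith
  · rintro rfl; rw [angle_self_right] at h; linarith

/-! ### Similarity invariants -/

/-- Some angle of the set is right. -/
def HasRightAngle (S : Set Plane) : Prop :=
  ∃ a ∈ S, ∃ b ∈ S, ∃ c ∈ S, a ≠ b ∧ c ≠ b ∧ ∠ a b c = Real.pi / 2

/-- Some point of the set lies between two others. -/
def HasStraightAngle (S : Set Plane) : Prop :=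
  ∃ a ∈ S, ∃ b ∈ S, ∃ c ∈ S, ∠ a b c = Real.pi

/-- Some point of the set lies between two others in two ways. -/
def HasTwoStraightAngles (S : Set Plane) : Prop :=
  ∃ a ∈ S, ∃ e ∈ S, ∃ c ∈ S, ∠ a e c = Real.pi ∧ ∃ b ∈ S, ∃ d ∈ S, ∠ b e d = Real.pi ∧ a ≠ b ∧ a ≠ d

/-- Four points of the set lie on a line. -/
def HasFourOnLine (S : Set Plane) : Prop :=
  ∃ a ∈ S, ∃ b ∈ S, ∃ c ∈ S, ∠ a b c = Real.pi ∧ ∃ d ∈ S, ∠ b c d = Real.pi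

theorem invariants_of_similar {S T : Set Plane} (h : SimilarSets S T) :
    (HasRightAngle S → HasRightAngle T) ∧ (HasStraightAngle S → HasStraightAngle T) ∧
      (HasTwoStraightAngles S → HasTwoStraightAngles T) ∧ (HasFourOnLine S → HasFourOnLine T) := by
  obtain ⟨f, rfl⟩ := h
  have hf : ∀ {x}, x ∈ S → f x ∈ f '' S := Set.mem_image_of_mem f
  have hne : ∀ {x y}, x ≠ y → f x ≠ f y := fun h => f.injective.ne h
  refine ⟨?_, ?_, ?_, ?_⟩
  · rintro ⟨a, ha, b, hb, c, hc, h1, h2, h⟩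
    exact ⟨_, hf ha, _, hf hb, _, hf hc, hne h1, hne h2, by rwa [angle_dilation]⟩
  · rintro ⟨a, ha, b, hb, c, hc, h⟩
    exact ⟨_, hf ha, _, hf hb, _, hf hc, by rwa [angle_dilation]⟩
  · rintro ⟨a, ha, e, he, c, hc, h, b, hb, d, hd, h', h1, h2⟩
    exact ⟨_, hf ha, _, hf he, _, hf hc, by rwa [angle_dilation], _, hf hb, _, hf hd,
      by rwa [angle_dilation], hne h1, hne h2⟩
  · rintro ⟨a, ha, b, hb, c, hc, h, d, hd, h'⟩
    exact ⟨_, hf ha, _, hf hb, _, hf hc, by rwa [angle_dilation], _, hf hd, by rwa [angle_dilation]⟩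

namespace HasDirections

variable {n : ℕ} {K : Fin 5 → Fin 5 → ℕ} {z : Fin 5 → Plane}

theorem hasRightAngle_iff (h : HasDirections n K z) : HasRightAngle (Set.range z) ↔
    ∃ i j l, i ≠ j ∧ l ≠ j ∧ turn n (K j i) (K j l) * 2 = n := by
  simp only [HasRightAngle, Set.exists_range_iff, h.injective.ne_iff]
  refine exists_congr fun i => exists_congr fun j => exists_congr fun l =>
    and_congr_right fun hij => and_congr_right fun hlj => ?_
  have := h.angle_eq_iff hij hlj (a := 1) (b := 2) two_ne_zero
  simpa using this

theorem angle_eq_pi_iff' (h : HasDirections n K z) {i j l : Fin 5} :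
    ∠ (z i) (z j) (z l) = Real.pi ↔ i ≠ j ∧ l ≠ j ∧ turn n (K j i) (K j l) = n := by
  constructor
  · intro e
    obtain ⟨h1, h2⟩ := ne_of_angle_eq_pi e
    rw [h.injective.ne_iff] at h1 h2
    exact ⟨h1, h2, (h.angle_eq_pi_iff h1 h2).1 e⟩
  · rintro ⟨h1, h2, e⟩
    exact (h.angle_eq_pi_iff h1 h2).2 e

theorem hasStraightAngle_iff (h : HasDirections n K z) : HasStraightAngle (Set.range z) ↔
    ∃ i j l, i ≠ j ∧ l ≠ j ∧ turn n (K j i) (K j l) = n := by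
  simp only [HasStraightAngle, Set.exists_range_iff, h.angle_eq_pi_iff']

theorem hasTwoStraightAngles_iff (h : HasDirections n K z) : HasTwoStraightAngles (Set.range z) ↔
    ∃ a e c, (a ≠ e ∧ c ≠ e ∧ turn n (K e a) (K e c) = n) ∧ ∃ b d,
      (b ≠ e ∧ d ≠ e ∧ turn n (K e b) (K e d) = n) ∧ a ≠ b ∧ a ≠ d := by
  simp only [HasTwoStraightAngles, Set.exists_range_iff, h.angle_eq_pi_iff', h.injective.ne_iff]

theorem hasFourOnLine_iff (h : HasDirections n K z) : HasFourOnLine (Set.range z) ↔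
    ∃ a b c, (a ≠ b ∧ c ≠ b ∧ turn n (K b a) (K b c) = n) ∧ ∃ d,
      (b ≠ c ∧ d ≠ c ∧ turn n (K c b) (K c d) = n) := by
  simp only [HasFourOnLine, Set.exists_range_iff, h.angle_eq_pi_iff']

end HasDirections

/-! ### The five configurations -/

theorem cos_two_pi_div_five : Real.cos (2 * (Real.pi / 5)) = (Real.goldenRatio - 1) / 2 := by
  rw [Real.cos_two_mul, cos_pi_div_five_eq, div_pow, Real.goldenRatio_sq]; ring

theorem inv_goldenRatio_eq : Real.goldenRatio⁻¹ = Real.goldenRatio - 1 := by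
  rw [Real.inv_goldenRatio, ← Real.one_sub_goldenConj]; ring

theorem pentagonVertex_eq :
    pentagonVertex 0 = !₂[1, 0] ∧
    pentagonVertex 1 = !₂[(Real.goldenRatio - 1) / 2, Real.goldenRatio * Real.sin (Real.pi / 5)] ∧
    pentagonVertex 2 = !₂[-(Real.goldenRatio / 2), Real.sin (Real.pi / 5)] ∧
    pentagonVertex 3 = !₂[-(Real.goldenRatio / 2), -Real.sin (Real.pi / 5)] ∧
    pentagonVertex 4 =
      !₂[(Real.goldenRatio - 1) / 2, -(Real.goldenRatio * Real.sin (Real.pi / 5))] := by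
  refine ⟨?_, ?_, ?_, ?_, ?_⟩
  · simp [pentagonVertex]
  · rw [pentagonVertex, ← cos_two_pi_div_five, ← sin_two_pi_div_five]
    simp [mul_div_assoc]
  · rw [pentagonVertex, ← cos_pi_div_five_eq, ← Real.cos_pi_sub, ← Real.sin_pi_sub (Real.pi / 5)]
    have : 2 * Real.pi * ((2 : ℕ) : ℝ) / 5 = Real.pi - Real.pi / 5 := by push_cast; ring
    rw [this]
  · rw [pentagonVertex, ← cos_pi_div_five_eq, ← Real.cos_add_pi, ← Real.sin_add_pi]
    have : 2 * Real.pi * ((3 : ℕ) : ℝ) / 5 = Real.pi / 5 + Real.pi := by push_cast; ring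
    rw [this]
  · rw [pentagonVertex, ← cos_two_pi_div_five, ← sin_two_pi_div_five, ← Real.sin_two_pi_sub,
      ← Real.cos_two_pi_sub (2 * (Real.pi / 5))]
    have : 2 * Real.pi * ((4 : ℕ) : ℝ) / 5 = 2 * Real.pi - 2 * (Real.pi / 5) := by push_cast; ring
    rw [this]

/-- The points of the square with its centre. -/
def squarePoints : Fin 5 → Plane := ![!₂[1, 1], !₂[-1, 1], !₂[-1, -1], !₂[1, -1], !₂[0, 0]]

theorem squareWithCentre_eq : squareWithCentre = Set.range squarePoints := by
  simp only [squarePoints, Matrix.range_cons, Matrix.range_empty, Set.union_empty,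
    Set.singleton_union, squareWithCentre]

/-- The directions between the points of the square, in units of `π / 4`. -/
def squareDirections : Fin 5 → Fin 5 → ℕ :=
  ![![0, 2, 3, 4, 3], ![0, 0, 4, 5, 5], ![0, 0, 0, 6, 7], ![0, 0, 0, 0, 1], ![0, 0, 0, 0, 0]]

theorem unitRay_four_zero : unitRay 4 0 = !₂[0, 1] := by
  simp [unitRay]

theorem unitRay_four_one : unitRay 4 1 = !₂[-(√2 / 2), √2 / 2] := by
  simp [unitRay]

theorem unitRay_four_two : unitRay 4 2 = !₂[-1, 0] := by
  have : ((2 : ℕ) : ℝ) * Real.pi / (4 : ℕ) = Real.pi / 2 := by push_cast; ring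
  simp only [unitRay, this]; simp

theorem unitRay_four_three : unitRay 4 3 = !₂[-(√2 / 2), -(√2 / 2)] := by
  have : ((3 : ℕ) : ℝ) * Real.pi / (4 : ℕ) = Real.pi - Real.pi / 4 := by push_cast; ring
  simp only [unitRay, this, Real.sin_pi_sub, Real.cos_pi_sub]; simp

theorem unitRay_four_add (k : ℕ) : unitRay 4 (k + 4) = -unitRay 4 k :=
  unitRay_add_half (by norm_num) k

theorem hasDirections_square : HasDirections 4 (fullDirections 4 squareDirections) squarePoints := by
  refine hasDirections_of_lt (by norm_num) (by decide) fun i j hij => ?_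
  have h2 : √(2 : ℝ) ^ 2 = 2 := Real.sq_sqrt (by norm_num)
  have h0 : 0 < √(2 : ℝ) := by positivity
  fin_cases i <;> fin_cases j <;> first
    | exact absurd hij (by decide)
    | skip
  · exact ⟨2, by norm_num, by
      ext l; fin_cases l <;> simp [squarePoints, squareDirections, unitRay_four_two]; norm_num⟩
  · exact ⟨2 * √2, by positivity, by
      ext l; fin_cases l <;> simp [squarePoints, squareDirections, unitRay_four_three] <;> grind⟩
  · exact ⟨2, by norm_num, by
      ext l; fin_cases l <;> simp [squarePoints, squareDirections, unitRay_four_add 0,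
        unitRay_four_zero]; norm_num⟩
  · exact ⟨√2, by positivity, by
      ext l; fin_cases l <;> simp [squarePoints, squareDirections, unitRay_four_three] <;> grind⟩
  · exact ⟨2, by norm_num, by
      ext l; fin_cases l <;> simp [squarePoints, squareDirections, unitRay_four_add 0,
        unitRay_four_zero]; norm_num⟩
  · exact ⟨2 * √2, by positivity, by
      ext l; fin_cases l <;> simp [squarePoints, squareDirections, unitRay_four_add 1,
        unitRay_four_one] <;> grind⟩
  · exact ⟨√2, by positivity, by
      ext l; fin_cases l <;> simp [squarePoints, squareDirections, unitRay_four_add 1,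
        unitRay_four_one] <;> grind⟩
  · exact ⟨2, by norm_num, by
      ext l; fin_cases l <;> simp [squarePoints, squareDirections, unitRay_four_add 2,
        unitRay_four_two]; norm_num⟩
  · exact ⟨√2, by positivity, by
      ext l; fin_cases l <;> simp [squarePoints, squareDirections, unitRay_four_add 3,
        unitRay_four_three] <;> grind⟩
  · exact ⟨√2, by positivity, by
      ext l; fin_cases l <;> simp [squarePoints, squareDirections, unitRay_four_one] <;> grind⟩

/-- The vector between two vertices of the regular pentagon: its direction has the number `a + b`. -/
theorem pentagonVertex_sub (a b : ℕ) : pentagonVertex b - pentagonVertex a =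
    (2 * Real.sin ((b - a) * Real.pi / 5)) • unitRay 5 (a + b) := by
  have e1 := Real.cos_sub_cos (2 * Real.pi * b / 5) (2 * Real.pi * a / 5)
  have e2 := Real.sin_sub_sin (2 * Real.pi * b / 5) (2 * Real.pi * a / 5)
  have h1 : (2 * Real.pi * b / 5 + 2 * Real.pi * a / 5) / 2 =
      ((a + b : ℕ) : ℝ) * Real.pi / (5 : ℕ) := by
    push_cast; ring
  have h2 : (2 * Real.pi * b / 5 - 2 * Real.pi * a / 5) / 2 = (b - a) * Real.pi / 5 := by ring
  rw [h1, h2] at e1 e2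
  ext l
  fin_cases l
  · simp only [pentagonVertex, unitRay]
    simpa [mul_right_comm] using e1
  · simp only [pentagonVertex, unitRay]
    simpa using e2

theorem exists_smul_unitRay {a b : ℕ} (hab : a < b) (hb : b < 5) {c : ℝ} (hc : 0 < c) {w : Plane}
    (h : w = c • (pentagonVertex b - pentagonVertex a)) :
    ∃ r : ℝ, 0 < r ∧ w = r • unitRay 5 (a + b) := by
  refine ⟨c * (2 * Real.sin ((b - a) * Real.pi / 5)), ?_, by
    rw [h, pentagonVertex_sub, smul_smul]⟩
  have hpi := Real.pi_pos
  have h1 : (0 : ℝ) < b - a := by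
    rw [sub_pos]; exact_mod_cast hab
  have h2 : (b : ℝ) - a < 5 := by
    have : (b : ℝ) < 5 := by exact_mod_cast hb
    have : (0 : ℝ) ≤ a := by positivity
    linarith
  have := Real.sin_pos_of_pos_of_lt_pi (x := (b - a) * Real.pi / 5) (by positivity) (by
    rw [div_lt_iff₀ (by norm_num), mul_comm]
    gcongr)
  positivity

theorem exists_smul_unitRay_vertex {a b : ℕ} (hab : a < b) (hb : b < 5) :
    ∃ r : ℝ, 0 < r ∧ pentagonVertex b - pentagonVertex a = r • unitRay 5 (a + b) :=
  exists_smul_unitRay hab hb one_pos (one_smul ℝ _).symm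

/-- The points of the regular pentagon. -/
noncomputable def pentagonPoints (i : Fin 5) : Plane := pentagonVertex i

/-- The directions between the points of the pentagon, in units of `π / 5`. -/
def pentagonDirections (i j : Fin 5) : ℕ := i + j

theorem hasDirections_pentagon :
    HasDirections 5 (fullDirections 5 pentagonDirections) pentagonPoints :=
  hasDirections_of_lt (by norm_num) (by decide) fun _ j hij => exists_smul_unitRay_vertex hij j.2

theorem regularPentagon_eq : regularPentagon = Set.range pentagonPoints := by
  ext x
  simp [regularPentagon, pentagonPoints, Fin.exists_fin_succ, eq_comm]

theorem inv_goldenRatio_pos : 0 < Real.goldenRatio⁻¹ := inv_pos.2 Real.goldenRatio_pos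

theorem one_sub_inv_goldenRatio : 1 - Real.goldenRatio⁻¹ = Real.goldenRatio⁻¹ ^ 2 := by
  have := Real.goldenRatio_sq
  rw [inv_goldenRatio_eq]; linear_combination -this

/-- The intersection point of two diagonals divides both of them in the golden ratio. -/
theorem diagonal_point_eq : AffineMap.lineMap (pentagonVertex 0) (pentagonVertex 2)
    Real.goldenRatio⁻¹ = AffineMap.lineMap (pentagonVertex 3) (pentagonVertex 1)
      Real.goldenRatio⁻¹ := by
  obtain ⟨h0, h1, h2, h3, -⟩ := pentagonVertex_eq
  have := Real.goldenRatio_sq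
  rw [h0, h1, h2, h3, inv_goldenRatio_eq]
  ext l
  fin_cases l <;> simp [AffineMap.lineMap_apply] <;> grind

theorem leg_point_eq : AffineMap.lineMap (pentagonVertex 0) (pentagonVertex 1)
    (1 + Real.goldenRatio) = AffineMap.lineMap (pentagonVertex 3) (pentagonVertex 2)
      (1 + Real.goldenRatio) := by
  obtain ⟨h0, h1, h2, h3, -⟩ := pentagonVertex_eq
  have := Real.goldenRatio_sq
  rw [h0, h1, h2, h3]
  ext l
  fin_cases l <;> simp [AffineMap.lineMap_apply] <;> grind

theorem trisector_point_eq : AffineMap.lineMap (pentagonVertex 4) (pentagonVertex 1)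
    Real.goldenRatio⁻¹ = AffineMap.lineMap (pentagonVertex 0) (pentagonVertex 2)
      (Real.goldenRatio⁻¹ ^ 2) := by
  obtain ⟨h0, h1, h2, -, h4⟩ := pentagonVertex_eq
  have := Real.goldenRatio_sq
  rw [h0, h1, h2, h4, inv_goldenRatio_eq]
  ext l
  fin_cases l <;> simp [AffineMap.lineMap_apply] <;> grind

theorem trisector_point_eq' : AffineMap.lineMap (pentagonVertex 1) (pentagonVertex 4)
    Real.goldenRatio⁻¹ = AffineMap.lineMap (pentagonVertex 0) (pentagonVertex 3)
      (Real.goldenRatio⁻¹ ^ 2) := by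
  obtain ⟨h0, h1, -, h3, h4⟩ := pentagonVertex_eq
  have := Real.goldenRatio_sq
  rw [h0, h1, h3, h4, inv_goldenRatio_eq]
  ext l
  fin_cases l <;> simp [AffineMap.lineMap_apply] <;> grind

theorem lineMap_sub_left' (a b : Plane) (t : ℝ) : AffineMap.lineMap a b t - a = t • (b - a) := by
  simp [AffineMap.lineMap_apply]

theorem lineMap_sub_right' (a b : Plane) (t : ℝ) :
    AffineMap.lineMap a b t - b = (1 - t) • (a - b) := by
  rw [AffineMap.lineMap_apply, vsub_eq_sub, vadd_eq_add]; module

/-- The points of the trapezoid with the intersection point of its diagonals. -/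
noncomputable def diagonalPoints : Fin 5 → Plane :=
  ![pentagonVertex 0, pentagonVertex 1,
    AffineMap.lineMap (pentagonVertex 0) (pentagonVertex 2) Real.goldenRatio⁻¹,
    pentagonVertex 2, pentagonVertex 3]

/-- The directions between these points, in units of `π / 5`. -/
def diagonalDirections : Fin 5 → Fin 5 → ℕ :=
  ![![0, 1, 2, 2, 3], ![0, 0, 4, 3, 4], ![0, 0, 0, 2, 4], ![0, 0, 0, 0, 5], ![0, 0, 0, 0, 0]]

theorem hasDirections_diagonal :
    HasDirections 5 (fullDirections 5 diagonalDirections) diagonalPoints := by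
  have hφ := inv_goldenRatio_pos
  have hφ' : 0 < 1 - Real.goldenRatio⁻¹ := by rw [one_sub_inv_goldenRatio]; positivity
  refine hasDirections_of_lt (by norm_num) (by decide) fun i j hij => ?_
  fin_cases i <;> fin_cases j <;> first
    | exact absurd hij (by decide)
    | skip
  · exact exists_smul_unitRay_vertex (a := 0) (b := 1) (by norm_num) (by norm_num)
  · exact exists_smul_unitRay (a := 0) (b := 2) (by norm_num) (by norm_num) hφ
      (lineMap_sub_left' _ _ _)
  · exact exists_smul_unitRay_vertex (a := 0) (b := 2) (by norm_num) (by norm_num)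
  · exact exists_smul_unitRay_vertex (a := 0) (b := 3) (by norm_num) (by norm_num)
  · exact exists_smul_unitRay (a := 1) (b := 3) (by norm_num) (by norm_num) hφ'
      (by
        change AffineMap.lineMap (pentagonVertex 0) (pentagonVertex 2) Real.goldenRatio⁻¹ -
          pentagonVertex 1 = _
        rw [diagonal_point_eq, lineMap_sub_right'])
  · exact exists_smul_unitRay_vertex (a := 1) (b := 2) (by norm_num) (by norm_num)
  · exact exists_smul_unitRay_vertex (a := 1) (b := 3) (by norm_num) (by norm_num)
  · exact exists_smul_unitRay (a := 0) (b := 2) (by norm_num) (by norm_num) hφ'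
      (by
        change pentagonVertex 2 - AffineMap.lineMap (pentagonVertex 0) (pentagonVertex 2)
          Real.goldenRatio⁻¹ = _
        rw [← neg_sub, lineMap_sub_right', ← smul_neg, neg_sub])
  · exact exists_smul_unitRay (a := 1) (b := 3) (by norm_num) (by norm_num) hφ
      (by
        change pentagonVertex 3 - AffineMap.lineMap (pentagonVertex 0) (pentagonVertex 2)
          Real.goldenRatio⁻¹ = _
        rw [diagonal_point_eq, ← neg_sub, lineMap_sub_left', ← smul_neg, neg_sub])
  · exact exists_smul_unitRay_vertex (a := 2) (b := 3) (by norm_num) (by norm_num)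

theorem trapezoidWithDiagonalPoint_eq : trapezoidWithDiagonalPoint = Set.range diagonalPoints := by
  simp only [diagonalPoints, Matrix.range_cons, Matrix.range_empty, Set.union_empty,
    Set.singleton_union, trapezoidWithDiagonalPoint]
  ext; simp only [Set.mem_insert_iff, Set.mem_singleton_iff]; tauto

/-- The points of the trapezoid with the intersection point of its legs. -/
noncomputable def legPoints : Fin 5 → Plane :=
  ![pentagonVertex 0, pentagonVertex 1,
    AffineMap.lineMap (pentagonVertex 0) (pentagonVertex 1) (1 + Real.goldenRatio),
    pentagonVertex 2, pentagonVertex 3]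

/-- The directions between these points, in units of `π / 5`. -/
def legDirections : Fin 5 → Fin 5 → ℕ :=
  ![![0, 1, 1, 2, 3], ![0, 0, 1, 3, 4], ![0, 0, 0, 5, 5], ![0, 0, 0, 0, 5], ![0, 0, 0, 0, 0]]

theorem hasDirections_leg : HasDirections 5 (fullDirections 5 legDirections) legPoints := by
  have hφ := Real.goldenRatio_pos
  have hφ' : 0 < 1 + Real.goldenRatio := by positivity
  refine hasDirections_of_lt (by norm_num) (by decide) fun i j hij => ?_
  fin_cases i <;> fin_cases j <;> first
    | exact absurd hij (by decide)
    | skip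
  · exact exists_smul_unitRay_vertex (a := 0) (b := 1) (by norm_num) (by norm_num)
  · exact exists_smul_unitRay (a := 0) (b := 1) (by norm_num) (by norm_num) hφ'
      (lineMap_sub_left' _ _ _)
  · exact exists_smul_unitRay_vertex (a := 0) (b := 2) (by norm_num) (by norm_num)
  · exact exists_smul_unitRay_vertex (a := 0) (b := 3) (by norm_num) (by norm_num)
  · exact exists_smul_unitRay (a := 0) (b := 1) (by norm_num) (by norm_num) hφ
      (by
        change AffineMap.lineMap (pentagonVertex 0) (pentagonVertex 1) (1 + Real.goldenRatio) -
          pentagonVertex 1 = _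
        rw [lineMap_sub_right']; module)
  · exact exists_smul_unitRay_vertex (a := 1) (b := 2) (by norm_num) (by norm_num)
  · exact exists_smul_unitRay_vertex (a := 1) (b := 3) (by norm_num) (by norm_num)
  · exact exists_smul_unitRay (a := 2) (b := 3) (by norm_num) (by norm_num) hφ
      (by
        change pentagonVertex 2 - AffineMap.lineMap (pentagonVertex 0) (pentagonVertex 1)
          (1 + Real.goldenRatio) = _
        rw [leg_point_eq, ← neg_sub, lineMap_sub_right']; module)
  · exact exists_smul_unitRay (a := 2) (b := 3) (by norm_num) (by norm_num) hφ'
      (by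
        change pentagonVertex 3 - AffineMap.lineMap (pentagonVertex 0) (pentagonVertex 1)
          (1 + Real.goldenRatio) = _
        rw [leg_point_eq, ← neg_sub, lineMap_sub_left']; module)
  · exact exists_smul_unitRay_vertex (a := 2) (b := 3) (by norm_num) (by norm_num)

theorem trapezoidWithLegPoint_eq : trapezoidWithLegPoint = Set.range legPoints := by
  simp only [legPoints, Matrix.range_cons, Matrix.range_empty, Set.union_empty,
    Set.singleton_union, trapezoidWithLegPoint]
  ext; simp only [Set.mem_insert_iff, Set.mem_singleton_iff]; tauto

/-- The points of the trisected triangle. -/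
noncomputable def trisectedPoints : Fin 5 → Plane :=
  ![pentagonVertex 0, pentagonVertex 1,
    AffineMap.lineMap (pentagonVertex 4) (pentagonVertex 1) Real.goldenRatio⁻¹,
    AffineMap.lineMap (pentagonVertex 1) (pentagonVertex 4) Real.goldenRatio⁻¹, pentagonVertex 4]

/-- The directions between these points, in units of `π / 5`. -/
def trisectedDirections : Fin 5 → Fin 5 → ℕ :=
  ![![0, 1, 2, 3, 4], ![0, 0, 5, 5, 5], ![0, 0, 0, 5, 5], ![0, 0, 0, 0, 5], ![0, 0, 0, 0, 0]]

theorem hasDirections_trisected :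
    HasDirections 5 (fullDirections 5 trisectedDirections) trisectedPoints := by
  have hφ := inv_goldenRatio_pos
  have hφ' : 0 < 1 - Real.goldenRatio⁻¹ := by rw [one_sub_inv_goldenRatio]; positivity
  have hφ2 : 0 < Real.goldenRatio⁻¹ ^ 2 := by positivity
  have hφ3 : 0 < 2 * Real.goldenRatio⁻¹ - 1 := by
    have : (2 : ℝ)⁻¹ < Real.goldenRatio⁻¹ :=
      (inv_lt_inv₀ (by norm_num) Real.goldenRatio_pos).2 Real.goldenRatio_lt_two
    linarith
  refine hasDirections_of_lt (by norm_num) (by decide) fun i j hij => ?_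
  fin_cases i <;> fin_cases j <;> first
    | exact absurd hij (by decide)
    | skip
  · exact exists_smul_unitRay_vertex (a := 0) (b := 1) (by norm_num) (by norm_num)
  · exact exists_smul_unitRay (a := 0) (b := 2) (by norm_num) (by norm_num) hφ2
      (by
        change AffineMap.lineMap (pentagonVertex 4) (pentagonVertex 1) Real.goldenRatio⁻¹ -
          pentagonVertex 0 = _
        rw [trisector_point_eq, lineMap_sub_left'])
  · exact exists_smul_unitRay (a := 0) (b := 3) (by norm_num) (by norm_num) hφ2
      (by
        change AffineMap.lineMap (pentagonVertex 1) (pentagonVertex 4) Real.goldenRatio⁻¹ -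
          pentagonVertex 0 = _
        rw [trisector_point_eq', lineMap_sub_left'])
  · exact exists_smul_unitRay_vertex (a := 0) (b := 4) (by norm_num) (by norm_num)
  · exact exists_smul_unitRay (a := 1) (b := 4) (by norm_num) (by norm_num) hφ'
      (lineMap_sub_right' _ _ _)
  · exact exists_smul_unitRay (a := 1) (b := 4) (by norm_num) (by norm_num) hφ
      (lineMap_sub_left' _ _ _)
  · exact exists_smul_unitRay_vertex (a := 1) (b := 4) (by norm_num) (by norm_num)
  · exact exists_smul_unitRay (a := 1) (b := 4) (by norm_num) (by norm_num) hφ3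
      (by
        change AffineMap.lineMap (pentagonVertex 1) (pentagonVertex 4) Real.goldenRatio⁻¹ -
          AffineMap.lineMap (pentagonVertex 4) (pentagonVertex 1) Real.goldenRatio⁻¹ = _
        simp only [AffineMap.lineMap_apply, vsub_eq_sub, vadd_eq_add]; module)
  · exact exists_smul_unitRay (a := 1) (b := 4) (by norm_num) (by norm_num) hφ
      (by
        change pentagonVertex 4 - AffineMap.lineMap (pentagonVertex 4) (pentagonVertex 1)
          Real.goldenRatio⁻¹ = _
        rw [← neg_sub, lineMap_sub_left']; module)
  · exact exists_smul_unitRay (a := 1) (b := 4) (by norm_num) (by norm_num) hφ'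
      (by
        change pentagonVertex 4 - AffineMap.lineMap (pentagonVertex 1) (pentagonVertex 4)
          Real.goldenRatio⁻¹ = _
        rw [← neg_sub, lineMap_sub_right']; module)

theorem trisectedTriangle_eq : trisectedTriangle = Set.range trisectedPoints := by
  simp only [trisectedPoints, Matrix.range_cons, Matrix.range_empty, Set.union_empty,
    Set.singleton_union, trisectedTriangle]
  ext; simp only [Set.mem_insert_iff, Set.mem_singleton_iff]; tauto

/-! ### Recognizing the configurations -/

/-- The remaining two points of the trapezoid, in the frame at the intersection point of the
diagonals. -/
theorem diagonal_frame (x : Plane) (hx : x = AffineMap.lineMap (pentagonVertex 0) (pentagonVertex 2)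
      Real.goldenRatio⁻¹) :
    framePoint x (pentagonVertex 1 - x) (pentagonVertex 0 - x) (-Real.goldenRatio) 0 =
        pentagonVertex 3 ∧
      framePoint x (pentagonVertex 1 - x) (pentagonVertex 0 - x) 0 (-Real.goldenRatio⁻¹) =
        pentagonVertex 2 := by
  obtain ⟨h0, h1, h2, h3, -⟩ := pentagonVertex_eq
  have := Real.goldenRatio_sq
  rw [hx, h0, h1, h2, h3, inv_goldenRatio_eq]
  constructor <;> ext l <;> fin_cases l <;> simp [framePoint, AffineMap.lineMap_apply] <;> grind

/-- The remaining two points of the trapezoid, in the frame at the intersection point of the legs. -/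
theorem leg_frame (x : Plane) (hx : x = AffineMap.lineMap (pentagonVertex 0) (pentagonVertex 1)
      (1 + Real.goldenRatio)) :
    framePoint x (pentagonVertex 1 - x) (pentagonVertex 2 - x) Real.goldenRatio 0 =
        pentagonVertex 0 ∧
      framePoint x (pentagonVertex 1 - x) (pentagonVertex 2 - x) 0 Real.goldenRatio =
        pentagonVertex 3 := by
  obtain ⟨h0, h1, h2, h3, -⟩ := pentagonVertex_eq
  have := Real.goldenRatio_sq
  rw [hx, h0, h1, h2, h3]
  constructor <;> ext l <;> fin_cases l <;> simp [framePoint, AffineMap.lineMap_apply] <;> grind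

theorem pentagon_frame :
    framePoint (pentagonVertex 0) (pentagonVertex 1 - pentagonVertex 0)
        (pentagonVertex 4 - pentagonVertex 0) Real.goldenRatio 1 = pentagonVertex 2 ∧
      framePoint (pentagonVertex 0) (pentagonVertex 1 - pentagonVertex 0)
        (pentagonVertex 4 - pentagonVertex 0) 1 Real.goldenRatio = pentagonVertex 3 := by
  obtain ⟨h0, h1, h2, h3, h4⟩ := pentagonVertex_eq
  have := Real.goldenRatio_sq
  rw [h0, h1, h2, h3, h4]
  constructor <;> ext l <;> fin_cases l <;> simp [framePoint] <;> grind

theorem trisected_frame :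
    framePoint (pentagonVertex 0) (pentagonVertex 1 - pentagonVertex 0)
        (pentagonVertex 4 - pentagonVertex 0) Real.goldenRatio⁻¹ (Real.goldenRatio⁻¹ ^ 2) =
        AffineMap.lineMap (pentagonVertex 4) (pentagonVertex 1) Real.goldenRatio⁻¹ ∧
      framePoint (pentagonVertex 0) (pentagonVertex 1 - pentagonVertex 0)
        (pentagonVertex 4 - pentagonVertex 0) (Real.goldenRatio⁻¹ ^ 2) Real.goldenRatio⁻¹ =
        AffineMap.lineMap (pentagonVertex 1) (pentagonVertex 4) Real.goldenRatio⁻¹ := by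
  rw [← one_sub_inv_goldenRatio]
  constructor <;> rw [AffineMap.lineMap_apply, framePoint, vsub_eq_sub, vadd_eq_add] <;> module

/-- The point beyond `e`, as seen from `a`, at a given multiple of the distance from `e` to `a`. -/
theorem eq_add_smul_of_sbtw {a e c : Plane} {k : ℝ} (h : Sbtw ℝ a e c)
    (hk : dist e c = k * dist e a) : c = e + (-k) • (a - e) := by
  obtain ⟨t, h0, h1, ht⟩ := h.exists_lineMap
  have hea : a - e = (-t) • (c - a) := by
    rw [ht, AffineMap.lineMap_apply, vsub_eq_sub, vadd_eq_add]; module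
  have hec : c - e = (1 - t) • (c - a) := by
    rw [ht, AffineMap.lineMap_apply, vsub_eq_sub, vadd_eq_add]; module
  have hca : 0 < ‖c - a‖ := norm_pos_iff.2 (sub_ne_zero.2 h.left_ne_right.symm)
  rw [dist_comm, dist_comm e, dist_eq_norm, dist_eq_norm, hea, hec, norm_smul, norm_smul, norm_neg,
    Real.norm_of_nonneg h0.le, Real.norm_of_nonneg (by linarith), ← mul_assoc] at hk
  have hk' := mul_right_cancel₀ hca.ne' hk
  rw [hea, smul_smul, neg_mul_neg, ← hk', ← hec, add_sub_cancel]

theorem similar_squareWithCentre {S : Set Plane} (hS : numAngles S ≤ 3) {a b c d e : Plane}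
    (ha : a ∈ S) (hb : b ∈ S) (hc : c ∈ S) (hd : d ∈ S) (he : e ∈ S) (h : IsCrossing a b c d e)
    (hr : ∠ a e b = Real.pi / 2) : SimilarSets {a, b, c, d, e} squareWithCentre := by
  obtain ⟨hn, hac, hbd⟩ := h
  obtain ⟨hn1, hn2, -⟩ := crossing_not_collinear hn hac hbd
  have h1 := crossing_right hS ha hb hc hd he hn hac hbd hr
  have hr2 : ∠ b e c = Real.pi / 2 := by
    have := angle_add_angle_eq_pi_of_angle_eq_pi b hac.angle₁₂₃_eq_pi
    rw [angle_comm b e a] at this; linarith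
  have h2 := crossing_right hS hb hc hd ha he hn1 hbd hac.symm hr2
  have hr3 : ∠ c e d = Real.pi / 2 := by
    have := angle_add_angle_eq_pi_of_angle_eq_pi c hbd.angle₁₂₃_eq_pi
    rw [angle_comm c e b] at this; linarith
  have h3 := crossing_right hS hc hd ha hb he hn2 hac.symm hbd.symm hr3
  have hab := angle_eq_angle_of_dist_eq h1
  have hs := triangle_sum b (show e ≠ a from (ne₁₃_of_not_collinear hn).symm)
  rw [angle_comm e b a] at hab
  have hea : ∠ e a b = Real.pi / 4 := by
    rw [angle_comm a b e] at hab
    linarith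
  have key := similarSets_of_frames (p := e) (a := a) (b := b) (p' := squarePoints 4)
    (a' := squarePoints 0) (b' := squarePoints 1) (by
      rwa [Set.insert_comm, Set.pair_comm e b]) (by
      rw [hr]; symm
      simpa using (hasDirections_square.angle_eq_iff (i := 0) (j := 4) (l := 1) (by decide)
        (by decide) (a := 1) (b := 2) (by decide)).2 (by decide)) (by
      rw [hea]; symm
      simpa using (hasDirections_square.angle_eq_iff (i := 4) (j := 0) (l := 1) (by decide)
        (by decide) (a := 1) (b := 4) (by decide)).2 (by decide)) (-1) 0 0 (-1)
  have e1 : framePoint e (a - e) (b - e) (-1) 0 = c := by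
    rw [eq_add_smul_of_sbtw hac (k := 1) (by rw [one_mul, h1, h2]), framePoint]; simp
  have e2 : framePoint e (a - e) (b - e) 0 (-1) = d := by
    rw [eq_add_smul_of_sbtw hbd (k := 1) (by rw [one_mul, h2, h3]), framePoint]; simp
  rw [e1, e2] at key
  convert key using 1
  · ext; simp only [Set.mem_insert_iff, Set.mem_singleton_iff]; tauto
  · have e3 : framePoint (squarePoints 4) (squarePoints 0 - squarePoints 4)
        (squarePoints 1 - squarePoints 4) (-1) 0 = !₂[-1, -1] := by
      ext l; fin_cases l <;> simp [squarePoints, framePoint]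
    have e4 : framePoint (squarePoints 4) (squarePoints 0 - squarePoints 4)
        (squarePoints 1 - squarePoints 4) 0 (-1) = !₂[1, -1] := by
      ext l; fin_cases l <;> simp [squarePoints, framePoint]
    rw [e3, e4]
    ext; simp only [squareWithCentre, squarePoints, Matrix.cons_val, Set.mem_insert_iff,
      Set.mem_singleton_iff]
    tauto

/-- The law of sines in a triangle with angles `π / 5`, `2π / 5`, `2π / 5`. -/
theorem golden_law_of_sines {a b c : Plane} (ha : ∠ a b c = Real.pi / 5)
    (hb : ∠ c a b = 2 * Real.pi / 5) : dist b c = Real.goldenRatio * dist c a := by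
  have h := law_sin a b c
  rw [ha, hb, mul_div_assoc, sin_two_pi_div_five] at h
  have := sin_pi_div_five_pos
  exact mul_left_cancel₀ this.ne' (by linear_combination h)

theorem similar_trapezoidWithDiagonalPoint {a b c d e : Plane} (h : IsCrossing a b c d e)
    (hr : ∠ a e b = 2 * Real.pi / 5) (hbc : dist e b = dist e c) (had : dist e a = dist e d)
    (hba : ∠ b a e = 2 * Real.pi / 5) (hab : ∠ a b e = Real.pi / 5) :
    SimilarSets {a, b, c, d, e} trapezoidWithDiagonalPoint := by
  obtain ⟨hn, hac, hbd⟩ := h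
  have hl : dist e b = Real.goldenRatio * dist e a := by
    rw [dist_comm e b]
    exact golden_law_of_sines hab (by rwa [angle_comm])
  have hl' := golden_law_of_sines hab (by rwa [angle_comm])
  have key := similarSets_of_frames (p := e) (a := a) (b := b) (p' := diagonalPoints 2)
    (a' := diagonalPoints 1) (b' := diagonalPoints 0) (by
      rwa [Set.insert_comm, Set.pair_comm e b]) (by
      rw [hr]; symm
      simpa using (hasDirections_diagonal.angle_eq_iff (i := 1) (j := 2) (l := 0) (by decide)
        (by decide) (a := 2) (b := 5) (by decide)).2 (by decide)) (by
      rw [angle_comm, hba]; symm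
      simpa using (hasDirections_diagonal.angle_eq_iff (i := 2) (j := 1) (l := 0) (by decide)
        (by decide) (a := 2) (b := 5) (by decide)).2 (by decide))
    (-Real.goldenRatio) 0 0 (-Real.goldenRatio⁻¹)
  have e1 : framePoint e (a - e) (b - e) (-Real.goldenRatio) 0 = c := by
    rw [eq_add_smul_of_sbtw hac (k := Real.goldenRatio) (by rw [← hbc, hl]), framePoint]; simp
  have e2 : framePoint e (a - e) (b - e) 0 (-Real.goldenRatio⁻¹) = d := by
    rw [eq_add_smul_of_sbtw hbd (k := Real.goldenRatio⁻¹) (by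
      rw [← had, hl, inv_mul_cancel_left₀ Real.goldenRatio_ne_zero]), framePoint]; simp
  rw [e1, e2] at key
  convert key using 1
  · ext; simp only [Set.mem_insert_iff, Set.mem_singleton_iff]; tauto
  · have e3 : framePoint (diagonalPoints 2) (diagonalPoints 1 - diagonalPoints 2)
        (diagonalPoints 0 - diagonalPoints 2) (-Real.goldenRatio) 0 = pentagonVertex 3 :=
      (diagonal_frame _ rfl).1
    have e4 : framePoint (diagonalPoints 2) (diagonalPoints 1 - diagonalPoints 2)
        (diagonalPoints 0 - diagonalPoints 2) 0 (-Real.goldenRatio⁻¹) = pentagonVertex 2 :=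
      (diagonal_frame _ rfl).2
    rw [e3, e4]
    ext; simp only [trapezoidWithDiagonalPoint, diagonalPoints, Matrix.cons_val,
      Set.mem_insert_iff, Set.mem_singleton_iff]
    tauto

theorem similar_of_isCrossing_acute {S : Set Plane} (hS : numAngles S ≤ 3) {a b c d e : Plane}
    (ha : a ∈ S) (hb : b ∈ S) (hc : c ∈ S) (hd : d ∈ S) (he : e ∈ S) (h : IsCrossing a b c d e)
    (hr : ∠ a e b < Real.pi / 2) : SimilarSets {a, b, c, d, e} trapezoidWithDiagonalPoint := by
  obtain ⟨h1, h2, h3, ⟨h4, h5⟩ | ⟨h4, h5⟩⟩ := crossing_acute hS ha hb hc hd he h.1 h.2.1 h.2.2 hr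
  · exact similar_trapezoidWithDiagonalPoint h h1 h2 h3 h4 h5
  · have := similar_trapezoidWithDiagonalPoint (a := b) (b := a) (c := d) (d := c) (e := e)
      ⟨by rw [Set.insert_comm]; exact h.1, h.2.2, h.2.1⟩ (by rwa [angle_comm]) h3 h2 h5 h4
    convert this using 1
    ext; simp only [Set.mem_insert_iff, Set.mem_singleton_iff]; tauto

theorem similar_of_isCrossing {S : Set Plane} (hS : numAngles S ≤ 3) {a b c d e : Plane}
    (ha : a ∈ S) (hb : b ∈ S) (hc : c ∈ S) (hd : d ∈ S) (he : e ∈ S) (h : IsCrossing a b c d e) :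
    SimilarSets {a, b, c, d, e} squareWithCentre ∨
      SimilarSets {a, b, c, d, e} trapezoidWithDiagonalPoint := by
  rcases lt_trichotomy (∠ a e b) (Real.pi / 2) with hr | hr | hr
  · exact .inr (similar_of_isCrossing_acute hS ha hb hc hd he h hr)
  · exact .inl (similar_squareWithCentre hS ha hb hc hd he h hr)
  · right
    have hsum := angle_add_angle_eq_pi_of_angle_eq_pi b h.2.1.angle₁₂₃_eq_pi
    rw [angle_comm b e a] at hsum
    have := similar_of_isCrossing_acute hS hb hc hd ha he
      ⟨(crossing_not_collinear h.1 h.2.1 h.2.2).1, h.2.2, h.2.1.symm⟩ (by linarith)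
    convert this using 1
    ext; simp only [Set.mem_insert_iff, Set.mem_singleton_iff]; tauto

theorem similar_of_isLegs {S : Set Plane} (hS : numAngles S ≤ 3) {a b c d e : Plane}
    (ha : a ∈ S) (hb : b ∈ S) (hc : c ∈ S) (hd : d ∈ S) (he : e ∈ S) (h : IsLegs a b c d e) :
    SimilarSets {a, b, c, d, e} trapezoidWithLegPoint := by
  obtain ⟨hn, hbd, hce⟩ := h
  obtain ⟨h1, h2, h3, h4, h5, h6⟩ := legs_angles hS ha hb hc hd he hn hbd hce
  have hs := sin_pi_div_five_pos
  have h7 : ∠ b c a = 2 * Real.pi / 5 := by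
    have := triangle_sum c hbd.left_ne
    rw [angle_comm b c a]; linarith
  have hbd' : dist b d = dist c b := by
    have := law_sin d c b
    rw [angle_comm d c b, h4, h3] at this
    rw [← mul_left_cancel₀ hs.ne' this]
  have hce' : dist c e = dist c b := by
    have := law_sin e b c
    rw [angle_comm e b c, h6, h5, dist_comm b c] at this
    exact (mul_left_cancel₀ hs.ne' this).symm
  have hac : dist a c = Real.goldenRatio * dist c b :=
    golden_law_of_sines h1 (by rwa [angle_comm])
  have hab : dist a b = Real.goldenRatio * dist c b := by
    rw [dist_comm c b]; exact golden_law_of_sines (by rwa [angle_comm]) h7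
  have hφ := Real.goldenRatio_ne_zero
  have key := similarSets_of_frames (p := a) (a := b) (b := c) (p' := legPoints 2)
    (a' := legPoints 1) (b' := legPoints 3) (by
      intro hcol
      rcases collinear_iff_eq_or_eq_or_angle_eq_zero_or_angle_eq_pi.1 hcol with e | e | e | e
      · exact hbd.left_ne e
      · subst e; simp at h4; have := Real.pi_pos; linarith
      · have := Real.pi_pos; linarith
      · have := Real.pi_pos; linarith) (by
      rw [h1]; symm
      simpa using (hasDirections_leg.angle_eq_iff (i := 1) (j := 2) (l := 3) (by decide)
        (by decide) (a := 1) (b := 5) (by decide)).2 (by decide)) (by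
      rw [h2]; symm
      simpa using (hasDirections_leg.angle_eq_iff (i := 2) (j := 1) (l := 3) (by decide)
        (by decide) (a := 2) (b := 5) (by decide)).2 (by decide))
    Real.goldenRatio 0 0 Real.goldenRatio
  have e1 : framePoint a (b - a) (c - a) Real.goldenRatio 0 = d := by
    rw [eq_add_smul_of_sbtw hbd (k := Real.goldenRatio⁻¹) (by
      rw [hbd', dist_comm b a, hab, inv_mul_cancel_left₀ hφ]), framePoint, inv_goldenRatio_eq]
    module
  have e2 : framePoint a (b - a) (c - a) 0 Real.goldenRatio = e := by
    rw [eq_add_smul_of_sbtw hce (k := Real.goldenRatio⁻¹) (by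
      rw [hce', dist_comm c a, hac, inv_mul_cancel_left₀ hφ]), framePoint, inv_goldenRatio_eq]
    module
  rw [e1, e2] at key
  convert key using 1
  have e3 : framePoint (legPoints 2) (legPoints 1 - legPoints 2)
      (legPoints 3 - legPoints 2) Real.goldenRatio 0 = pentagonVertex 0 := (leg_frame _ rfl).1
  have e4 : framePoint (legPoints 2) (legPoints 1 - legPoints 2)
      (legPoints 3 - legPoints 2) 0 Real.goldenRatio = pentagonVertex 3 := (leg_frame _ rfl).2
  rw [e3, e4]
  ext; simp only [trapezoidWithLegPoint, legPoints, Matrix.cons_val, Set.mem_insert_iff,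
    Set.mem_singleton_iff]
  tauto

theorem similar_of_isFan {S : Set Plane} (hS : numAngles S ≤ 3) {p a b c d : Plane} (hp : p ∈ S)
    (ha : a ∈ S) (hb : b ∈ S) (hc : c ∈ S) (hd : d ∈ S) (h : IsFan p a b c d) :
    SimilarSets {p, a, b, c, d} regularPentagon ∨
      SimilarSets {p, a, b, c, d} trisectedTriangle := by
  obtain ⟨-, -, -, -, -, h3, -⟩ := fan_equal_gaps hS hp ha hb hc hd h
  obtain ⟨h1, hda, -⟩ := fan_distances hS hp ha hb hc hd h
  have hn : ¬ Collinear ℝ {p, a, d} := by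
    obtain ⟨s, -, -, hs, -⟩ := h
    exact not_collinear_of_cross_pos hs
  have hpa : ∠ p a d = Real.pi / 5 := by
    have e := angle_eq_angle_of_dist_eq hda
    have := triangle_sum d (ne₁₂_of_not_collinear hn)
    rw [e] at this
    linarith
  rcases fan_coordinates hS hp ha hb hc hd h with ⟨hb', hc'⟩ | ⟨hb', hc'⟩
  · left
    have key := similarSets_of_frames (p := p) (a := a) (b := d) (p' := pentagonPoints 0)
      (a' := pentagonPoints 1) (b' := pentagonPoints 4) hn (by
        rw [h3, h1]; symm
        rw [(hasDirections_pentagon.angle_eq_iff (i := 1) (j := 0) (l := 4) (by decide)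
          (by decide) (a := 3) (b := 5) (by decide)).2 (by decide)]
        push_cast; ring) (by
        rw [hpa]; symm
        simpa using (hasDirections_pentagon.angle_eq_iff (i := 0) (j := 1) (l := 4) (by decide)
          (by decide) (a := 1) (b := 5) (by decide)).2 (by decide))
      Real.goldenRatio 1 1 Real.goldenRatio
    rw [← hb', ← hc'] at key
    convert key using 1
    · ext; simp only [Set.mem_insert_iff, Set.mem_singleton_iff]; tauto
    · have e3 : framePoint (pentagonPoints 0) (pentagonPoints 1 - pentagonPoints 0)
          (pentagonPoints 4 - pentagonPoints 0) Real.goldenRatio 1 = pentagonVertex 2 :=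
        pentagon_frame.1
      have e4 : framePoint (pentagonPoints 0) (pentagonPoints 1 - pentagonPoints 0)
          (pentagonPoints 4 - pentagonPoints 0) 1 Real.goldenRatio = pentagonVertex 3 :=
        pentagon_frame.2
      rw [e3, e4]
      change _ = {pentagonVertex 0, pentagonVertex 1, pentagonVertex 4, pentagonVertex 2,
        pentagonVertex 3}
      ext; simp only [regularPentagon, Set.mem_insert_iff, Set.mem_singleton_iff]; tauto
  · right
    have key := similarSets_of_frames (p := p) (a := a) (b := d) (p' := trisectedPoints 0)
      (a' := trisectedPoints 1) (b' := trisectedPoints 4) hn (by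
        rw [h3, h1]; symm
        rw [(hasDirections_trisected.angle_eq_iff (i := 1) (j := 0) (l := 4) (by decide)
          (by decide) (a := 3) (b := 5) (by decide)).2 (by decide)]
        push_cast; ring) (by
        rw [hpa]; symm
        simpa using (hasDirections_trisected.angle_eq_iff (i := 0) (j := 1) (l := 4) (by decide)
          (by decide) (a := 1) (b := 5) (by decide)).2 (by decide))
      Real.goldenRatio⁻¹ (Real.goldenRatio⁻¹ ^ 2) (Real.goldenRatio⁻¹ ^ 2) Real.goldenRatio⁻¹
    rw [← hb', ← hc'] at key
    convert key using 1
    · ext; simp only [Set.mem_insert_iff, Set.mem_singleton_iff]; tauto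
    · have e3 : framePoint (trisectedPoints 0) (trisectedPoints 1 - trisectedPoints 0)
          (trisectedPoints 4 - trisectedPoints 0) Real.goldenRatio⁻¹ (Real.goldenRatio⁻¹ ^ 2) =
          AffineMap.lineMap (pentagonVertex 4) (pentagonVertex 1) Real.goldenRatio⁻¹ :=
        trisected_frame.1
      have e4 : framePoint (trisectedPoints 0) (trisectedPoints 1 - trisectedPoints 0)
          (trisectedPoints 4 - trisectedPoints 0) (Real.goldenRatio⁻¹ ^ 2) Real.goldenRatio⁻¹ =
          AffineMap.lineMap (pentagonVertex 1) (pentagonVertex 4) Real.goldenRatio⁻¹ :=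
        trisected_frame.2
      rw [e3, e4]
      ext; simp only [trisectedTriangle, trisectedPoints, Matrix.cons_val, Set.mem_insert_iff,
        Set.mem_singleton_iff]
      tauto

/-! ### The optimal configurations -/

/-- A set without a fan is handled through its subsets with five and six points. -/
theorem exists_similar_of_five_le {S : Set Plane} (hcol : ¬ Collinear ℝ S) (hS : numAngles S ≤ 3)
    (h5 : 5 ≤ S.encard) : ∃ i, SimilarSets S (optimalConfig i) := by
  by_cases hf : HasNoFan S
  · obtain ⟨p, hp⟩ : S.Nonempty := by
      rw [Set.nonempty_iff_ne_empty]; rintro rfl; simp at h5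
    obtain ⟨a, ha, b, hb, hab⟩ := exists_cross_pos hcol p
    have hn : ¬ Collinear ℝ {p, a, b} := by
      rw [collinear_iff_cross]; exact hab.ne'
    have hsub : {p, a, b} ⊆ S := by
      rintro x (rfl | rfl | rfl) <;> assumption
    have h3 : ({p, a, b} : Set Plane).encard ≤ 3 := by
      refine (Set.encard_insert_le _ _).trans ?_
      refine (add_le_add_left (Set.encard_insert_le _ _) 1).trans ?_
      rw [Set.encard_singleton]; norm_num
    have key : ∀ k : ℕ, 3 ≤ k → (k : ℕ∞) ≤ S.encard → ∃ F : Finset Plane, (F : Set Plane) ⊆ S ∧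
        F.card = k ∧ ¬ Collinear ℝ (F : Set Plane) := by
      intro k hk hkS
      obtain ⟨r, h1, h2, h3⟩ := Set.exists_superset_subset_encard_eq hsub
        (h3.trans (by exact_mod_cast hk)) hkS
      have hfin : r.Finite := Set.finite_of_encard_eq_coe h3
      refine ⟨hfin.toFinset, by simpa using h2, ?_, fun hc => hn (hc.subset (by simpa using h1))⟩
      rw [hfin.encard_eq_coe_toFinset_card] at h3
      exact_mod_cast h3
    have h6 : ¬ ((6 : ℕ) : ℕ∞) ≤ S.encard := by
      intro h
      obtain ⟨F, hF, hc, hn⟩ := key 6 (by norm_num) h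
      exact (classification hS hF hn hf).1 hc
    obtain ⟨F, hF, hc, hn⟩ := key 5 (by norm_num) h5
    have hFS : (F : Set Plane) = S := by
      refine F.finite_toSet.eq_of_subset_of_encard_le hF ?_
      rw [Set.encard_coe_eq_coe_finsetCard, hc]
      exact Order.le_of_lt_add_one (not_le.1 h6)
    obtain ⟨a, b, c, d, e, he, h⟩ := (classification hS hF hn hf).2 hc
    rw [hFS] at he
    have hm : a ∈ S ∧ b ∈ S ∧ c ∈ S ∧ d ∈ S ∧ e ∈ S := by rw [he]; simp
    obtain ⟨ha, hb, hc, hd, he'⟩ := hm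
    rw [he]
    rcases h with h | h
    · rcases similar_of_isCrossing hS ha hb hc hd he' h with h | h
      · exact ⟨0, h⟩
      · exact ⟨2, h⟩
    · exact ⟨3, similar_of_isLegs hS ha hb hc hd he' h⟩
  · simp only [HasNoFan, not_forall, not_not] at hf
    obtain ⟨p, hp, a, ha, b, hb, c, hc, d, hd, h⟩ := hf
    rw [eq_fan hS hp ha hb hc hd h]
    rcases similar_of_isFan hS hp ha hb hc hd h with h | h
    · exact ⟨1, h⟩
    · exact ⟨4, h⟩

theorem HasDirections.isAdmissible {n : ℕ} {K : Fin 5 → Fin 5 → ℕ} {z : Fin 5 → Plane}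
    (h : HasDirections n K z)
    (hK : ∀ i j l, i ≠ j → l ≠ j → turn n (K j i) (K j l) = 0 ∨ turn n (K j i) (K j l) = 1 ∨
      turn n (K j i) (K j l) = 2 ∨ turn n (K j i) (K j l) = 3 ∨ turn n (K j i) (K j l) = n)
    (h0 : turn n (K 0 1) (K 0 4) ≠ 0) (hn : turn n (K 0 1) (K 0 4) ≠ n) :
    IsAdmissible 3 (Set.range z) ∧ (Set.range z).encard = 5 := by
  refine ⟨⟨fun hc => h.not_collinear (i := 1) (j := 0) (l := 4) (by decide) (by decide) h0 hn
    (hc.subset ?_), h.numAngles_le hK⟩, h.encard_range⟩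
  rintro x (rfl | rfl | rfl) <;> exact Set.mem_range_self _

theorem optimalConfig_isAdmissible (i : Fin 5) :
    IsAdmissible 3 (optimalConfig i) ∧ (optimalConfig i).encard = 5 := by
  fin_cases i
  · change IsAdmissible 3 squareWithCentre ∧ squareWithCentre.encard = 5
    rw [squareWithCentre_eq]
    exact hasDirections_square.isAdmissible (by decide) (by decide) (by decide)
  · change IsAdmissible 3 regularPentagon ∧ regularPentagon.encard = 5
    rw [regularPentagon_eq]
    exact hasDirections_pentagon.isAdmissible (by decide) (by decide) (by decide)
  · change IsAdmissible 3 trapezoidWithDiagonalPoint ∧ trapezoidWithDiagonalPoint.encard = 5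
    rw [trapezoidWithDiagonalPoint_eq]
    exact hasDirections_diagonal.isAdmissible (by decide) (by decide) (by decide)
  · change IsAdmissible 3 trapezoidWithLegPoint ∧ trapezoidWithLegPoint.encard = 5
    rw [trapezoidWithLegPoint_eq]
    exact hasDirections_leg.isAdmissible (by decide) (by decide) (by decide)
  · change IsAdmissible 3 trisectedTriangle ∧ trisectedTriangle.encard = 5
    rw [trisectedTriangle_eq]
    exact hasDirections_trisected.isAdmissible (by decide) (by decide) (by decide)

theorem SimilarSets.encard_eq {S T : Set Plane} (h : SimilarSets S T) : S.encard = T.encard := by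
  obtain ⟨f, rfl⟩ := h
  rw [f.injective.encard_image]

theorem SimilarSets.angleSet_subset {S T : Set Plane} (h : SimilarSets S T) :
    angleSet S ⊆ angleSet T := by
  obtain ⟨f, rfl⟩ := h
  rintro θ ⟨hθ, a, ha, b, hb, c, hc, h1, h2, h3, rfl⟩
  exact ⟨hθ, _, Set.mem_image_of_mem f ha, _, Set.mem_image_of_mem f hb, _,
    Set.mem_image_of_mem f hc, f.injective.ne h1, f.injective.ne h2, f.injective.ne h3,
    angle_dilation f a b c⟩

theorem SimilarSets.collinear {S T : Set Plane} (h : SimilarSets S T) (hS : Collinear ℝ S) :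
    Collinear ℝ T := by
  by_contra hT
  obtain ⟨f, rfl⟩ := h
  obtain ⟨p, hp⟩ : (f '' S).Nonempty := by
    rw [Set.nonempty_iff_ne_empty]
    intro h; rw [h] at hT; exact hT (collinear_empty ℝ _)
  obtain ⟨a, ha, b, hb, hab⟩ := exists_cross_pos hT p
  have hn : ¬ Collinear ℝ {a, p, b} := by
    rw [Set.insert_comm, collinear_iff_cross]; exact hab.ne'
  obtain ⟨p, hp, rfl⟩ := hp
  obtain ⟨a, ha, rfl⟩ := ha
  obtain ⟨b, hb, rfl⟩ := hb
  refine hn ?_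
  have hc : Collinear ℝ {a, p, b} := hS.subset (by rintro x (rfl | rfl | rfl) <;> assumption)
  rw [collinear_iff_eq_or_eq_or_angle_eq_zero_or_angle_eq_pi] at hc ⊢
  rwa [angle_dilation, f.injective.eq_iff, f.injective.eq_iff]

theorem SimilarSets.isAdmissible {k : ℕ} {S T : Set Plane} (h : SimilarSets S T)
    (hT : IsAdmissible k T) : IsAdmissible k S :=
  ⟨fun hc => hT.1 (h.collinear hc), (Set.encard_le_encard h.angleSet_subset).trans hT.2⟩

theorem isGreatest_admissibleSizes_three : IsGreatest (admissibleSizes 3) 5 := by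
  refine ⟨⟨optimalConfig 0, optimalConfig_isAdmissible 0⟩, ?_⟩
  rintro - ⟨S, ⟨hcol, hS⟩, rfl⟩
  by_contra! h
  obtain ⟨i, hi⟩ := exists_similar_of_five_le hcol hS h.le
  rw [hi.encard_eq, (optimalConfig_isAdmissible i).2] at h
  exact lt_irrefl _ h

theorem isOptimal_three_iff (S : Set Plane) :
    IsOptimal 3 S ↔ ∃ i : Fin 5, SimilarSets S (optimalConfig i) := by
  constructor
  · rintro ⟨⟨hcol, hS⟩, hmax⟩
    exact exists_similar_of_five_le hcol hS (hmax.unique isGreatest_admissibleSizes_three).ge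
  · rintro ⟨i, hi⟩
    obtain ⟨h1, h2⟩ := optimalConfig_isAdmissible i
    exact ⟨hi.isAdmissible h1, by rw [hi.encard_eq, h2]; exact isGreatest_admissibleSizes_three⟩

theorem invariants_square : HasRightAngle squareWithCentre := by
  rw [squareWithCentre_eq, hasDirections_square.hasRightAngle_iff]
  decide

theorem invariants_pentagon :
    ¬ HasRightAngle regularPentagon ∧ ¬ HasStraightAngle regularPentagon := by
  rw [regularPentagon_eq, hasDirections_pentagon.hasRightAngle_iff,
    hasDirections_pentagon.hasStraightAngle_iff]
  decide

theorem invariants_diagonal : ¬ HasRightAngle trapezoidWithDiagonalPoint ∧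
    HasStraightAngle trapezoidWithDiagonalPoint ∧
    HasTwoStraightAngles trapezoidWithDiagonalPoint ∧
    ¬ HasFourOnLine trapezoidWithDiagonalPoint := by
  rw [trapezoidWithDiagonalPoint_eq, hasDirections_diagonal.hasRightAngle_iff,
    hasDirections_diagonal.hasStraightAngle_iff, hasDirections_diagonal.hasTwoStraightAngles_iff,
    hasDirections_diagonal.hasFourOnLine_iff]
  decide

theorem invariants_leg : ¬ HasRightAngle trapezoidWithLegPoint ∧
    HasStraightAngle trapezoidWithLegPoint ∧ ¬ HasTwoStraightAngles trapezoidWithLegPoint := by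
  rw [trapezoidWithLegPoint_eq, hasDirections_leg.hasRightAngle_iff,
    hasDirections_leg.hasStraightAngle_iff, hasDirections_leg.hasTwoStraightAngles_iff]
  decide

theorem invariants_trisected : ¬ HasRightAngle trisectedTriangle ∧
    HasStraightAngle trisectedTriangle ∧ HasTwoStraightAngles trisectedTriangle ∧
    HasFourOnLine trisectedTriangle := by
  rw [trisectedTriangle_eq, hasDirections_trisected.hasRightAngle_iff,
    hasDirections_trisected.hasStraightAngle_iff, hasDirections_trisected.hasTwoStraightAngles_iff,
    hasDirections_trisected.hasFourOnLine_iff]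
  decide

theorem not_similarSets_of_lt {i j : Fin 5} (hij : i < j) :
    ¬ SimilarSets (optimalConfig i) (optimalConfig j) := by
  intro h
  obtain ⟨r1, s1, t1, f1⟩ := invariants_of_similar h
  obtain ⟨r2, s2, t2, f2⟩ := invariants_of_similar h.symm
  have hp := invariants_pentagon
  have hd := invariants_diagonal
  have hl := invariants_leg
  have ht := invariants_trisected
  fin_cases i <;> fin_cases j <;> first
    | exact absurd hij (by decide)
    | skip
  · exact hp.1 (r1 invariants_square)
  · exact hd.1 (r1 invariants_square)
  · exact hl.1 (r1 invariants_square)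
  · exact ht.1 (r1 invariants_square)
  · exact hp.2 (s2 hd.2.1)
  · exact hp.2 (s2 hl.2.1)
  · exact hp.2 (s2 ht.2.1)
  · exact hl.2.2 (t1 hd.2.2.1)
  · exact hd.2.2.2 (f2 ht.2.2.2)
  · exact hl.2.2 (t2 ht.2.2.1)

theorem theorem2 :
    -- `P(3) = 5`
    IsGreatest (admissibleSizes 3) 5 ∧
    -- the optimal configurations are, up to similarity, the five listed ones
    (∀ S : Set Plane, IsOptimal 3 S ↔ ∃ i : Fin 5, SimilarSets S (optimalConfig i)) ∧
    -- and no two of these are similar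
    (∀ i j : Fin 5, i ≠ j → ¬ SimilarSets (optimalConfig i) (optimalConfig j)) := by
  refine ⟨isGreatest_admissibleSizes_three, isOptimal_three_iff, fun i j hij h => ?_⟩
  rcases lt_or_gt_of_ne hij with hlt | hlt
  · exact not_similarSets_of_lt hlt h
  · exact not_similarSets_of_lt hlt h.symm
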